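/- **Setting.** Let $(Y,\omega)$ be a symplectic manifold of dimension $2n+2$ ($n\ge 0$) and $v:Y\to\mathbb C$ a smooth map with finitely many critical values; let $C\subset\mathbb C$ be the set of regular values, $Y_c=v^{-1}(c)$. Assume that $v:v^{-1}(C)\to C$ is a symplectic fibration (locally trivial, with the forms $\omega|_{Y_c}$ symplectic and preserved by the trivializations), and that symplectic parallel transport is defined: with $\mathrm{Hor}=(\ker dv)^{\perp_\omega}$, every smooth path $\gamma:[a,b]\to C$ has, through each point of $Y_{\gamma(a)}$, a horizontal lift over all of $[a,b]$. (The form $\omega$ need not be exact.) Write $\Phi_{\gamma(a)\to\gamma(b)}:Y_{\gamma(a)}\to Y_{\gamma(b)}$ for the parallel transport along $\gamma$. Let $\gamma:\mathbb R\to C$ be a smooth embedded curve, $\ell\subset Y_{\gamma(0)}$ an embedded Lagrangian submanifold of the fiber, and let $L=\bigcup_{t\in\mathbb R}\Phi_{\gamma(0)\to\gamma(t)}(\ell)\subset Y$ be the (embedded) fibered Lagrangian over $\gamma$. Assume that $\gamma$ passes through $-\epsilon$ for some real $\epsilon>0$, and put $L_{-\epsilon}=L\cap Y_{-\epsilon}$.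 Let $h_s(t)$, $s\in[0,1]$, $t\in\mathbb R$, be a smooth homotopy of maps $\mathbb R\to C$ with $h_0=\gamma$ and $h_s(t)=\gamma(t)$ for all $t$ outside a neighborhood of $[0,1]$ (the end path $h_1|_{[0,1]}$ is arbitrary and may be constant). **Statement.** 1. Every $p\in L$ is $p=\Phi_{-\epsilon\to\gamma(t)}(q)$ for a unique pair $(q,t)\in L_{-\epsilon}\times\mathbb R$, the transport being along $\gamma$. 2. Let $\psi:L\times[0,1]\to Y$ be given by $$\psi(p,s)=\Phi_{h_0(t)\to h_s(t)}(p)\qquad\text{for } p=\Phi_{-\epsilon\to\gamma(t)}(q),$$ where the transport is along the path $s'\mapsto h_{s'}(t)$, $0\le s'\le s$. Suppose that $\psi$ is a Lagrangian isotopy, or, more generally, that $\psi$ is smooth and $\psi_s^*\omega=0$ for every $s\in[0,1]$ (the maps $\psi_s=\psi(\cdot,s)$ need not be embeddings). Then $\psi$ is exact: there is a smooth function $H:L\times[0,1]\to\mathbb R$ with $$\psi^*\omega=d(H\,ds)=dH\wedge ds .$$ Moreover, every smooth closed $1$-form $b$ on $L\times[0,1]$ with $\psi^*\omega=b\wedge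 ds$ is exact, that is, $b=d\widetilde H$ for a smooth function $\widetilde H$ on $L\times[0,1]$. -/

import Mathlib

open Set Topology Manifold
open scoped ContDiff

noncomputable section

/-! ### Differential forms on manifolds (possibly with boundary or corners) -/

section Forms

variable {E : Type*} [NormedAddCommGroup E] [NormedSpace ℝ E]
  {H : Type*} [TopologicalSpace H] (I : ModelWithCorners ℝ E H)
  (M : Type*) [TopologicalSpace M] [ChartedSpace H M]
  {E' : Type*} [NormedAddCommGroup E'] [NormedSpace ℝ E']
  {H' : Type*} [TopologicalSpace H'] (I' : ModelWithCorners ℝ E' H')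
  {N : Type*} [TopologicalSpace N] [ChartedSpace H' N]

/-- A (not necessarily smooth) real differential `k`-form on the manifold `M`. -/
abbrev DiffForm (k : ℕ) : Type _ :=
  ∀ p : M, (TangentSpace I p) [⋀^Fin k]→L[ℝ] ℝ

variable {M}

/-- The coordinate expression of a form in the preferred chart around `x₀`; it is meaningful on
the target `(extChartAt I x₀).target` of that chart. -/
def DiffForm.inChart {k : ℕ} (α : DiffForm I M k) (x₀ : M) (y : E) : E [⋀^Fin k]→L[ℝ] ℝ :=
  (α ((extChartAt I x₀).symm y)).compContinuousLinearMap
    (mfderivWithin 𝓘(ℝ, E) I (extChartAt I x₀).symm (range I) y)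

/-- A form is smooth if all its coordinate expressions are smooth. -/
def DiffForm.IsSmooth {k : ℕ} (α : DiffForm I M k) : Prop :=
  ∀ x₀ : M, ContDiffOn ℝ ∞ (α.inChart I x₀) (extChartAt I x₀).target

/-- A form is closed if the exterior derivative of each coordinate expression vanishes. -/
def DiffForm.IsClosed {k : ℕ} (α : DiffForm I M k) : Prop :=
  ∀ x₀ : M, ∀ y ∈ (extChartAt I x₀).target,
    extDerivWithin (α.inChart I x₀) (extChartAt I x₀).target y = 0

/-- The pullback `f^* Ω` of a form along a map `f : M → N`. -/
def DiffForm.pullback {k : ℕ} (f : M → N) (Ω : DiffForm I' N k) : DiffForm I M k :=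
  fun p => (Ω (f p)).compContinuousLinearMap (mfderiv I I' f p)

/-- The differential `df` of a real function, as a `1`-form. -/
def DiffForm.d (f : M → ℝ) : DiffForm I M 1 := fun p =>
  ContinuousAlternatingMap.ofSubsingleton ℝ (TangentSpace I p) ℝ (0 : Fin 1)
    (mfderiv I 𝓘(ℝ, ℝ) f p : TangentSpace I p →L[ℝ] ℝ)

/-- The value `(α ∧ β)_p (X, Z) = α(X) β(Z) - α(Z) β(X)` of the wedge product of `1`-forms. -/
def DiffForm.wedge (α β : DiffForm I M 1) (p : M) (X Z : TangentSpace I p) : ℝ :=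
  α p ![X] * β p ![Z] - α p ![Z] * β p ![X]

/-- A symplectic form: a smooth, closed, nondegenerate `2`-form. -/
structure IsSymplecticForm (Ω : DiffForm I M 2) : Prop where
  smooth : Ω.IsSmooth I
  closed : Ω.IsClosed I
  nondegenerate : ∀ (p : M) (X : TangentSpace I p),
    (∀ Z : TangentSpace I p, Ω p ![X, Z] = 0) → X = 0

end Forms

/-! ### Symplectic Landau-Ginzburg models and symplectic parallel transport -/

section LG

universe u

variable {n : ℕ} {Y : Type u} [TopologicalSpace Y]
  [ChartedSpace (EuclideanSpace ℝ (Fin (2 * n + 2))) Y]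

/-- The set of critical values of `v : Y → ℂ`. -/
def critValues (n : ℕ) {Y : Type u} [TopologicalSpace Y]
    [ChartedSpace (EuclideanSpace ℝ (Fin (2 * n + 2))) Y] (v : Y → ℂ) : Set ℂ :=
  {c | ∃ p : Y, v p = c ∧ ¬ Function.Surjective (mfderiv (𝓡 (2 * n + 2)) 𝓘(ℝ, ℂ) v p)}

/-- The set `C = ℂ \ critv(v)` of regular values of `v`. -/
def regValues (n : ℕ) {Y : Type u} [TopologicalSpace Y]
    [ChartedSpace (EuclideanSpace ℝ (Fin (2 * n + 2))) Y] (v : Y → ℂ) : Set ℂ :=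
  (critValues n v)ᶜ

/-- The vertical space `ker dv_p`. -/
def vert (v : Y → ℂ) (p : Y) : Set (TangentSpace (𝓡 (2 * n + 2)) p) :=
  {X | mfderiv (𝓡 (2 * n + 2)) 𝓘(ℝ, ℂ) v p X = 0}

/-- The horizontal space, the `Ω`-orthogonal complement of the vertical space. -/
def hor (Ω : DiffForm (𝓡 (2 * n + 2)) Y 2) (v : Y → ℂ) (p : Y) :
    Set (TangentSpace (𝓡 (2 * n + 2)) p) :=
  {X | ∀ Z ∈ vert v p, Ω p ![X, Z] = 0}

/-- `β` is a horizontal lift of the base path `γ` over the parameter set `J`. -/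
structure IsHorizontalLift (Ω : DiffForm (𝓡 (2 * n + 2)) Y 2) (v : Y → ℂ)
    (γ : ℝ → ℂ) (J : Set ℝ) (β : ℝ → Y) : Prop where
  smooth : ContMDiffOn 𝓘(ℝ, ℝ) (𝓡 (2 * n + 2)) ∞ β J
  lift : ∀ t ∈ J, v (β t) = γ t
  horizontal : ∀ t ∈ J,
    mfderivWithin 𝓘(ℝ, ℝ) (𝓡 (2 * n + 2)) β J t (1 : ℝ) ∈ hor Ω v (β t)

/-- `v` restricts over its regular values to a symplectic fibration whose fibers carry the
restrictions of `Ω`: there are a symplectic manifold `(F, σ)` and, near every `c ∈ C`, a smooth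
trivialization `φ : U × F ≃ v⁻¹(U)` (with `F`-component of the inverse `χ`) which identifies
`σ` with the restriction of `Ω` to each fiber. -/
def IsSymplecticFibration (Ω : DiffForm (𝓡 (2 * n + 2)) Y 2) (v : Y → ℂ) : Prop :=
  ∃ (F : Type u) (_ : TopologicalSpace F) (_ : ChartedSpace (EuclideanSpace ℝ (Fin (2 * n))) F)
    (_ : IsManifold (𝓡 (2 * n)) ∞ F) (σ : DiffForm (𝓡 (2 * n)) F 2),
    IsSymplecticForm (𝓡 (2 * n)) σ ∧
    ∀ c ∈ regValues n v, ∃ U : Set ℂ, IsOpen U ∧ c ∈ U ∧ U ⊆ regValues n v ∧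
      ∃ (φ : ℂ × F → Y) (χ : Y → F),
        ContMDiffOn (𝓘(ℝ, ℂ).prod (𝓡 (2 * n))) (𝓡 (2 * n + 2)) ∞ φ (U ×ˢ univ) ∧
        ContMDiffOn (𝓡 (2 * n + 2)) (𝓡 (2 * n)) ∞ χ (v ⁻¹' U) ∧
        (∀ z ∈ U, ∀ x : F, v (φ (z, x)) = z ∧ χ (φ (z, x)) = x) ∧
        (∀ p ∈ v ⁻¹' U, φ (v p, χ p) = p) ∧
        ∀ z ∈ U, Ω.pullback (𝓡 (2 * n)) (𝓡 (2 * n + 2)) (fun x : F => φ (z, x)) = σ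

/-- A symplectic Landau-Ginzburg model `v : (Y, Ω) → ℂ`. The last field says that symplectic
parallel transport along paths of regular values is defined on whole fibers (which is automatic
if the fibers are compact). -/
structure IsSymplecticLGModel (Ω : DiffForm (𝓡 (2 * n + 2)) Y 2) (v : Y → ℂ) : Prop where
  symplectic : IsSymplecticForm (𝓡 (2 * n + 2)) Ω
  smooth : ContMDiff (𝓡 (2 * n + 2)) 𝓘(ℝ, ℂ) ∞ v
  finite_critValues : (critValues n v).Finite
  fibration : IsSymplecticFibration Ω v
  fiber_symplectic : ∀ p : Y, v p ∈ regValues n v → ∀ X ∈ vert (n := n) v p,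
    (∀ Z ∈ vert v p, Ω p ![X, Z] = 0) → X = 0
  exists_lift : ∀ (γ : ℝ → ℂ) (a b : ℝ), ContDiffOn ℝ ∞ γ (uIcc a b) →
    (∀ t ∈ uIcc a b, γ t ∈ regValues n v) → ∀ p : Y, v p = γ a →
    ∃ β : ℝ → Y, IsHorizontalLift Ω v γ (uIcc a b) β ∧ β a = p

open Classical in
/-- Symplectic parallel transport `Φ_{γ(a) → γ(b)}` along `γ` from parameter `a` to parameter `b`:
a point `p` of the fiber over `γ a` is sent to `β b`, where `β` is the horizontal lift of `γ` with
`β a = p`. (If there is no such lift, the value is the irrelevant `p`.) -/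
def parallelTransport (Ω : DiffForm (𝓡 (2 * n + 2)) Y 2) (v : Y → ℂ)
    (γ : ℝ → ℂ) (a b : ℝ) (p : Y) : Y :=
  if h : ∃ β : ℝ → Y, IsHorizontalLift Ω v γ (uIcc a b) β ∧ β a = p then h.choose b else p

/-- `ℓ` is a Lagrangian submanifold of the (regular) fiber of `v` over `c`, that is, an embedded
submanifold of half the dimension of the fiber on which `Ω` vanishes. -/
structure IsFiberLagrangian (Ω : DiffForm (𝓡 (2 * n + 2)) Y 2) (v : Y → ℂ) (c : ℂ)
    (ℓ : Set Y) [ChartedSpace (EuclideanSpace ℝ (Fin n)) ℓ] : Prop where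
  embedding : IsSmoothEmbedding (𝓡 n) (𝓡 (2 * n + 2)) ∞ (Subtype.val : ℓ → Y)
  subset_fiber : ∀ p ∈ ℓ, v p = c
  isotropic : Ω.pullback (𝓡 n) (𝓡 (2 * n + 2)) (Subtype.val : ℓ → Y) = 0

/-- `L` is the fibered Lagrangian over the smooth embedded curve `γ` of regular values obtained by
parallel transport of the Lagrangian `ℓ` of the fiber over `γ 0`; as a submanifold of `Y` it
carries the induced smooth structure. -/
structure IsFiberedLagrangian (Ω : DiffForm (𝓡 (2 * n + 2)) Y 2) (v : Y → ℂ) (γ : ℝ → ℂ)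
    (ℓ : Set Y) [ChartedSpace (EuclideanSpace ℝ (Fin n)) ℓ]
    (L : Set Y) [ChartedSpace (EuclideanSpace ℝ (Fin (n + 1))) L] : Prop where
  curve_embedding : IsSmoothEmbedding 𝓘(ℝ, ℝ) 𝓘(ℝ, ℂ) ∞ γ
  curve_regular : ∀ t, γ t ∈ regValues n v
  fiberLagrangian : IsFiberLagrangian Ω v (γ 0) ℓ
  embedding : IsSmoothEmbedding (𝓡 (n + 1)) (𝓡 (2 * n + 2)) ∞ (Subtype.val : L → Y)
  eq_transport : L = ⋃ t : ℝ, parallelTransport Ω v γ 0 t '' ℓ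

/-- `h s t`, `0 ≤ s ≤ 1`, is a smooth homotopy in the set of regular values of `v` which starts at
`γ` and is constant outside the neighborhood `N` of `[0,1]`. The deformed piece `t ↦ h 1 t`,
`t ∈ [0,1]`, is arbitrary; it may for instance be constant. -/
structure IsBaseHomotopy (n : ℕ) {Y : Type u} [TopologicalSpace Y]
    [ChartedSpace (EuclideanSpace ℝ (Fin (2 * n + 2))) Y] (v : Y → ℂ) (γ : ℝ → ℂ) (N : Set ℝ)
    (h : ℝ → ℝ → ℂ) : Prop where
  smooth : ContDiffOn ℝ ∞ (fun x : ℝ × ℝ => h x.1 x.2) (Icc 0 1 ×ˢ univ)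
  regular : ∀ s ∈ Icc (0 : ℝ) 1, ∀ t, h s t ∈ regValues n v
  start : ∀ t, h 0 t = γ t
  nhds : N ∈ 𝓝ˢ (Icc (0 : ℝ) 1)
  supported : ∀ s ∈ Icc (0 : ℝ) 1, ∀ t ∉ N, h s t = γ t

/-! ### Lagrangian isotopies -/

variable {L : Set Y} [ChartedSpace (EuclideanSpace ℝ (Fin (n + 1))) L]

/-- `ψ : L × [0,1] → Y` is a smooth family of Lagrangian maps `ψ_s`, that is, `ψ_s^* Ω = 0` for
every `s` (note that `2 dim L = dim Y`). The maps `ψ_s` need not be embeddings. A Lagrangian isotopy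
is such a family in which every `ψ_s` is moreover an embedding. -/
structure IsLagrangianFamily (Ω : DiffForm (𝓡 (2 * n + 2)) Y 2)
    (ψ : L × unitInterval → Y) : Prop where
  smooth : ContMDiff ((𝓡 (n + 1)).prod (𝓡∂ 1)) (𝓡 (2 * n + 2)) ∞ ψ
  lagrangian : ∀ s : unitInterval,
    Ω.pullback (𝓡 (n + 1)) (𝓡 (2 * n + 2)) (fun p : L => ψ (p, s)) = 0

/-- The `1`-form `ds` on `L × [0,1]`. -/
def formDs (n : ℕ) {Y : Type u} [TopologicalSpace Y] (L : Set Y)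
    [ChartedSpace (EuclideanSpace ℝ (Fin (n + 1))) L] :
    DiffForm ((𝓡 (n + 1)).prod (𝓡∂ 1)) (L × unitInterval) 1 :=
  DiffForm.d _ (fun x : L × unitInterval => (x.2 : ℝ))

/-- `ψ^* Ω = b ∧ ds` on `L × [0,1]`. -/
def PullbackEqWedgeDs (Ω : DiffForm (𝓡 (2 * n + 2)) Y 2) (ψ : L × unitInterval → Y)
    (b : DiffForm ((𝓡 (n + 1)).prod (𝓡∂ 1)) (L × unitInterval) 1) : Prop :=
  ∀ (x : L × unitInterval) (X Z : TangentSpace ((𝓡 (n + 1)).prod (𝓡∂ 1)) x),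
    Ω.pullback ((𝓡 (n + 1)).prod (𝓡∂ 1)) (𝓡 (2 * n + 2)) ψ x ![X, Z] =
      b.wedge _ (formDs n L) x X Z

/-- The Lagrangian family `ψ` is exact: `ψ^* Ω = d(H ds) = dH ∧ ds` for a smooth function `H` on
`L × [0,1]`. -/
def IsExactFamily (Ω : DiffForm (𝓡 (2 * n + 2)) Y 2) (ψ : L × unitInterval → Y) : Prop :=
  ∃ H : L × unitInterval → ℝ,
    ContMDiff ((𝓡 (n + 1)).prod (𝓡∂ 1)) 𝓘(ℝ, ℝ) ∞ H ∧
    PullbackEqWedgeDs Ω ψ (DiffForm.d _ H)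

end LG

end

/-!
Write `v(p) = γ(t(p))` for `p ∈ L`. This defines a smooth function `t` on `L`, and through every
point `p` of `L` runs a horizontal lift `τ ↦ c p τ` of `γ`, defined for all times and contained in
`L`; uniqueness of horizontal lifts gives the first part of the statement.

For the exactness of `ψ`, consider for fixed `s` the `1`-form `X ↦ Ω(dψ_s X, ∂_s ψ)` on `L`, called
the slice form here. As every `ψ_s` is isotropic, `ψ^* Ω` is the wedge product of the slice forms
with `ds`. The vector `∂_s ψ` is horizontal, and `v(ψ(p, s)) = h_s(t(p))`, so `dψ_s` maps `ker dt`
to vertical vectors. Hence the slice form vanishes on `ker dt` and is a multiple `f dt` of `dt`.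
Closedness of `ψ^* Ω` makes `f` locally constant along the fibers of `t`, and then
`H(p, s) = ∫_0^{t(p)} f(c p τ, s) dτ` is a smooth function whose differential along the slices is
`f dt`: near a given `p`, only the flow line through that one point enters. This is
`IsTransverseFlow.exists_primitive`, which works on any manifold with a transverse flow
(`IsTransverseFlow`), and no topological assumption on `L` is needed, because the integral is taken
along flow lines and `f` is never compared between different components of a fiber.

For the last part, the equation `ψ^* Ω = b ∧ ds` only says that the restriction of `b` to the slices
is given by the slice forms (`pullback_eq_wedge_iff`), so `b = dH + g ds`. If `b` is closed, `g` is
locally constant in `p`, and `H + ∫_0^s g` is a potential of `b` (`exists_potential`).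

The transverse flow on `L` comes from the theory of horizontal lifts, developed here. In a chart the
horizontal lift of `ζ ∈ ℂ` is `P(z) ζ` for a smooth field `P` of linear maps
(`IsSymplecticLGModel.exists_horizontal_field`), obtained by inverting a linear system that is
nondegenerate because the fibers are symplectic. Horizontal lifts are therefore solutions of
`z' = P(z) γ'`; the theory of ordinary differential equations gives uniqueness
(`IsDifferentiableLift.eqOn`) and continuous dependence
(`IsSymplecticLGModel.continuous_uncurry_lift`).
-/

noncomputable section

/-! ### Pullbacks of forms to subsets of a normed space -/

section PullbackWithin

variable {E : Type*} [NormedAddCommGroup E] [NormedSpace ℝ E]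
  {H : Type*} [TopologicalSpace H] {I : ModelWithCorners ℝ E H}
  {M : Type*} [TopologicalSpace M] [ChartedSpace H M]
  {V : Type*} [NormedAddCommGroup V] [NormedSpace ℝ V] {k : ℕ}

variable (I) in
/-- The pullback of a form on the manifold `M` along a map `κ` defined on a subset `S` of a normed
space, as a form on the normed space. The derivative of `κ` is taken within `S`. -/
def DiffForm.pullbackWithin (α : DiffForm I M k) (κ : V → M) (S : Set V) (x : V) :
    V [⋀^Fin k]→L[ℝ] ℝ :=
  (α (κ x)).compContinuousLinearMap (mfderivWithin 𝓘(ℝ, V) I κ S x)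

/-- In a chart, the pullback of a form is the pullback of its coordinate expression. -/
theorem DiffForm.pullbackWithin_eq_inChart [IsManifold I 1 M] (α : DiffForm I M k) {κ : V → M}
    {S : Set V} {x : V} (x₀ : M) (hκ : MDifferentiableWithinAt 𝓘(ℝ, V) I κ S x)
    (hS : UniqueDiffWithinAt ℝ S x) (hx : κ x ∈ (extChartAt I x₀).source) :
    α.pullbackWithin I κ S x =
      (α.inChart I x₀ (extChartAt I x₀ (κ x))).compContinuousLinearMap
        (fderivWithin ℝ (fun y => extChartAt I x₀ (κ y)) S x) := by
  have h1 : fderivWithin ℝ (fun y => extChartAt I x₀ (κ y)) S x =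
      (mfderiv I 𝓘(ℝ, E) (extChartAt I x₀) (κ x)).comp (mfderivWithin 𝓘(ℝ, V) I κ S x) := by
    rw [← mfderivWithin_eq_fderivWithin]
    exact mfderiv_comp_mfderivWithin (I' := I) x
      (mdifferentiableAt_extChartAt (by rwa [extChartAt_source] at hx)) hκ hS.uniqueMDiffWithinAt
  have h2 := mfderivWithin_extChartAt_symm_comp_mfderiv_extChartAt' hx
  have h3 : (extChartAt I x₀).symm (extChartAt I x₀ (κ x)) = κ x := (extChartAt I x₀).left_inv hx
  ext m
  rw [h1]
  have key : ∀ (q : M) (hq : q = κ x) (L : TangentSpace I (κ x) →L[ℝ] TangentSpace I q)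
      (_ : ∀ X : E, (L X : E) = X) (u : Fin k → TangentSpace I (κ x)),
      α (κ x) u = α q (fun i => L (u i)) := by
    rintro q rfl L hL u
    congr 1
    funext i
    exact (hL (u i)).symm
  refine key _ h3 ((mfderivWithin 𝓘(ℝ, E) I (extChartAt I x₀).symm (range I)
    (extChartAt I x₀ (κ x))).comp (mfderiv I 𝓘(ℝ, E) (extChartAt I x₀) (κ x))) ?_ _
  intro X
  exact DFunLike.congr_fun h2 X

omit [NormedSpace ℝ V] in
/-- Near a point of `S`, a map `κ` that is continuous on `S` stays in the chart at its value. -/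
theorem ContinuousOn.exists_isOpen_mapsTo_extChartAt_source {κ : V → M} {S : Set V} {x : V}
    (hκ : ContinuousOn κ S) (hx : x ∈ S) :
    ∃ O : Set V, IsOpen O ∧ x ∈ O ∧ ∀ y ∈ S ∩ O, κ y ∈ (extChartAt I (κ x)).source := by
  have h := (hκ x hx).preimage_mem_nhdsWithin (extChartAt_source_mem_nhds (I := I) (κ x))
  obtain ⟨O, hO, hxO, h⟩ := mem_nhdsWithin.1 h
  exact ⟨O, hO, hxO, fun y hy => h ⟨hy.2, hy.1⟩⟩

section

variable [IsManifold I ∞ M] {α : DiffForm I M k} {κ : V → M} {S : Set V}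

theorem DiffForm.IsSmooth.pullbackWithin_aux (hα : α.IsSmooth I)
    (hκ : ContMDiffOn 𝓘(ℝ, V) I ∞ κ S) (hS : UniqueDiffOn ℝ S) {x : V} (hx : x ∈ S) :
    ∃ O : Set V, IsOpen O ∧ x ∈ O ∧
      MapsTo (fun y => extChartAt I (κ x) (κ y)) (S ∩ O) (extChartAt I (κ x)).target ∧
      ContDiffOn ℝ ∞ (fun y => extChartAt I (κ x) (κ y)) (S ∩ O) ∧
      ContDiffOn ℝ ∞ (fun y => α.inChart I (κ x) (extChartAt I (κ x) (κ y))) (S ∩ O) ∧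
      ∀ y ∈ S ∩ O, α.pullbackWithin I κ S y =
        (α.inChart I (κ x) (extChartAt I (κ x) (κ y))).compContinuousLinearMap
          (fderivWithin ℝ (fun y => extChartAt I (κ x) (κ y)) (S ∩ O) y) := by
  obtain ⟨O, hO, hxO, h⟩ :=
    hκ.continuousOn.exists_isOpen_mapsTo_extChartAt_source (I := I) hx
  have hmaps : MapsTo (fun y => extChartAt I (κ x) (κ y)) (S ∩ O) (extChartAt I (κ x)).target :=
    fun y hy => (extChartAt I (κ x)).map_source (h y hy)
  have hs : ContDiffOn ℝ ∞ (fun y => extChartAt I (κ x) (κ y)) (S ∩ O) := by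
    rw [← contMDiffOn_iff_contDiffOn]
    exact (contMDiffOn_extChartAt (n := ∞)).comp (hκ.mono inter_subset_left)
      (fun y hy => by simpa using h y hy)
  have : IsManifold I 1 M := .of_le (n := ∞) (by simp)
  refine ⟨O, hO, hxO, hmaps, hs, (hα (κ x)).comp hs hmaps, fun y hy => ?_⟩
  rw [α.pullbackWithin_eq_inChart (κ x) ((hκ y hy.1).mdifferentiableWithinAt (by simp))
    (hS y hy.1) (h y hy), fderivWithin_inter (hO.mem_nhds hy.2)]

theorem DiffForm.IsSmooth.differentiableOn_pullbackWithin (hα : α.IsSmooth I)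
    (hκ : ContMDiffOn 𝓘(ℝ, V) I ∞ κ S) (hS : UniqueDiffOn ℝ S) :
    DifferentiableOn ℝ (α.pullbackWithin I κ S) S := by
  intro x hx
  obtain ⟨O, hO, hxO, -, h1, h2, h3⟩ := hα.pullbackWithin_aux hκ hS hx
  have hSO : UniqueDiffOn ℝ (S ∩ O) := hS.inter hO
  rw [← differentiableWithinAt_inter (hO.mem_nhds hxO)]
  refine DifferentiableWithinAt.congr ?_ h3 (h3 x ⟨hx, hxO⟩)
  have h4 := h2.differentiableOn (by simp) x ⟨hx, hxO⟩
  exact h4.continuousAlternatingMapCompContinuousLinearMap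
    ((h1.fderivWithin hSO (m := ∞) (by simp)).differentiableOn (by simp) x ⟨hx, hxO⟩)

theorem DiffForm.IsSmooth.contDiffOn_pullbackWithin_apply (hα : α.IsSmooth I)
    (hκ : ContMDiffOn 𝓘(ℝ, V) I ∞ κ S) (hS : UniqueDiffOn ℝ S) (m : Fin k → V) :
    ContDiffOn ℝ ∞ (fun x => α.pullbackWithin I κ S x m) S := by
  intro x hx
  obtain ⟨O, hO, hxO, -, h1, h2, h3⟩ := hα.pullbackWithin_aux hκ hS hx
  have hSO : UniqueDiffOn ℝ (S ∩ O) := hS.inter hO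
  rw [← contDiffWithinAt_inter (hO.mem_nhds hxO)]
  have h4 : ContDiffOn ℝ ∞ (fun y => (α.inChart I (κ x) (extChartAt I (κ x) (κ y)))
      (fun i => fderivWithin ℝ (fun y => extChartAt I (κ x) (κ y)) (S ∩ O) y (m i))) (S ∩ O) := by
    have h5 : ContDiffOn ℝ ∞
        (fun y i => fderivWithin ℝ (fun y => extChartAt I (κ x) (κ y)) (S ∩ O) y (m i))
        (S ∩ O) := by
      rw [contDiffOn_pi]
      exact fun i => (h1.fderivWithin hSO (by simp)).clm_apply contDiffOn_const
    have h6 : ContDiff ℝ ∞ (fun p : (E [⋀^Fin k]→L[ℝ] ℝ) × (Fin k → E) => p.1 p.2) := by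
      have := (ContinuousAlternatingMap.toContinuousMultilinearMapCLM (𝕜 := ℝ) (E := E) (F := ℝ)
        (ι := Fin k) ℝ).analyticOnNhd_uncurry_of_multilinear (s := univ)
      exact (contDiffOn_univ.1 this.contDiffOn_of_completeSpace)
    exact h6.comp_contDiffOn (h2.prodMk h5)
  refine (h4 x ⟨hx, hxO⟩).congr (fun y hy => ?_) ?_
  · rw [h3 y hy]; rfl
  · rw [h3 x ⟨hx, hxO⟩]; rfl

/-- The pullback of a smooth closed form is closed, also at boundary points of the domain. -/
theorem DiffForm.IsClosed.extDerivWithin_pullbackWithin (hc : α.IsClosed I) (hα : α.IsSmooth I)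
    (hκ : ContMDiffOn 𝓘(ℝ, V) I ∞ κ S) (hS : UniqueDiffOn ℝ S) {x : V} (hx : x ∈ S)
    (hxc : x ∈ closure (interior S)) :
    extDerivWithin (α.pullbackWithin I κ S) S x = 0 := by
  obtain ⟨O, hO, hxO, hm, h1, h2, h3⟩ := hα.pullbackWithin_aux hκ hS hx
  have hSO : UniqueDiffOn ℝ (S ∩ O) := hS.inter hO
  have hx' : x ∈ S ∩ O := ⟨hx, hxO⟩
  have h4 : extDerivWithin (α.pullbackWithin I κ S) S x =
      extDerivWithin (α.pullbackWithin I κ S) (S ∩ O) x := by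
    simp only [extDerivWithin, fderivWithin_inter (hO.mem_nhds hxO)]
  have hxc' : x ∈ closure (interior (S ∩ O)) := by
    rw [interior_inter, hO.interior_eq, inter_comm]
    exact hO.inter_closure ⟨hxO, hxc⟩
  have h5 : DifferentiableWithinAt ℝ (α.inChart I (κ x)) (extChartAt I (κ x)).target
      (extChartAt I (κ x) (κ x)) := (hα (κ x)).differentiableOn (by simp) _ (hm hx')
  rw [h4, extDerivWithin_congr' (s := S ∩ O) h3 hx',
    extDerivWithin_pullback (f := fun y => extChartAt I (κ x) (κ y)) h5 (h1 x hx')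
      (by simp; exact WithTop.coe_le_coe.2 le_top) hSO hxc' hx' hm, hc (κ x) _ (hm hx')]
  ext; simp

end

end PullbackWithin

/-! ### Primitives on a strip and closed forms -/

section Strip

/-- The primitive of a `C^1` function on the strip `ℝ × [0,1]` in the first variable is
differentiable, also at the boundary of the strip. -/
theorem hasFDerivWithinAt_integral_strip {F : ℝ × ℝ → ℝ} (t₀ : ℝ)
    (hF : ContDiffOn ℝ 1 F (univ ×ˢ Icc 0 1)) {x₀ : ℝ × ℝ} (hx₀ : x₀.2 ∈ Icc (0 : ℝ) 1) :
    HasFDerivWithinAt (fun x : ℝ × ℝ => ∫ τ in t₀..x.1, F (τ, x.2))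
      (F x₀ • ContinuousLinearMap.fst ℝ ℝ ℝ +
        (∫ τ in t₀..x₀.1, fderivWithin ℝ F (univ ×ˢ Icc 0 1) (τ, x₀.2) (0, 1)) •
          ContinuousLinearMap.snd ℝ ℝ ℝ) (univ ×ˢ Icc 0 1) x₀ := by
  obtain ⟨t, s⟩ := x₀
  simp only at hx₀
  set S : Set (ℝ × ℝ) := univ ×ˢ Icc 0 1 with hS
  have hSu : UniqueDiffOn ℝ S := uniqueDiffOn_univ.prod (uniqueDiffOn_Icc zero_lt_one)
  set f2 : ℝ × ℝ → ℝ := fun x => fderivWithin ℝ F S x (0, 1) with hf2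
  have hf2c : ContinuousOn f2 S :=
    (hF.continuousOn_fderivWithin hSu le_rfl).clm_apply continuousOn_const
  have hsl : ∀ {σ : ℝ}, σ ∈ Icc (0 : ℝ) 1 → ∀ {g : ℝ × ℝ → ℝ}, ContinuousOn g S →
      Continuous fun τ => g (τ, σ) := fun {σ} hσ {g} hg =>
    hg.comp_continuous (by fun_prop) (fun τ => ⟨mem_univ _, hσ⟩)
  rw [hasFDerivWithinAt_iff_isLittleO, Asymptotics.isLittleO_iff]
  intro ε hε
  set C : ℝ := |t - t₀| + 1 with hC
  have hC0 : 0 < C := by positivity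
  -- uniform continuity of the partial derivative along the compact interval of integration
  have h1 : ∀ᶠ σ in 𝓝 s, ∀ τ ∈ uIcc t₀ t,
      |f2 (τ, projIcc 0 1 zero_le_one σ) - f2 (τ, s)| < ε / (2 * C) := by
    refine isCompact_uIcc.eventually_forall_of_forall_eventually (fun τ _ => ?_)
    have hc1 : Continuous fun z : ℝ × ℝ => f2 (z.2, projIcc (0 : ℝ) 1 zero_le_one z.1) :=
      hf2c.comp_continuous
        (by fun_prop) (fun z => ⟨mem_univ _, Subtype.coe_prop _⟩)
    have hc2 : Continuous fun z : ℝ × ℝ => f2 (z.2, s) :=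
      hf2c.comp_continuous (by fun_prop) (fun z => ⟨mem_univ _, hx₀⟩)
    have hc3 : Continuous fun z : ℝ × ℝ =>
        |f2 (z.2, projIcc (0 : ℝ) 1 zero_le_one z.1) - f2 (z.2, s)| := (hc1.sub hc2).abs
    refine (hc3.tendsto (s, τ)).eventually (gt_mem_nhds ?_)
    simp only [projIcc_of_mem _ hx₀, sub_self, abs_zero]
    positivity
  obtain ⟨δ₁, hδ₁, h1⟩ := Metric.eventually_nhds_iff.1 h1
  have h2 := (hF.continuousOn (t, s) ⟨mem_univ _, hx₀⟩)
  obtain ⟨δ₂, hδ₂, h2⟩ := Metric.continuousWithinAt_iff.1 h2 (ε / 2) (by positivity)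
  have h3 : ∀ᶠ x in 𝓝[S] (t, s), x ∈ S ∧ dist x (t, s) < min δ₁ δ₂ :=
    (eventually_mem_nhdsWithin).and
      (nhdsWithin_le_nhds (Metric.ball_mem_nhds _ (lt_min hδ₁ hδ₂)))
  filter_upwards [h3] with x hx
  obtain ⟨⟨-, hxS⟩, hd⟩ := hx
  obtain ⟨t', s'⟩ := x
  simp only at hxS
  have hd1 : dist (t', s') (t, s) < δ₁ := hd.trans_le (min_le_left _ _)
  have hd2 : dist (t', s') (t, s) < δ₂ := hd.trans_le (min_le_right _ _)
  rw [Prod.dist_eq, max_lt_iff] at hd1 hd2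
  have hFs : ∀ {σ : ℝ}, σ ∈ Icc (0 : ℝ) 1 → Continuous fun τ => F (τ, σ) :=
    fun hσ => hsl hσ hF.continuousOn
  have hii : ∀ {σ : ℝ} (_ : σ ∈ Icc (0 : ℝ) 1) (a b : ℝ),
      IntervalIntegrable (fun τ => F (τ, σ)) MeasureTheory.volume a b :=
    fun hσ a b => (hFs hσ).intervalIntegrable a b
  have hif2 : IntervalIntegrable (fun τ => f2 (τ, s)) MeasureTheory.volume t₀ t :=
    (hsl hx₀ hf2c).intervalIntegrable _ _
  have e1 : (∫ τ in t₀..t', F (τ, s')) = (∫ τ in t₀..t, F (τ, s')) + ∫ τ in t..t', F (τ, s') :=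
    (intervalIntegral.integral_add_adjacent_intervals (hii hxS _ _) (hii hxS _ _)).symm
  have e2 : (∫ τ in t..t', F (τ, s')) - F (t, s) * (t' - t) =
      ∫ τ in t..t', (F (τ, s') - F (t, s)) := by
    rw [intervalIntegral.integral_sub (hii hxS _ _) (by simp), intervalIntegral.integral_const,
      smul_eq_mul, mul_comm]
  have e3 : (∫ τ in t₀..t, F (τ, s')) - (∫ τ in t₀..t, F (τ, s)) -
      (∫ τ in t₀..t, f2 (τ, s)) * (s' - s) =
      ∫ τ in t₀..t, (F (τ, s') - F (τ, s) - f2 (τ, s) * (s' - s)) := by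
    rw [intervalIntegral.integral_sub ((hii hxS _ _).sub (hii hx₀ _ _)) (hif2.mul_const _),
      intervalIntegral.integral_sub (hii hxS _ _) (hii hx₀ _ _),
      intervalIntegral.integral_mul_const]
  have b2 : ‖∫ τ in t..t', (F (τ, s') - F (t, s))‖ ≤ ε / 2 * |t' - t| := by
    refine intervalIntegral.norm_integral_le_of_norm_le_const (fun τ hτ => ?_)
    have hτ' : dist τ t < δ₂ := by
      have : |τ - t| ≤ |t' - t| := abs_sub_left_of_mem_uIcc (uIoc_subset_uIcc hτ)
      rw [Real.dist_eq]
      have h := hd2.1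
      rw [Real.dist_eq] at h
      exact this.trans_lt h
    have := h2 (x := (τ, s')) ⟨mem_univ _, hxS⟩ (by
      rw [Prod.dist_eq]; exact max_lt hτ' hd2.2)
    rw [Real.dist_eq] at this
    exact this.le
  have b3 : ‖∫ τ in t₀..t, (F (τ, s') - F (τ, s) - f2 (τ, s) * (s' - s))‖ ≤
      ε / (2 * C) * |s' - s| * |t - t₀| := by
    refine intervalIntegral.norm_integral_le_of_norm_le_const (fun τ hτ => ?_)
    have hτ' := uIoc_subset_uIcc hτ
    have hsub : uIcc s s' ⊆ Icc (0 : ℝ) 1 := uIcc_subset_Icc hx₀ hxS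
    have hder : ∀ σ ∈ uIcc s s', HasDerivWithinAt (fun σ => F (τ, σ) - f2 (τ, s) * σ)
        (f2 (τ, σ) - f2 (τ, s)) (uIcc s s') σ := by
      intro σ hσ
      have hd := ((hF.differentiableOn (by simp)) (τ, σ) ⟨mem_univ _, hsub hσ⟩).hasFDerivWithinAt
      have hc : HasDerivWithinAt (fun σ : ℝ => (τ, σ)) ((0 : ℝ), (1 : ℝ)) (uIcc s s') σ :=
        (hasDerivWithinAt_const _ _ _).prodMk (hasDerivWithinAt_id _ _)
      have := hd.comp_hasDerivWithinAt σ hc (fun y hy => ⟨mem_univ _, hsub hy⟩)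
      exact this.sub (by simpa using (hasDerivWithinAt_id σ (uIcc s s')).const_mul (f2 (τ, s)))
    have hb : ∀ σ ∈ uIcc s s', ‖f2 (τ, σ) - f2 (τ, s)‖ ≤ ε / (2 * C) := by
      intro σ hσ
      have h4 : dist σ s < δ₁ := by
        have : |σ - s| ≤ |s' - s| := abs_sub_left_of_mem_uIcc hσ
        rw [Real.dist_eq]
        have h := hd1.2
        rw [Real.dist_eq] at h
        exact this.trans_lt h
      have := h1 h4 τ hτ'
      rw [projIcc_of_mem _ (hsub hσ)] at this
      exact this.le
    have := (convex_uIcc s s').norm_image_sub_le_of_norm_hasDerivWithin_le hder hb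
      left_mem_uIcc right_mem_uIcc
    calc _ = ‖F (τ, s') - f2 (τ, s) * s' - (F (τ, s) - f2 (τ, s) * s)‖ := by congr 1; ring
      _ ≤ _ := this
  have hn1 : |t' - t| ≤ ‖((t', s') : ℝ × ℝ) - (t, s)‖ := by
    simp
  have hn2 : |s' - s| ≤ ‖((t', s') : ℝ × ℝ) - (t, s)‖ := by
    simp
  have hgoal : (∫ τ in t₀..t', F (τ, s')) - (∫ τ in t₀..t, F (τ, s)) -
      (F (t, s) * (t' - t) + (∫ τ in t₀..t, f2 (τ, s)) * (s' - s)) =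
      (∫ τ in t..t', (F (τ, s') - F (t, s))) +
        ∫ τ in t₀..t, (F (τ, s') - F (τ, s) - f2 (τ, s) * (s' - s)) := by
    rw [← e2, ← e3, e1]; ring
  have : ε / (2 * C) * |s' - s| * |t - t₀| ≤ ε / 2 * |s' - s| := by
    have h5 : |t - t₀| ≤ C := by simp [hC]
    calc ε / (2 * C) * |s' - s| * |t - t₀| ≤ ε / (2 * C) * |s' - s| * C := by gcongr
      _ = ε / 2 * |s' - s| := by field_simp
  simp only [add_apply, smul_apply,
    ContinuousLinearMap.coe_fst', ContinuousLinearMap.coe_snd', Prod.fst_sub, Prod.snd_sub,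
    smul_eq_mul]
  rw [hgoal]
  calc _ ≤ ε / 2 * |t' - t| + ε / 2 * |s' - s| :=
        (norm_add_le _ _).trans (add_le_add b2 (b3.trans this))
    _ ≤ ε / 2 * ‖((t', s') : ℝ × ℝ) - (t, s)‖ + ε / 2 * ‖((t', s') : ℝ × ℝ) - (t, s)‖ := by
        gcongr
    _ = _ := by ring

/-- The primitive in the first variable of a function that is smooth up to the boundary of the
strip `ℝ × [0,1]` is again smooth up to the boundary. -/
theorem ContDiffOn.integral_strip {F : ℝ × ℝ → ℝ} (t₀ : ℝ)
    (hF : ContDiffOn ℝ ∞ F (univ ×ˢ Icc 0 1)) :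
    ContDiffOn ℝ ∞ (fun x : ℝ × ℝ => ∫ τ in t₀..x.1, F (τ, x.2)) (univ ×ˢ Icc 0 1) := by
  have hSu : UniqueDiffOn ℝ (univ ×ˢ Icc 0 1 : Set (ℝ × ℝ)) :=
    uniqueDiffOn_univ.prod (uniqueDiffOn_Icc zero_lt_one)
  rw [contDiffOn_infty]
  intro n
  induction n generalizing F with
  | zero =>
    have : ContDiffOn ℝ 1 F (univ ×ˢ Icc 0 1) := hF.of_le (mod_cast le_top)
    exact contDiffOn_zero.2
      fun x hx => (hasFDerivWithinAt_integral_strip t₀ this hx.2).continuousWithinAt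
  | succ n ih =>
    have h1 : ContDiffOn ℝ 1 F (univ ×ˢ Icc 0 1) := hF.of_le (mod_cast le_top)
    have hd := fun (x : ℝ × ℝ) (hx : x ∈ (univ ×ˢ Icc 0 1 : Set (ℝ × ℝ))) =>
      hasFDerivWithinAt_integral_strip t₀ h1 hx.2
    rw [Nat.cast_add, Nat.cast_one, contDiffOn_succ_iff_fderivWithin hSu]
    refine ⟨fun x hx => (hd x hx).differentiableWithinAt, by simp, ?_⟩
    have h2 : ContDiffOn ℝ ∞ (fun x => fderivWithin ℝ F (univ ×ˢ Icc 0 1) x (0, 1))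
        (univ ×ˢ Icc 0 1) := (hF.fderivWithin hSu (by simp)).clm_apply contDiffOn_const
    refine ContDiffOn.congr ?_ (fun x hx => (hd x hx).fderivWithin (hSu x hx))
    exact ((hF.of_le (mod_cast le_top)).smul contDiffOn_const).add
      ((ih h2).smul contDiffOn_const)

variable {E : Type*} [NormedAddCommGroup E] [NormedSpace ℝ E] {B : Set E}

theorem eq_of_fderivWithin_prod_eq_zero {g : E × ℝ → ℝ} (hB : Convex ℝ B)
    (hg : DifferentiableOn ℝ g (B ×ˢ Icc 0 1)) {w w' : E} (hw : w ∈ B) (hw' : w' ∈ B) {s : ℝ}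
    (hs : s ∈ Icc (0 : ℝ) 1)
    (h : ∀ x ∈ B, fderivWithin ℝ g (B ×ˢ Icc 0 1) (x, s) (w' - w, 0) = 0) :
    g (w, s) = g (w', s) := by
  have hmaps : ∀ r ∈ Icc (0 : ℝ) 1, w + r • (w' - w) ∈ B := fun r hr =>
    hB.add_smul_sub_mem hw hw' hr
  have hd : ∀ r ∈ Icc (0 : ℝ) 1,
      HasDerivWithinAt (fun r : ℝ => g (w + r • (w' - w), s)) 0 (Icc 0 1) r := by
    intro r hr
    have h1 : HasDerivWithinAt (fun r : ℝ => (w + r • (w' - w), s)) (w' - w, 0) (Icc 0 1) r := by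
      have : HasDerivWithinAt (fun r : ℝ => w + r • (w' - w)) (w' - w) (Icc 0 1) r := by
        simpa using ((hasDerivWithinAt_id r (Icc (0 : ℝ) 1)).smul_const (w' - w)).const_add w
      exact this.prodMk (hasDerivWithinAt_const _ _ _)
    have h2 := (hg (w + r • (w' - w), s) ⟨hmaps r hr, hs⟩).hasFDerivWithinAt
    have h3 := h2.comp_hasDerivWithinAt (t := B ×ˢ Icc (0 : ℝ) 1) r h1
      (fun y hy => ⟨hmaps y hy, hs⟩)
    rwa [h _ (hmaps r hr)] at h3
  have := (convex_Icc (0 : ℝ) 1).norm_image_sub_le_of_norm_hasDerivWithin_le hd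
    (C := 0) (by simp) (left_mem_Icc.2 zero_le_one) (right_mem_Icc.2 zero_le_one)
  have h0 : g (w + (1 : ℝ) • (w' - w), s) = g (w + (0 : ℝ) • (w' - w), s) := by
    simpa [sub_eq_zero] using this
  simpa using h0.symm

/-- If a `1`-form vanishes on `k` and is closed, then its value on a constant vector field does not
change in the direction `k`. -/
theorem fderivWithin_apply_eq_zero_of_extDerivWithin_eq_zero
    {V : Type*} [NormedAddCommGroup V] [NormedSpace ℝ V] {S : Set V}
    {δ : V → V [⋀^Fin 1]→L[ℝ] ℝ} (hδ : DifferentiableOn ℝ δ S) (hS : UniqueDiffOn ℝ S)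
    (hc : ∀ x ∈ S, extDerivWithin δ S x = 0) {k u : V} (h : ∀ x ∈ S, δ x ![k] = 0)
    {x : V} (hx : x ∈ S) : fderivWithin ℝ (fun x => δ x ![u]) S x k = 0 := by
  have h1 := extDerivWithin_apply (hδ x hx) (hS x hx) ![k, u]
  have h2 : fderivWithin ℝ (fun x => δ x ![k]) S x u = 0 := by
    rw [fderivWithin_congr (f := fun _ => 0) h (h x hx)]; simp
  have e0 : Fin.removeNth 0 ![k, u] = ![u] := by ext i; fin_cases i; rfl
  have e1 : Fin.removeNth 1 ![k, u] = ![k] := by ext i; fin_cases i; rfl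
  rw [hc x hx, Fin.sum_univ_two, e0, e1] at h1
  simp [h2] at h1
  exact h1.symm

theorem ContinuousAlternatingMap.apply_swap_two {V : Type*} [AddCommGroup V] [Module ℝ V]
    [TopologicalSpace V] (ω₂ : V [⋀^Fin 2]→L[ℝ] ℝ) (X Z : V) : ω₂ ![X, Z] = -ω₂ ![Z, X] := by
  have := ω₂.toAlternatingMap.map_swap ![Z, X] (i := 0) (j := 1) (by simp)
  have e : (![Z, X] ∘ Equiv.swap (0 : Fin 2) 1) = ![X, Z] := by
    ext i; fin_cases i <;> simp
  rw [e] at this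
  exact this

/-- If a closed `2`-form vanishes on the pairs `(k, z)` and `(u, k)`, then its value on the
pair `(u, z)` does not change in the direction `k`. -/
theorem fderivWithin_apply_two_eq_zero_of_extDerivWithin_eq_zero
    {V : Type*} [NormedAddCommGroup V] [NormedSpace ℝ V] {S : Set V}
    {δ : V → V [⋀^Fin 2]→L[ℝ] ℝ} (hδ : DifferentiableOn ℝ δ S) (hS : UniqueDiffOn ℝ S)
    (hc : ∀ x ∈ S, extDerivWithin δ S x = 0) {k u z : V} (h : ∀ x ∈ S, δ x ![k, z] = 0)
    (h' : ∀ x ∈ S, δ x ![u, k] = 0)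
    {x : V} (hx : x ∈ S) : fderivWithin ℝ (fun x => δ x ![u, z]) S x k = 0 := by
  have h1 := extDerivWithin_apply (hδ x hx) (hS x hx) ![k, u, z]
  have h2 : fderivWithin ℝ (fun x => δ x ![k, z]) S x u = 0 := by
    rw [fderivWithin_congr (f := fun _ => 0) h (h x hx)]; simp
  have h3' : ∀ x ∈ S, δ x ![k, u] = 0 := fun x hx => by
    rw [ContinuousAlternatingMap.apply_swap_two, h' x hx, neg_zero]
  have h3 : fderivWithin ℝ (fun x => δ x ![k, u]) S x z = 0 := by
    rw [fderivWithin_congr (f := fun _ => 0) h3' (h3' x hx)]; simp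
  have e0 : Fin.removeNth 0 ![k, u, z] = ![u, z] := by ext i; fin_cases i <;> rfl
  have e1 : Fin.removeNth 1 ![k, u, z] = ![k, z] := by ext i; fin_cases i <;> rfl
  have e2 : Fin.removeNth 2 ![k, u, z] = ![k, u] := by ext i; fin_cases i <;> rfl
  rw [hc x hx, Fin.sum_univ_three, e0, e1, e2] at h1
  simp [h2, h3] at h1
  exact h1.symm

end Strip

/-! ### Maps defined on a cylinder over a manifold -/

section Cylinder

variable {E : Type*} [NormedAddCommGroup E] [NormedSpace ℝ E]
  {M : Type*} [TopologicalSpace M] [ChartedSpace E M]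
  {E' : Type*} [NormedAddCommGroup E'] [NormedSpace ℝ E']
  {H' : Type*} [TopologicalSpace H'] {J : ModelWithCorners ℝ E' H'}
  {Y : Type*} [TopologicalSpace Y] [ChartedSpace H' Y]
  {V : Type*} [NormedAddCommGroup V] [NormedSpace ℝ V]

theorem exists_eq_smul_one_tangentSpace_unitInterval (s : unitInterval)
    (X : TangentSpace (𝓡∂ 1) s) : ∃ r : ℝ, X = r • (1 : TangentSpace (𝓡∂ 1) s) := by
  have h1 : (1 : TangentSpace (𝓡∂ 1) s) ≠ 0 := by
    intro h
    have := mfderiv_subtypeVal_Icc_one s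
    rw [h, map_zero] at this
    exact zero_ne_one (α := ℝ) this
  have h2 : Module.finrank ℝ (TangentSpace (𝓡∂ 1) s) = 1 := by
    change Module.finrank ℝ (EuclideanSpace ℝ (Fin 1)) = 1
    simp
  obtain ⟨r, hr⟩ := exists_smul_eq_of_finrank_eq_one h2 h1 X
  exact ⟨r, hr.symm⟩

/-- The map `(w, s) ↦ ψ (φ w, s)` on `V × ℝ`, for a map `ψ` on `M × [0,1]` and a map `φ : V → M`;
it is meaningful on `V × [0,1]`. -/
def cylinderMap (ψ : M × unitInterval → Y) (φ : V → M) (x : V × ℝ) : Y :=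
  ψ (φ x.1, projIcc 0 1 zero_le_one x.2)

omit [TopologicalSpace M] [TopologicalSpace Y] [NormedAddCommGroup V] [NormedSpace ℝ V] in
theorem cylinderMap_apply (ψ : M × unitInterval → Y) (φ : V → M) (w : V) (s : unitInterval) :
    cylinderMap ψ φ (w, (s : ℝ)) = ψ (φ w, s) := by
  simp [cylinderMap]

theorem contMDiffOn_cylinderMap {ψ : M × unitInterval → Y} {φ : V → M} {B : Set V}
    (hψ : ContMDiff (𝓘(ℝ, E).prod (𝓡∂ 1)) J ∞ ψ) (hφ : ContMDiffOn 𝓘(ℝ, V) 𝓘(ℝ, E) ∞ φ B) :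
    ContMDiffOn 𝓘(ℝ, V × ℝ) J ∞ (cylinderMap ψ φ) (B ×ˢ Icc 0 1) := by
  refine hψ.comp_contMDiffOn (ContMDiffOn.prodMk ?_ ?_)
  · exact hφ.comp contDiff_fst.contMDiff.contMDiffOn (fun x hx => hx.1)
  · exact (contMDiffOn_projIcc (x := (0 : ℝ)) (y := 1)).comp contDiff_snd.contMDiff.contMDiffOn
      (fun x hx => hx.2)

theorem uniqueDiffOn_cylinder {B : Set V} (hB : UniqueDiffOn ℝ B) :
    UniqueDiffOn ℝ (B ×ˢ Icc (0 : ℝ) 1) :=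
  hB.prod (uniqueDiffOn_Icc zero_lt_one)

theorem contMDiff_slice_left {ψ : M × unitInterval → Y}
    (hψ : ContMDiff (𝓘(ℝ, E).prod (𝓡∂ 1)) J ∞ ψ) (s : unitInterval) :
    ContMDiff 𝓘(ℝ, E) J ∞ (fun p => ψ (p, s)) :=
  hψ.comp (contMDiff_id.prodMk contMDiff_const)

theorem contMDiff_slice_right {ψ : M × unitInterval → Y}
    (hψ : ContMDiff (𝓘(ℝ, E).prod (𝓡∂ 1)) J ∞ ψ) (p : M) :
    ContMDiff (𝓡∂ 1) J ∞ (fun s => ψ (p, s)) :=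
  hψ.comp (contMDiff_const.prodMk contMDiff_id)

theorem mfderivWithin_cylinderMap_left {ψ : M × unitInterval → Y} {φ : V → M} {B : Set V}
    (hψ : ContMDiff (𝓘(ℝ, E).prod (𝓡∂ 1)) J ∞ ψ) (hφ : ContMDiffOn 𝓘(ℝ, V) 𝓘(ℝ, E) ∞ φ B)
    (hB : UniqueDiffOn ℝ B) {w : V} (hw : w ∈ B) (s : unitInterval) (u : V) :
    (mfderivWithin 𝓘(ℝ, V × ℝ) J (cylinderMap ψ φ) (B ×ˢ Icc 0 1) (w, (s : ℝ)) (u, (0 : ℝ)) : E') =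
      mfderiv 𝓘(ℝ, E) J (fun p => ψ (p, s)) (φ w) (mfderivWithin 𝓘(ℝ, V) 𝓘(ℝ, E) φ B w u) := by
  have h1 : HasFDerivWithinAt (fun w : V => (w, (s : ℝ)))
      (ContinuousLinearMap.inl ℝ V ℝ) B w :=
    (hasFDerivWithinAt_id w B).prodMk (hasFDerivWithinAt_const _ _ _)
  have h2 := mfderivWithin_comp (I := 𝓘(ℝ, V)) (I' := 𝓘(ℝ, V × ℝ)) (I'' := J)
    (g := cylinderMap ψ φ) (u := B ×ˢ Icc 0 1) (f := fun w : V => (w, (s : ℝ))) (s := B) w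
    ((contMDiffOn_cylinderMap hψ hφ (w, (s : ℝ)) ⟨hw, s.2⟩).mdifferentiableWithinAt (by simp))
    h1.hasMFDerivWithinAt.mdifferentiableWithinAt (fun y hy => ⟨hy, s.2⟩)
    (hB w hw).uniqueMDiffWithinAt
  have h3 : (cylinderMap ψ φ) ∘ (fun w : V => (w, (s : ℝ))) = (fun p => ψ (p, s)) ∘ φ := by
    funext y; exact cylinderMap_apply ψ φ y s
  have h4 := mfderiv_comp_mfderivWithin (I := 𝓘(ℝ, V)) (I' := 𝓘(ℝ, E)) (I'' := J)
    (g := fun p => ψ (p, s)) (f := φ) (s := B) w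
    ((contMDiff_slice_left hψ s).mdifferentiable (by simp) _)
    ((hφ w hw).mdifferentiableWithinAt (by simp)) (hB w hw).uniqueMDiffWithinAt
  have h5 : mfderivWithin 𝓘(ℝ, V) 𝓘(ℝ, V × ℝ) (fun w : V => (w, (s : ℝ))) B w =
      ContinuousLinearMap.inl ℝ V ℝ := by
    rw [mfderivWithin_eq_fderivWithin]; exact h1.fderivWithin (hB w hw)
  have key : ∀ g : V → Y, (cylinderMap ψ φ) ∘ (fun w : V => (w, (s : ℝ))) = g →
      (mfderivWithin 𝓘(ℝ, V) J ((cylinderMap ψ φ) ∘ (fun w : V => (w, (s : ℝ)))) B w u : E') =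
        mfderivWithin 𝓘(ℝ, V) J g B w u := by
    rintro _ rfl; rfl
  have h6 := DFunLike.congr_fun h2 u
  rw [h5] at h6
  exact h6.symm.trans ((key _ h3).trans (DFunLike.congr_fun h4 u))

theorem mfderivWithin_cylinderMap_right {ψ : M × unitInterval → Y} {φ : V → M} {B : Set V}
    (hψ : ContMDiff (𝓘(ℝ, E).prod (𝓡∂ 1)) J ∞ ψ) (hφ : ContMDiffOn 𝓘(ℝ, V) 𝓘(ℝ, E) ∞ φ B)
    {w : V} (hw : w ∈ B) (s : unitInterval) :
    (mfderivWithin 𝓘(ℝ, V × ℝ) J (cylinderMap ψ φ) (B ×ˢ Icc 0 1) (w, (s : ℝ)) ((0 : V), (1 : ℝ)) :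
      E') = mfderiv (𝓡∂ 1) J (fun s => ψ (φ w, s)) s 1 := by
  have h1 : HasFDerivWithinAt (fun s : ℝ => (w, s))
      (ContinuousLinearMap.inr ℝ V ℝ) (Icc 0 1) (s : ℝ) :=
    (hasFDerivWithinAt_const _ _ _).prodMk (hasFDerivWithinAt_id _ _)
  have hu : UniqueDiffWithinAt ℝ (Icc (0 : ℝ) 1) (s : ℝ) := uniqueDiffOn_Icc zero_lt_one _ s.2
  have h2 := mfderivWithin_comp (I := 𝓘(ℝ, ℝ)) (I' := 𝓘(ℝ, V × ℝ)) (I'' := J)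
    (g := cylinderMap ψ φ) (u := B ×ˢ Icc 0 1) (f := fun s : ℝ => (w, s)) (s := Icc 0 1) (s : ℝ)
    ((contMDiffOn_cylinderMap hψ hφ (w, (s : ℝ)) ⟨hw, s.2⟩).mdifferentiableWithinAt (by simp))
    h1.hasMFDerivWithinAt.mdifferentiableWithinAt (fun y hy => ⟨hw, hy⟩)
    hu.uniqueMDiffWithinAt
  have h5 : mfderivWithin 𝓘(ℝ, ℝ) 𝓘(ℝ, V × ℝ) (fun s : ℝ => (w, s)) (Icc 0 1) (s : ℝ) =
      ContinuousLinearMap.inr ℝ V ℝ := by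
    rw [mfderivWithin_eq_fderivWithin]; exact h1.fderivWithin hu
  have h4 := mfderivWithin_comp_projIcc_one (I := J) (f := fun s => ψ (φ w, s)) (w := s)
  have h7 := DFunLike.congr_fun h2 (1 : ℝ)
  rw [h5] at h7
  exact h7.symm.trans h4

end Cylinder

/-! ### Flows transverse to the fibers of a function -/

section TransverseFlow

variable {E : Type*} [NormedAddCommGroup E] [NormedSpace ℝ E]
  {M : Type*} [TopologicalSpace M] [ChartedSpace E M]

/-- A complete flow on `M` transverse to the fibers of a function `t : M → ℝ`: `c p` is the flow
line through `p`, parametrized by the values of `t`. -/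
structure IsTransverseFlow (t : M → ℝ) (c : M → ℝ → M) : Prop where
  contMDiff_time : ContMDiff 𝓘(ℝ, E) 𝓘(ℝ, ℝ) ∞ t
  continuous : Continuous (Function.uncurry c)
  contMDiff_curve : ∀ p, ContMDiff 𝓘(ℝ, ℝ) 𝓘(ℝ, E) ∞ (c p)
  curve_time : ∀ p, c p (t p) = p
  time_curve : ∀ p τ, t (c p τ) = τ
  curve_curve : ∀ p τ, c (c p τ) = c p

variable (E) in
/-- The velocity at `p` of the flow line through `p`. -/
def flowVelocity (t : M → ℝ) (c : M → ℝ → M) (p : M) : TangentSpace 𝓘(ℝ, E) p :=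
  (mfderiv 𝓘(ℝ, ℝ) 𝓘(ℝ, E) (c p) (t p) (1 : ℝ) : E)

namespace IsTransverseFlow

variable {t : M → ℝ} {c : M → ℝ → M}

theorem flowVelocity_curve (hc : IsTransverseFlow (E := E) t c) (p : M) (τ : ℝ) :
    (flowVelocity E t c (c p τ) : E) = mfderiv 𝓘(ℝ, ℝ) 𝓘(ℝ, E) (c p) τ (1 : ℝ) := by
  rw [flowVelocity, hc.curve_curve, hc.time_curve]

theorem mfderiv_time_curve (hc : IsTransverseFlow (E := E) t c) (p : M) (τ : ℝ) :
    (mfderiv 𝓘(ℝ, E) 𝓘(ℝ, ℝ) t (c p τ) (mfderiv 𝓘(ℝ, ℝ) 𝓘(ℝ, E) (c p) τ (1 : ℝ)) : ℝ) = 1 := by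
  have h1 := mfderiv_comp (I := 𝓘(ℝ, ℝ)) (I' := 𝓘(ℝ, E)) (I'' := 𝓘(ℝ, ℝ)) (g := t) (f := c p) τ
    (hc.contMDiff_time.mdifferentiable (by simp) _) ((hc.contMDiff_curve p).mdifferentiable
      (by simp) _)
  have h2 : t ∘ c p = id := funext (hc.time_curve p)
  have key : ∀ g : ℝ → ℝ, t ∘ c p = g → (mfderiv 𝓘(ℝ, ℝ) 𝓘(ℝ, ℝ) (t ∘ c p) τ (1 : ℝ) : ℝ) =
      mfderiv 𝓘(ℝ, ℝ) 𝓘(ℝ, ℝ) g τ (1 : ℝ) := by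
    rintro _ rfl; rfl
  have h3 := DFunLike.congr_fun h1 (1 : ℝ)
  refine h3.symm.trans ((key _ h2).trans ?_)
  rw [mfderiv_id]; rfl

theorem mfderiv_time_flowVelocity (hc : IsTransverseFlow (E := E) t c) (p : M) :
    (mfderiv 𝓘(ℝ, E) 𝓘(ℝ, ℝ) t p (flowVelocity E t c p) : ℝ) = 1 := by
  have h := hc.mfderiv_time_curve p (t p)
  have key : ∀ (q : M) (_ : q = p) (X : E), (mfderiv 𝓘(ℝ, E) 𝓘(ℝ, ℝ) t q X : ℝ) =
      mfderiv 𝓘(ℝ, E) 𝓘(ℝ, ℝ) t p X := by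
    rintro _ rfl _; rfl
  exact (key _ (hc.curve_time p) _).symm.trans h

/-- By the inverse function theorem, there are local parametrizations `φ` in which the function `t`
is affine with linear part `l ≠ 0`. -/
theorem exists_straightening [CompleteSpace E] [IsManifold 𝓘(ℝ, E) ∞ M]
    (hc : IsTransverseFlow (E := E) t c) (p₀ : M) :
    ∃ (B : Set E) (φ : E → M) (l : E →L[ℝ] ℝ) (a : ℝ) (u : E), IsOpen B ∧ Convex ℝ B ∧
      ContMDiffOn 𝓘(ℝ, E) 𝓘(ℝ, E) ∞ φ B ∧ φ '' B ∈ 𝓝 p₀ ∧ (∀ w ∈ B, t (φ w) = l w + a) ∧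
      l u = 1 := by
  set e := extChartAt 𝓘(ℝ, E) p₀ with he
  set z₀ := e p₀ with hz₀
  have hz₀t : z₀ ∈ e.target := mem_extChartAt_target p₀
  have heo : IsOpen e.target := isOpen_extChartAt_target p₀
  set th : E → ℝ := fun z => t (e.symm z) with hth
  have hths : ContDiffOn ℝ ∞ th e.target := by
    rw [← contMDiffOn_iff_contDiffOn]
    exact hc.contMDiff_time.comp_contMDiffOn (contMDiffOn_extChartAt_symm p₀)
  set l : E →L[ℝ] ℝ := fderiv ℝ th z₀ with hl
  have hthd : HasFDerivAt th l z₀ :=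
    ((hths.contDiffAt (heo.mem_nhds hz₀t)).differentiableAt (by simp)).hasFDerivAt
  -- the velocity of the flow line through `p₀`, read in the chart
  obtain ⟨u, hu⟩ : ∃ u, l u = 1 := by
    have h1 : MDifferentiableAt 𝓘(ℝ, ℝ) 𝓘(ℝ, E) (e ∘ c p₀) (t p₀) := by
      refine MDifferentiableAt.comp (I' := 𝓘(ℝ, E)) _ ?_
        ((hc.contMDiff_curve p₀).mdifferentiable (by simp) _)
      rw [hc.curve_time]
      exact mdifferentiableAt_extChartAt (mem_chart_source _ _)
    have h2 : HasFDerivAt (e ∘ c p₀) (fderiv ℝ (e ∘ c p₀) (t p₀)) (t p₀) :=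
      h1.differentiableAt.hasFDerivAt
    have h3 : HasFDerivAt th l ((e ∘ c p₀) (t p₀)) := by
      simpa [hc.curve_time] using hthd
    have h4 := h3.comp (t p₀) h2
    have h5 : th ∘ (e ∘ c p₀) =ᶠ[𝓝 (t p₀)] id := by
      have : ∀ᶠ τ in 𝓝 (t p₀), c p₀ τ ∈ e.source := by
        refine (hc.contMDiff_curve p₀).continuous.continuousAt.eventually_mem ?_
        rw [hc.curve_time]; exact extChartAt_source_mem_nhds p₀
      filter_upwards [this] with τ hτ
      simp [hth, e.left_inv hτ, hc.time_curve]
    have h6 := (h4.congr_of_eventuallyEq h5.symm).unique (hasFDerivAt_id (t p₀))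
    exact ⟨fderiv ℝ (e ∘ c p₀) (t p₀) 1, by simpa using DFunLike.congr_fun h6 (1 : ℝ)⟩
  -- the coordinate change that replaces `t` by its linear part
  set G : E → E := fun z => z + (th z - th z₀ - l (z - z₀)) • u with hG
  have hGs : ContDiffOn ℝ ∞ G e.target := by
    refine contDiffOn_id.add (((hths.sub contDiffOn_const).sub ?_).smul contDiffOn_const)
    exact (l.contDiff.comp (contDiff_id.sub contDiff_const)).contDiffOn
  have hGd : HasFDerivAt G ((ContinuousLinearEquiv.refl ℝ E : E ≃L[ℝ] E) : E →L[ℝ] E) z₀ := by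
    have h1 : HasFDerivAt (fun z => th z - th z₀ - l (z - z₀)) (0 : E →L[ℝ] ℝ) z₀ := by
      have h2 : HasFDerivAt (fun z => l (z - z₀)) l z₀ := by
        exact l.hasFDerivAt.comp z₀ ((hasFDerivAt_id z₀).sub_const z₀)
      have := (hthd.sub_const (th z₀)).sub h2
      rwa [sub_self] at this
    have h3 := (hasFDerivAt_id z₀).add (h1.smul_const u)
    have h4 : ContinuousLinearMap.id ℝ E + (0 : E →L[ℝ] ℝ).smulRight u =
        ((ContinuousLinearEquiv.refl ℝ E : E ≃L[ℝ] E) : E →L[ℝ] E) := by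
      ext; simp
    rw [h4] at h3
    exact h3
  have hlG : ∀ z, l (G z) = th z - th z₀ + l z₀ := by
    intro z
    simp only [hG, map_add, map_smul, map_sub, smul_eq_mul, hu]
    ring
  have hGa : ContDiffAt ℝ ∞ G z₀ := hGs.contDiffAt (heo.mem_nhds hz₀t)
  set R := hGa.toOpenPartialHomeomorph G hGd (by simp) with hR
  have hRG : (R : E → E) = G := rfl
  have hz₀R : z₀ ∈ R.source := hGa.mem_toOpenPartialHomeomorph_source hGd (by simp)
  have hinv : ∀ᶠ z in 𝓝 z₀, ∃ A : E ≃L[ℝ] E, (A : E →L[ℝ] E) = fderiv ℝ G z := by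
    have h1 : ContinuousAt (fderiv ℝ G) z₀ :=
      (hGa.fderiv_right (m := 0) (by simp)).continuousAt
    have h2 := ContinuousLinearEquiv.nhds (ContinuousLinearEquiv.refl ℝ E)
    rw [← hGd.fderiv] at h2
    exact h1.eventually_mem h2
  have hgood : ∀ᶠ w in 𝓝 (R z₀), w ∈ R.target ∧ R.symm w ∈ e.target ∧
      ∃ A : E ≃L[ℝ] E, (A : E →L[ℝ] E) = fderiv ℝ G (R.symm w) := by
    have h1 : Filter.Tendsto R.symm (𝓝 (R z₀)) (𝓝 z₀) := R.tendsto_symm hz₀R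
    exact (R.open_target.eventually_mem (R.map_source hz₀R)).and
      ((h1.eventually (heo.eventually_mem hz₀t)).and (h1.eventually hinv))
  obtain ⟨r, hr, hball⟩ := Metric.eventually_nhds_iff_ball.1 hgood
  refine ⟨Metric.ball (R z₀) r, fun w => e.symm (R.symm w), l, th z₀ - l z₀, u, Metric.isOpen_ball,
    convex_ball _ _, ?_, ?_, ?_, hu⟩
  · refine (contMDiffOn_extChartAt_symm p₀).comp ?_ (fun w hw => (hball w hw).2.1)
    rw [contMDiffOn_iff_contDiffOn]
    intro w hw
    obtain ⟨hw1, hw2, A, hA⟩ := hball w hw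
    have h3 : ContDiffAt ℝ ∞ G (R.symm w) := hGs.contDiffAt (heo.mem_nhds hw2)
    refine (R.contDiffAt_symm hw1 (f₀' := A) ?_ h3).contDiffWithinAt
    rw [hA]
    exact (h3.differentiableAt (by simp)).hasFDerivAt
  · have h1 : ∀ᶠ z in 𝓝 z₀, z ∈ R.source ∧ R z ∈ Metric.ball (R z₀) r :=
      (R.open_source.eventually_mem hz₀R).and
        ((R.continuousAt hz₀R).eventually_mem (Metric.ball_mem_nhds _ hr))
    have h2 : ∀ᶠ p in 𝓝 p₀, p ∈ e.source ∧ (e p ∈ R.source ∧ R (e p) ∈ Metric.ball (R z₀) r) :=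
      ((isOpen_extChartAt_source p₀).eventually_mem (mem_extChartAt_source p₀)).and
        ((continuousAt_extChartAt p₀).eventually h1)
    filter_upwards [h2] with p hp
    refine ⟨R (e p), hp.2.2, ?_⟩
    simp only [R.left_inv hp.2.1, e.left_inv hp.1]
  · intro w hw
    have h1 := hlG (R.symm w)
    have h2 : G (R.symm w) = w := R.right_inv (hball w hw).1
    rw [h2] at h1
    simp only [h1, hth]
    ring

end IsTransverseFlow

end TransverseFlow

/-! ### Primitives of the slice forms -/

section Primitive

variable {E : Type*} [NormedAddCommGroup E] [NormedSpace ℝ E]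
  {M : Type*} [TopologicalSpace M] [ChartedSpace E M]
  {E' : Type*} [NormedAddCommGroup E'] [NormedSpace ℝ E']
  {H' : Type*} [TopologicalSpace H'] {J : ModelWithCorners ℝ E' H'}
  {Y : Type*} [TopologicalSpace Y] [ChartedSpace H' Y]
  {V : Type*} [NormedAddCommGroup V] [NormedSpace ℝ V]

/-- The `1`-form `X ↦ (ψ^* Ω)(X, ∂_s)` on the slice `M × {s}` of `M × [0,1]`. -/
def sliceForm (Ω : DiffForm J Y 2) (ψ : M × unitInterval → Y) (s : unitInterval) (p : M)
    (X : TangentSpace 𝓘(ℝ, E) p) : ℝ :=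
  Ω (ψ (p, s)) ![mfderiv 𝓘(ℝ, E) J (fun p => ψ (p, s)) p X,
    mfderiv (𝓡∂ 1) J (fun s => ψ (p, s)) s 1]

theorem sliceForm_add (Ω : DiffForm J Y 2) (ψ : M × unitInterval → Y) (s : unitInterval) (p : M)
    (X Z : TangentSpace 𝓘(ℝ, E) p) :
    sliceForm Ω ψ s p (X + Z) = sliceForm Ω ψ s p X + sliceForm Ω ψ s p Z := by
  simp only [sliceForm, map_add]
  exact ContinuousAlternatingMap.vecCons_add _ _ _ _

theorem sliceForm_smul (Ω : DiffForm J Y 2) (ψ : M × unitInterval → Y) (s : unitInterval) (p : M)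
    (r : ℝ) (X : TangentSpace 𝓘(ℝ, E) p) :
    sliceForm Ω ψ s p (r • X) = r * sliceForm Ω ψ s p X := by
  simp only [sliceForm, map_smul]
  exact ContinuousAlternatingMap.vecCons_smul _ _ _ _

theorem DiffForm.apply_congr {k : ℕ} (α : DiffForm J Y k) {y y' : Y} (h : y = y')
    (m : Fin k → E') : (α y : E' [⋀^Fin k]→L[ℝ] ℝ) m = (α y' : E' [⋀^Fin k]→L[ℝ] ℝ) m := by
  subst h; rfl

theorem DiffForm.pullbackWithin_apply_two (Ω : DiffForm J Y 2) (κ : V → Y) (S : Set V) (x u w : V) :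
    Ω.pullbackWithin J κ S x ![u, w] =
      Ω (κ x) ![mfderivWithin 𝓘(ℝ, V) J κ S x u, mfderivWithin 𝓘(ℝ, V) J κ S x w] := by
  change Ω (κ x) _ = _
  congr 1
  ext i; fin_cases i <;> rfl

theorem pullbackWithin_cylinderMap_apply (Ω : DiffForm J Y 2) {ψ : M × unitInterval → Y}
    {φ : V → M} {B : Set V}
    (hψ : ContMDiff (𝓘(ℝ, E).prod (𝓡∂ 1)) J ∞ ψ) (hφ : ContMDiffOn 𝓘(ℝ, V) 𝓘(ℝ, E) ∞ φ B)
    (hB : UniqueDiffOn ℝ B) {w : V} (hw : w ∈ B) (s : unitInterval) (u : V) :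
    Ω.pullbackWithin J (cylinderMap ψ φ) (B ×ˢ Icc 0 1) (w, (s : ℝ)) ![(u, 0), (0, 1)] =
      sliceForm Ω ψ s (φ w) (mfderivWithin 𝓘(ℝ, V) 𝓘(ℝ, E) φ B w u) := by
  rw [DiffForm.pullbackWithin_apply_two]
  refine (Ω.apply_congr (cylinderMap_apply ψ φ w s) _).trans ?_
  rw [mfderivWithin_cylinderMap_left hψ hφ hB hw s u, mfderivWithin_cylinderMap_right hψ hφ hw s]
  rfl

theorem pullbackWithin_cylinderMap_apply_eq_zero {Ω : DiffForm J Y 2} {ψ : M × unitInterval → Y}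
    {φ : V → M} {B : Set V}
    (hψ : ContMDiff (𝓘(ℝ, E).prod (𝓡∂ 1)) J ∞ ψ) (hφ : ContMDiffOn 𝓘(ℝ, V) 𝓘(ℝ, E) ∞ φ B)
    (hlag : ∀ s, Ω.pullback 𝓘(ℝ, E) J (fun p => ψ (p, s)) = 0)
    (hB : UniqueDiffOn ℝ B) {w : V} (hw : w ∈ B) (s : unitInterval) (u k : V) :
    Ω.pullbackWithin J (cylinderMap ψ φ) (B ×ˢ Icc 0 1) (w, (s : ℝ)) ![(u, 0), (k, 0)] = 0 := by
  rw [DiffForm.pullbackWithin_apply_two]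
  refine (Ω.apply_congr (cylinderMap_apply ψ φ w s) _).trans ?_
  rw [mfderivWithin_cylinderMap_left hψ hφ hB hw s u,
    mfderivWithin_cylinderMap_left hψ hφ hB hw s k]
  have h := DFunLike.congr_fun (congrFun (hlag s) (φ w))
    ![mfderivWithin 𝓘(ℝ, V) 𝓘(ℝ, E) φ B w u, mfderivWithin 𝓘(ℝ, V) 𝓘(ℝ, E) φ B w k]
  refine Eq.trans ?_ h
  change _ = Ω (ψ (φ w, s)) _
  congr 1
  ext i; fin_cases i <;> rfl

variable {t : M → ℝ} {c : M → ℝ → M} {Ω : DiffForm J Y 2} {ψ : M × unitInterval → Y}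

/-- A `1`-form on `M` that vanishes on `ker dt` is a multiple of `dt`. -/
theorem IsTransverseFlow.sliceForm_eq (hc : IsTransverseFlow (E := E) t c)
    (hvert : ∀ s p (X : TangentSpace 𝓘(ℝ, E) p), mfderiv 𝓘(ℝ, E) 𝓘(ℝ, ℝ) t p X = 0 →
      sliceForm Ω ψ s p X = 0) (s : unitInterval) (p : M) (X : TangentSpace 𝓘(ℝ, E) p) {r : ℝ}
    (hr : mfderiv 𝓘(ℝ, E) 𝓘(ℝ, ℝ) t p X = r) :
    sliceForm Ω ψ s p X = r * sliceForm Ω ψ s p (flowVelocity E t c p) := by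
  have h1 : mfderiv 𝓘(ℝ, E) 𝓘(ℝ, ℝ) t p (X + (-r) • flowVelocity E t c p) = 0 := by
    rw [map_add, map_smul]
    have : mfderiv 𝓘(ℝ, E) 𝓘(ℝ, ℝ) t p (flowVelocity E t c p) = (1 : ℝ) :=
      hc.mfderiv_time_flowVelocity p
    rw [this, hr]
    change r + (-r) * 1 = (0 : ℝ)
    ring
  have h2 := hvert s p _ h1
  rw [sliceForm_add, sliceForm_smul] at h2
  linarith

theorem IsTransverseFlow.contDiffOn_sliceForm [IsManifold J ∞ Y]
    (hc : IsTransverseFlow (E := E) t c) (hΩ : Ω.IsSmooth J)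
    (hψ : ContMDiff (𝓘(ℝ, E).prod (𝓡∂ 1)) J ∞ ψ) (p : M) :
    ContDiffOn ℝ ∞ (fun x : ℝ × ℝ => sliceForm Ω ψ (projIcc 0 1 zero_le_one x.2) (c p x.1)
      (flowVelocity E t c (c p x.1))) (univ ×ˢ Icc 0 1) := by
  have h1 := hΩ.contDiffOn_pullbackWithin_apply
    (contMDiffOn_cylinderMap hψ (hc.contMDiff_curve p).contMDiffOn (B := univ))
    (uniqueDiffOn_cylinder uniqueDiffOn_univ) ![((1 : ℝ), (0 : ℝ)), (0, 1)]
  refine h1.congr (fun x hx => ?_)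
  obtain ⟨τ, s⟩ := x
  have h2 := pullbackWithin_cylinderMap_apply Ω hψ (hc.contMDiff_curve p).contMDiffOn
    uniqueDiffOn_univ (mem_univ τ) ⟨s, hx.2⟩ (1 : ℝ)
  refine Eq.trans ?_ h2.symm
  simp only [projIcc_of_mem _ hx.2]
  congr 1
  rw [mfderivWithin_univ]
  exact hc.flowVelocity_curve p τ

/-- The coefficient of `dt` in the slice forms is constant on the fibers of `t`, locally on `M`:
this is the closedness of `ψ^* Ω`. -/
theorem IsTransverseFlow.eventually_sliceForm_eq [CompleteSpace E] [IsManifold 𝓘(ℝ, E) ∞ M]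
    [IsManifold J ∞ Y] (hc : IsTransverseFlow (E := E) t c) (hΩ : Ω.IsSmooth J)
    (hΩc : Ω.IsClosed J) (hψ : ContMDiff (𝓘(ℝ, E).prod (𝓡∂ 1)) J ∞ ψ)
    (hlag : ∀ s, Ω.pullback 𝓘(ℝ, E) J (fun p => ψ (p, s)) = 0)
    (hvert : ∀ s p (X : TangentSpace 𝓘(ℝ, E) p), mfderiv 𝓘(ℝ, E) 𝓘(ℝ, ℝ) t p X = 0 →
      sliceForm Ω ψ s p X = 0) (p₀ : M) :
    ∃ W ∈ 𝓝 p₀, ∀ p ∈ W, ∀ p' ∈ W, t p = t p' → ∀ s,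
      sliceForm Ω ψ s p (flowVelocity E t c p) = sliceForm Ω ψ s p' (flowVelocity E t c p') := by
  obtain ⟨B, φ, l, a, u, hBo, hBc, hφ, hW, htφ, hu⟩ := hc.exists_straightening p₀
  refine ⟨_, hW, ?_⟩
  rintro _ ⟨w, hw, rfl⟩ _ ⟨w', hw', rfl⟩ hww s
  rw [htφ w hw, htφ w' hw', add_left_inj] at hww
  have hBu := hBo.uniqueDiffOn (𝕜 := ℝ)
  set S : Set (E × ℝ) := B ×ˢ Icc 0 1 with hS
  have hSu : UniqueDiffOn ℝ S := uniqueDiffOn_cylinder hBu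
  set Θ := Ω.pullbackWithin J (cylinderMap ψ φ) S with hΘ
  have hκ := contMDiffOn_cylinderMap hψ hφ
  have hSc : ∀ x ∈ S, x ∈ closure (interior S) := by
    intro x hx
    rw [hS, interior_prod_eq, hBo.interior_eq, interior_Icc, closure_prod_eq,
      closure_Ioo zero_ne_one]
    exact ⟨subset_closure hx.1, hx.2⟩
  have hdt : ∀ w ∈ B, ∀ X : E, (mfderiv 𝓘(ℝ, E) 𝓘(ℝ, ℝ) t (φ w)
      (mfderivWithin 𝓘(ℝ, E) 𝓘(ℝ, E) φ B w X) : ℝ) = l X := by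
    intro w hw X
    have h1 := mfderiv_comp_mfderivWithin (I := 𝓘(ℝ, E)) (I' := 𝓘(ℝ, E)) (I'' := 𝓘(ℝ, ℝ))
      (g := t) (f := φ) (s := B) w (hc.contMDiff_time.mdifferentiable (by simp) _)
      ((hφ w hw).mdifferentiableWithinAt (by simp)) (hBu w hw).uniqueMDiffWithinAt
    have h2 : mfderivWithin 𝓘(ℝ, E) 𝓘(ℝ, ℝ) (t ∘ φ) B w = l := by
      rw [mfderivWithin_eq_fderivWithin]
      have h3 : HasFDerivWithinAt (fun w => l w + a) l B w := l.hasFDerivWithinAt.add_const a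
      exact (h3.congr htφ (htφ w hw)).fderivWithin (hBu w hw)
    exact (DFunLike.congr_fun h1 X).symm.trans (DFunLike.congr_fun h2 X)
  have hval : ∀ w ∈ B, ∀ (s : unitInterval) (X : E), Θ (w, (s : ℝ)) ![(X, 0), (0, 1)] =
      l X * sliceForm Ω ψ s (φ w) (flowVelocity E t c (φ w)) := by
    intro w hw s X
    rw [hΘ, hS, pullbackWithin_cylinderMap_apply Ω hψ hφ hBu hw s X,
      hc.sliceForm_eq hvert _ _ _ (hdt w hw X)]
  -- the direction `w' - w` is tangent to the fibers of `t`, so `Θ` vanishes on `(w' - w, ∂_s)`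
  have hk : l (w' - w) = 0 := by rw [map_sub, hww, sub_self]
  have h4 := eq_of_fderivWithin_prod_eq_zero (g := fun x => Θ x ![(u, 0), (0, 1)]) hBc
    ((hΩ.contDiffOn_pullbackWithin_apply hκ hSu _).differentiableOn (by simp)) hw hw' s.2
    (fun x hx => fderivWithin_apply_two_eq_zero_of_extDerivWithin_eq_zero
      (hΩ.differentiableOn_pullbackWithin hκ hSu) hSu
      (fun y hy => hΩc.extDerivWithin_pullbackWithin hΩ hκ hSu hy (hSc y hy))
      (fun y hy => by
        have := hval y.1 hy.1 ⟨y.2, hy.2⟩ (w' - w)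
        rw [hk, zero_mul] at this
        exact this)
      (fun y hy => pullbackWithin_cylinderMap_apply_eq_zero hψ hφ hlag hBu hy.1 ⟨y.2, hy.2⟩ _ _)
      (x := (x, (s : ℝ))) ⟨hx, s.2⟩)
  rw [hval w hw s u, hval w' hw' s u, hu, one_mul, one_mul] at h4
  exact h4

/-- The coefficient of `dt` in the slice forms agrees along neighboring flow lines, over compact
time intervals. -/
theorem IsTransverseFlow.eventually_sliceForm_curve_eq [CompleteSpace E] [IsManifold 𝓘(ℝ, E) ∞ M]
    [IsManifold J ∞ Y] (hc : IsTransverseFlow (E := E) t c) (hΩ : Ω.IsSmooth J)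
    (hΩc : Ω.IsClosed J) (hψ : ContMDiff (𝓘(ℝ, E).prod (𝓡∂ 1)) J ∞ ψ)
    (hlag : ∀ s, Ω.pullback 𝓘(ℝ, E) J (fun p => ψ (p, s)) = 0)
    (hvert : ∀ s p (X : TangentSpace 𝓘(ℝ, E) p), mfderiv 𝓘(ℝ, E) 𝓘(ℝ, ℝ) t p X = 0 →
      sliceForm Ω ψ s p X = 0) (t₀ : ℝ) (p₀ : M) :
    ∀ᶠ p in 𝓝 p₀, ∀ τ ∈ uIcc t₀ (t p), ∀ s,
      sliceForm Ω ψ s (c p τ) (flowVelocity E t c (c p τ)) =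
        sliceForm Ω ψ s (c p₀ τ) (flowVelocity E t c (c p₀ τ)) := by
  set K : Set ℝ := Icc (min t₀ (t p₀ - 1)) (max t₀ (t p₀ + 1)) with hK
  have h1 : ∀ᶠ p in 𝓝 p₀, ∀ τ ∈ K, ∀ s,
      sliceForm Ω ψ s (c p τ) (flowVelocity E t c (c p τ)) =
        sliceForm Ω ψ s (c p₀ τ) (flowVelocity E t c (c p₀ τ)) := by
    refine isCompact_Icc.eventually_forall_of_forall_eventually (fun τ _ => ?_)
    obtain ⟨W, hW, h⟩ := hc.eventually_sliceForm_eq hΩ hΩc hψ hlag hvert (c p₀ τ)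
    have h2 : ∀ᶠ z : M × ℝ in 𝓝 (p₀, τ), c z.1 z.2 ∈ W :=
      hc.continuous.continuousAt.eventually_mem hW
    have h3 : ∀ᶠ z : M × ℝ in 𝓝 (p₀, τ), c p₀ z.2 ∈ W := by
      have : Continuous fun z : M × ℝ => c p₀ z.2 :=
        (hc.contMDiff_curve p₀).continuous.comp continuous_snd
      exact this.continuousAt.eventually_mem hW
    filter_upwards [h2, h3] with z hz hz'
    exact h _ hz _ hz' (by rw [hc.time_curve, hc.time_curve])
  have h2 : ∀ᶠ p in 𝓝 p₀, t p ∈ Ioo (t p₀ - 1) (t p₀ + 1) :=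
    hc.contMDiff_time.continuous.continuousAt.eventually_mem
      (Ioo_mem_nhds (by linarith) (by linarith))
  filter_upwards [h1, h2] with p hp hp' τ hτ
  refine hp τ (uIcc_subset_Icc ?_ ?_ hτ)
  · exact ⟨min_le_left _ _, le_max_left _ _⟩
  · exact ⟨(min_le_right _ _).trans hp'.1.le, hp'.2.le.trans (le_max_right _ _)⟩

/-- The slice forms have primitives that depend smoothly on the slice: integrate them along the
flow lines. -/
theorem IsTransverseFlow.exists_primitive [CompleteSpace E] [IsManifold 𝓘(ℝ, E) ∞ M]
    [IsManifold J ∞ Y] (hc : IsTransverseFlow (E := E) t c) (hΩ : Ω.IsSmooth J)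
    (hΩc : Ω.IsClosed J) (hψ : ContMDiff (𝓘(ℝ, E).prod (𝓡∂ 1)) J ∞ ψ)
    (hlag : ∀ s, Ω.pullback 𝓘(ℝ, E) J (fun p => ψ (p, s)) = 0)
    (hvert : ∀ s p (X : TangentSpace 𝓘(ℝ, E) p), mfderiv 𝓘(ℝ, E) 𝓘(ℝ, ℝ) t p X = 0 →
      sliceForm Ω ψ s p X = 0) :
    ∃ H : M × unitInterval → ℝ, ContMDiff (𝓘(ℝ, E).prod (𝓡∂ 1)) 𝓘(ℝ, ℝ) ∞ H ∧
      ∀ s p (X : TangentSpace 𝓘(ℝ, E) p),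
        (mfderiv 𝓘(ℝ, E) 𝓘(ℝ, ℝ) (fun p => H (p, s)) p X : ℝ) = sliceForm Ω ψ s p X := by
  set f : M → ℝ × ℝ → ℝ := fun p x => sliceForm Ω ψ (projIcc 0 1 zero_le_one x.2) (c p x.1)
      (flowVelocity E t c (c p x.1)) with hf
  set G : M → ℝ × ℝ → ℝ := fun p x => ∫ τ in (0 : ℝ)..x.1, f p (τ, x.2) with hG
  have hGs : ∀ p, ContDiffOn ℝ ∞ (G p) (univ ×ˢ Icc 0 1) := fun p =>
    (hc.contDiffOn_sliceForm hΩ hψ p).integral_strip 0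
  set H : M × unitInterval → ℝ := fun x => G x.1 (t x.1, x.2) with hH
  -- near `p₀`, the function `H` is a function of `(t, s)` given by the flow line through `p₀`
  have hloc : ∀ p₀, ∀ᶠ p in 𝓝 p₀, ∀ s, H (p, s) = G p₀ (t p, s) := by
    intro p₀
    filter_upwards [hc.eventually_sliceForm_curve_eq hΩ hΩc hψ hlag hvert 0 p₀] with p hp s
    exact intervalIntegral.integral_congr (fun τ hτ => hp τ hτ _)
  refine ⟨H, fun x => ?_, fun s p₀ X => ?_⟩
  · obtain ⟨p₀, s₀⟩ := x
    have h1 : ContMDiff (𝓘(ℝ, E).prod (𝓡∂ 1)) 𝓘(ℝ, ℝ × ℝ) ∞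
        (fun x : M × unitInterval => (t x.1, (x.2 : ℝ))) :=
      (hc.contMDiff_time.comp contMDiff_fst).prodMk_space
        ((contMDiff_subtypeVal_Icc (x := (0 : ℝ)) (y := 1)).comp contMDiff_snd)
    have h2 : ContMDiff (𝓘(ℝ, E).prod (𝓡∂ 1)) 𝓘(ℝ, ℝ) ∞
        (fun x : M × unitInterval => G p₀ (t x.1, (x.2 : ℝ))) :=
      (hGs p₀).contMDiffOn.comp_contMDiff h1 (fun x => ⟨mem_univ _, x.2.2⟩)
    refine (h2 (p₀, s₀)).congr_of_eventuallyEq ?_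
    filter_upwards [continuous_fst.continuousAt.eventually (hloc p₀)] with x hx
    exact hx x.2
  · have h1 : HasFDerivAt (fun τ : ℝ => G p₀ (τ, s))
        (f p₀ (t p₀, s) • ContinuousLinearMap.id ℝ ℝ) (t p₀) := by
      have h2 := hasFDerivWithinAt_integral_strip 0
        ((hc.contDiffOn_sliceForm hΩ hψ p₀).of_le (m := 1) (by simp)) (x₀ := (t p₀, (s : ℝ))) s.2
      have h3 : HasFDerivWithinAt (fun τ : ℝ => (τ, (s : ℝ))) (ContinuousLinearMap.inl ℝ ℝ ℝ) univ
          (t p₀) := (hasFDerivWithinAt_id _ _).prodMk (hasFDerivWithinAt_const _ _ _)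
      have h4 := h2.comp (t := univ ×ˢ Icc (0 : ℝ) 1) (t p₀) h3 (fun τ _ => ⟨mem_univ _, s.2⟩)
      rw [hasFDerivWithinAt_univ] at h4
      refine h4.congr_fderiv ?_
      ext; simp [hf]
    have h5 : (fun p => H (p, s)) =ᶠ[𝓝 p₀] (fun τ : ℝ => G p₀ (τ, s)) ∘ t := by
      filter_upwards [hloc p₀] with p hp
      exact hp s
    have h6 := mfderiv_comp (I := 𝓘(ℝ, E)) (I' := 𝓘(ℝ, ℝ)) (I'' := 𝓘(ℝ, ℝ))
      (g := fun τ : ℝ => G p₀ (τ, s)) (f := t) p₀ h1.differentiableAt.mdifferentiableAt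
      (hc.contMDiff_time.mdifferentiable (by simp) _)
    rw [h5.mfderiv_eq]
    refine (DFunLike.congr_fun h6 X).trans ?_
    have h7 : mfderiv 𝓘(ℝ, ℝ) 𝓘(ℝ, ℝ) (fun τ : ℝ => G p₀ (τ, s)) (t p₀) =
        f p₀ (t p₀, s) • ContinuousLinearMap.id ℝ ℝ := by
      rw [mfderiv_eq_fderiv]; exact h1.fderiv
    rw [h7, hc.sliceForm_eq hvert s p₀ X rfl]
    refine (mul_comm (f p₀ (t p₀, s)) _).trans ?_
    have h8 : f p₀ (t p₀, s) = sliceForm Ω ψ s p₀ (flowVelocity E t c p₀) := by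
      simp only [hf, projIcc_val]
      exact congrArg (fun q => sliceForm Ω ψ s q (flowVelocity E t c q)) (hc.curve_time p₀)
    rw [h8]
    rfl

end Primitive

/-! ### Forms on a cylinder as pairs of components -/

section Potential

/-- Subtracting an exact form from a closed one leaves a closed form. -/
theorem extDerivWithin_sub_ofSubsingleton_fderivWithin
    {V : Type*} [NormedAddCommGroup V] [NormedSpace ℝ V] {S : Set V}
    {δ : V → V [⋀^Fin 1]→L[ℝ] ℝ} {f : V → ℝ} {x : V} (hδ : DifferentiableWithinAt ℝ δ S x)
    (hf : ContDiffOn ℝ ∞ f S) (hS : UniqueDiffOn ℝ S) (hx : x ∈ S)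
    (hxc : x ∈ closure (interior S)) :
    extDerivWithin (fun x => δ x - ContinuousAlternatingMap.ofSubsingleton ℝ V ℝ (0 : Fin 1)
      (fderivWithin ℝ f S x)) S x = extDerivWithin δ S x := by
  have h1 : ∀ y ∈ S, ContinuousAlternatingMap.ofSubsingleton ℝ V ℝ (0 : Fin 1)
      (fderivWithin ℝ f S y) =
        extDerivWithin (fun y => ContinuousAlternatingMap.constOfIsEmpty ℝ V (Fin 0) (f y)) S y :=
    fun y hy => (extDerivWithin_constOfIsEmpty f (hS y hy)).symm
  have h2 : ContDiffOn ℝ ∞ (fun y => ContinuousAlternatingMap.constOfIsEmpty ℝ V (Fin 0) (f y)) S :=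
    (ContinuousAlternatingMap.constOfIsEmptyLIE (𝕜 := ℝ) (E := V) (F := ℝ)
      (ι := Fin 0)).toContinuousLinearEquiv.contDiff.comp_contDiffOn hf
  have h3 : DifferentiableWithinAt ℝ (fun y => ContinuousAlternatingMap.ofSubsingleton ℝ V ℝ
      (0 : Fin 1) (fderivWithin ℝ f S y)) S x := by
    have h4 : DifferentiableWithinAt ℝ (fderivWithin ℝ f S) S x :=
      (hf.fderivWithin hS (m := ∞) (by simp)).differentiableOn (by simp) x hx
    exact (ContinuousAlternatingMap.ofSubsingletonLIE (𝕜 := ℝ) (E := V) (F := ℝ)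
      (0 : Fin 1)).toContinuousLinearEquiv.differentiableAt.comp_differentiableWithinAt x h4
  have h5 : extDerivWithin (fun y => ContinuousAlternatingMap.ofSubsingleton ℝ V ℝ (0 : Fin 1)
      (fderivWithin ℝ f S y)) S x = 0 := by
    rw [extDerivWithin_congr' h1 hx]
    exact extDerivWithin_extDerivWithin_apply (r := ∞) (h2 x hx)
      (by simp; exact WithTop.coe_le_coe.2 le_top) hS hxc hx
  have h6 : extDerivWithin (fun x => δ x - ContinuousAlternatingMap.ofSubsingleton ℝ V ℝ
      (0 : Fin 1) (fderivWithin ℝ f S x)) S x = extDerivWithin δ S x -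
        extDerivWithin (fun y => ContinuousAlternatingMap.ofSubsingleton ℝ V ℝ (0 : Fin 1)
          (fderivWithin ℝ f S y)) S x := by
    simp only [extDerivWithin]
    rw [fderivWithin_fun_sub (hS x hx) hδ h3]
    exact (ContinuousAlternatingMap.alternatizeUncurryFinCLM ℝ V ℝ).map_sub _ _
  rw [h6, h5, sub_zero]

variable {E : Type*} [NormedAddCommGroup E] [NormedSpace ℝ E]
  {M : Type*} [TopologicalSpace M] [ChartedSpace E M]
  {E' : Type*} [NormedAddCommGroup E'] [NormedSpace ℝ E']
  {H' : Type*} [TopologicalSpace H'] {J : ModelWithCorners ℝ E' H'}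
  {Y : Type*} [TopologicalSpace Y] [ChartedSpace H' Y]

/-- The tangent vector `(X, 0)` of `M × [0,1]`. -/
def tangentInl (s : unitInterval) {p : M} (X : TangentSpace 𝓘(ℝ, E) p) :
    TangentSpace (𝓘(ℝ, E).prod (𝓡∂ 1)) (p, s) :=
  (X, (0 : TangentSpace (𝓡∂ 1) s))

variable (E) in
/-- The tangent vector `∂_s` of `M × [0,1]`. -/
def tangentDs (s : unitInterval) (p : M) : TangentSpace (𝓘(ℝ, E).prod (𝓡∂ 1)) (p, s) :=
  ((0 : TangentSpace 𝓘(ℝ, E) p), (1 : TangentSpace (𝓡∂ 1) s))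

theorem exists_eq_tangentInl_add (s : unitInterval) (p : M)
    (X : TangentSpace (𝓘(ℝ, E).prod (𝓡∂ 1)) (p, s)) :
    ∃ (X' : TangentSpace 𝓘(ℝ, E) p) (r : ℝ), X = tangentInl s X' + r • tangentDs E s p := by
  obtain ⟨r, hr⟩ := exists_eq_smul_one_tangentSpace_unitInterval s X.2
  refine ⟨X.1, r, Prod.ext ?_ ?_⟩
  · change X.1 = X.1 + r • (0 : E)
    simp
  · change X.2 = (0 : TangentSpace (𝓡∂ 1) s) + r • (1 : TangentSpace (𝓡∂ 1) s)
    rw [zero_add, hr]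

theorem mfderiv_tangentInl {F : M × unitInterval → Y} {s : unitInterval} {p : M}
    (hF : MDifferentiableAt (𝓘(ℝ, E).prod (𝓡∂ 1)) J F (p, s)) (X : TangentSpace 𝓘(ℝ, E) p) :
    mfderiv (𝓘(ℝ, E).prod (𝓡∂ 1)) J F (p, s) (tangentInl s X) =
      mfderiv 𝓘(ℝ, E) J (fun p => F (p, s)) p X := by
  rw [mfderiv_prod_eq_add_apply hF]
  have : mfderiv (𝓡∂ 1) J (fun s => F (p, s)) s (0 : TangentSpace (𝓡∂ 1) s) = 0 := map_zero _
  exact (congrArg (mfderiv 𝓘(ℝ, E) J (fun p => F (p, s)) p X + ·) this).trans (add_zero _)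

theorem mfderiv_tangentDs {F : M × unitInterval → Y} {s : unitInterval} {p : M}
    (hF : MDifferentiableAt (𝓘(ℝ, E).prod (𝓡∂ 1)) J F (p, s)) :
    mfderiv (𝓘(ℝ, E).prod (𝓡∂ 1)) J F (p, s) (tangentDs E s p) =
      mfderiv (𝓡∂ 1) J (fun s => F (p, s)) s 1 := by
  rw [mfderiv_prod_eq_add_apply hF]
  have : mfderiv 𝓘(ℝ, E) J (fun p => F (p, s)) p (0 : TangentSpace 𝓘(ℝ, E) p) = 0 := map_zero _
  exact (congrArg (· + mfderiv (𝓡∂ 1) J (fun s => F (p, s)) s 1) this).trans (zero_add _)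

theorem DiffForm.d_apply {H₀ : Type*} [TopologicalSpace H₀] {E₀ : Type*} [NormedAddCommGroup E₀]
    [NormedSpace ℝ E₀] (I : ModelWithCorners ℝ E₀ H₀) {N : Type*} [TopologicalSpace N]
    [ChartedSpace H₀ N] (f : N → ℝ) (p : N) (X : TangentSpace I p) :
    DiffForm.d I f p ![X] = (mfderiv I 𝓘(ℝ, ℝ) f p X : ℝ) := rfl

variable (E M) in
theorem contMDiff_coe_snd :
    ContMDiff (𝓘(ℝ, E).prod (𝓡∂ 1)) 𝓘(ℝ, ℝ) ∞ (fun x : M × unitInterval => (x.2 : ℝ)) :=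
  (contMDiff_subtypeVal_Icc (x := (0 : ℝ)) (y := 1)).comp contMDiff_snd

theorem d_coe_snd_tangentInl (s : unitInterval) {p : M} (X : TangentSpace 𝓘(ℝ, E) p) :
    DiffForm.d (𝓘(ℝ, E).prod (𝓡∂ 1)) (fun x : M × unitInterval => (x.2 : ℝ)) (p, s)
      ![tangentInl s X] = 0 := by
  rw [DiffForm.d_apply,
    mfderiv_tangentInl ((contMDiff_coe_snd E M).mdifferentiable (by simp) (p, s))]
  exact DFunLike.congr_fun (mfderiv_const (I := 𝓘(ℝ, E)) (I' := 𝓘(ℝ, ℝ)) (c := (s : ℝ))) X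

theorem d_coe_snd_tangentDs (s : unitInterval) (p : M) :
    DiffForm.d (𝓘(ℝ, E).prod (𝓡∂ 1)) (fun x : M × unitInterval => (x.2 : ℝ)) (p, s)
      ![tangentDs E s p] = 1 := by
  rw [DiffForm.d_apply,
    mfderiv_tangentDs ((contMDiff_coe_snd E M).mdifferentiable (by simp) (p, s))]
  exact mfderiv_subtypeVal_Icc_one s

theorem ContinuousAlternatingMap.apply_two_add_smul {V : Type*} [AddCommGroup V] [Module ℝ V]
    [TopologicalSpace V] (ω₂ : V [⋀^Fin 2]→L[ℝ] ℝ) (A A' S : V) (a a' : ℝ) :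
    ω₂ ![A + a • S, A' + a' • S] = ω₂ ![A, A'] + a' * ω₂ ![A, S] - a * ω₂ ![A', S] := by
  have hl : ∀ X Z W : V, ω₂ ![X + Z, W] = ω₂ ![X, W] + ω₂ ![Z, W] := fun X Z W =>
    ω₂.vecCons_add _ _ _
  have hs : ∀ (r : ℝ) (X W : V), ω₂ ![r • X, W] = r * ω₂ ![X, W] := fun r X W =>
    ω₂.vecCons_smul _ _ _
  have hr : ∀ X Z W : V, ω₂ ![W, X + Z] = ω₂ ![W, X] + ω₂ ![W, Z] := fun X Z W => by
    rw [ω₂.apply_swap_two, hl, ω₂.apply_swap_two X, ω₂.apply_swap_two Z]; ring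
  have hrs : ∀ (r : ℝ) (X W : V), ω₂ ![W, r • X] = r * ω₂ ![W, X] := fun r X W => by
    rw [ω₂.apply_swap_two, hs, ω₂.apply_swap_two X]; ring
  have h0 : ω₂ ![S, S] = 0 := by
    have := ω₂.apply_swap_two S S
    linarith
  rw [hl, hr, hr, hs, hs, hrs, hrs, h0, ω₂.apply_swap_two S A']
  ring

theorem DiffForm.apply_tangentInl_add_smul
    (α : DiffForm (𝓘(ℝ, E).prod (𝓡∂ 1)) (M × unitInterval) 1) (s : unitInterval) {p : M}
    (X : TangentSpace 𝓘(ℝ, E) p) (r : ℝ) : α (p, s) ![tangentInl s X + r • tangentDs E s p] =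
      α (p, s) ![tangentInl s X] + r * α (p, s) ![tangentDs E s p] := by
  rw [ContinuousAlternatingMap.vecCons_add, ContinuousAlternatingMap.vecCons_smul]; rfl

/-- For a family `ψ` of isotropic maps, the equation `ψ^* Ω = b ∧ ds` only says that the
restrictions of `b` to the slices are the slice forms. -/
theorem pullback_eq_wedge_iff {Ω : DiffForm J Y 2} {ψ : M × unitInterval → Y}
    (hψ : ContMDiff (𝓘(ℝ, E).prod (𝓡∂ 1)) J ∞ ψ)
    (hlag : ∀ s, Ω.pullback 𝓘(ℝ, E) J (fun p => ψ (p, s)) = 0)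
    (b : DiffForm (𝓘(ℝ, E).prod (𝓡∂ 1)) (M × unitInterval) 1) :
    (∀ (x : M × unitInterval) (X Z : TangentSpace (𝓘(ℝ, E).prod (𝓡∂ 1)) x),
      Ω.pullback (𝓘(ℝ, E).prod (𝓡∂ 1)) J ψ x ![X, Z] =
        b.wedge _ (DiffForm.d _ (fun x : M × unitInterval => (x.2 : ℝ))) x X Z) ↔
    ∀ s p (X : TangentSpace 𝓘(ℝ, E) p), b (p, s) ![tangentInl s X] = sliceForm Ω ψ s p X := by
  have hpull : ∀ (x : M × unitInterval) (X Z : TangentSpace (𝓘(ℝ, E).prod (𝓡∂ 1)) x),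
      Ω.pullback (𝓘(ℝ, E).prod (𝓡∂ 1)) J ψ x ![X, Z] =
        Ω (ψ x) ![mfderiv _ J ψ x X, mfderiv _ J ψ x Z] := by
    intro x X Z
    change Ω (ψ x) _ = _
    congr 1
    ext i; fin_cases i <;> rfl
  have hd : ∀ s (p : M), MDifferentiableAt (𝓘(ℝ, E).prod (𝓡∂ 1)) J ψ (p, s) :=
    fun s p => hψ.mdifferentiable (by simp) _
  have hsl : ∀ s (p : M) (X : TangentSpace 𝓘(ℝ, E) p),
      Ω.pullback (𝓘(ℝ, E).prod (𝓡∂ 1)) J ψ (p, s) ![tangentInl s X, tangentDs E s p] =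
        sliceForm Ω ψ s p X := by
    intro s p X
    rw [hpull, mfderiv_tangentInl (hd s p), mfderiv_tangentDs (hd s p)]
    rfl
  have hss : ∀ s (p : M) (X Z : TangentSpace 𝓘(ℝ, E) p),
      Ω.pullback (𝓘(ℝ, E).prod (𝓡∂ 1)) J ψ (p, s) ![tangentInl s X, tangentInl s Z] = 0 := by
    intro s p X Z
    rw [hpull, mfderiv_tangentInl (hd s p), mfderiv_tangentInl (hd s p)]
    refine Eq.trans ?_ (DFunLike.congr_fun (congrFun (hlag s) p) ![X, Z])
    change _ = Ω (ψ (p, s)) _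
    congr 1
    ext i; fin_cases i <;> rfl
  constructor
  · intro h s p X
    have h1 := h (p, s) (tangentInl s X) (tangentDs E s p)
    rw [hsl, DiffForm.wedge, d_coe_snd_tangentInl, d_coe_snd_tangentDs] at h1
    linarith
  · rintro h ⟨p, s⟩ X Z
    obtain ⟨X', r, rfl⟩ := exists_eq_tangentInl_add s p X
    obtain ⟨Z', r', rfl⟩ := exists_eq_tangentInl_add s p Z
    rw [ContinuousAlternatingMap.apply_two_add_smul, hss, hsl, hsl, DiffForm.wedge,
      DiffForm.apply_tangentInl_add_smul, DiffForm.apply_tangentInl_add_smul,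
      DiffForm.apply_tangentInl_add_smul, DiffForm.apply_tangentInl_add_smul,
      d_coe_snd_tangentInl, d_coe_snd_tangentInl, d_coe_snd_tangentDs, h, h]
    ring

end Potential

/-! ### Potentials of closed 1-forms on a cylinder -/

section Potential

variable {E : Type*} [NormedAddCommGroup E] [NormedSpace ℝ E]
  {M : Type*} [TopologicalSpace M] [ChartedSpace E M]

theorem contDiffOn_integral_Icc {g : ℝ → ℝ} (hg : ContDiffOn ℝ ∞ g (Icc 0 1)) :
    ContDiffOn ℝ ∞ (fun s => ∫ σ in (0 : ℝ)..s, g σ) (Icc 0 1) ∧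
      ∀ s ∈ Icc (0 : ℝ) 1,
        HasDerivWithinAt (fun s => ∫ σ in (0 : ℝ)..s, g σ) (g s) (Icc 0 1) s := by
  have hd : ∀ s ∈ Icc (0 : ℝ) 1,
      HasDerivWithinAt (fun s => ∫ σ in (0 : ℝ)..s, g σ) (g s) (Icc 0 1) s := by
    intro s hs
    have hF : Fact (s ∈ Icc (0 : ℝ) 1) := ⟨hs⟩
    refine intervalIntegral.integral_hasDerivWithinAt_right ?_ ?_ (hg.continuousOn s hs)
    · exact (hg.continuousOn.mono (uIcc_subset_Icc (by simp) hs)).intervalIntegrable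
    · exact hg.continuousOn.stronglyMeasurableAtFilter_nhdsWithin measurableSet_Icc s
  refine ⟨?_, hd⟩
  rw [contDiffOn_infty_iff_derivWithin (uniqueDiffOn_Icc zero_lt_one)]
  exact ⟨fun s hs => (hd s hs).differentiableWithinAt,
    hg.congr fun s hs => (hd s hs).derivWithin (uniqueDiffOn_Icc zero_lt_one s hs)⟩

theorem DiffForm.ext_tangentInl_tangentDs
    {α β : DiffForm (𝓘(ℝ, E).prod (𝓡∂ 1)) (M × unitInterval) 1}
    (hl : ∀ s p (X : TangentSpace 𝓘(ℝ, E) p),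
      α (p, s) ![tangentInl s X] = β (p, s) ![tangentInl s X])
    (hr : ∀ s p, α (p, s) ![tangentDs E s p] = β (p, s) ![tangentDs E s p]) : α = β := by
  funext ⟨p, s⟩
  refine ContinuousAlternatingMap.ext fun X => ?_
  have hX : X = ![X 0] := by ext i; fin_cases i; rfl
  obtain ⟨X', r, h⟩ := exists_eq_tangentInl_add s p (X 0)
  rw [hX, h, DiffForm.apply_tangentInl_add_smul, DiffForm.apply_tangentInl_add_smul, hl, hr]

theorem DiffForm.pullbackWithin_apply_one {E' : Type*} [NormedAddCommGroup E'] [NormedSpace ℝ E']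
    {H' : Type*} [TopologicalSpace H'] {J : ModelWithCorners ℝ E' H'}
    {Y : Type*} [TopologicalSpace Y] [ChartedSpace H' Y]
    {V : Type*} [NormedAddCommGroup V] [NormedSpace ℝ V]
    (b : DiffForm J Y 1) (κ : V → Y) (S : Set V) (x u : V) :
    b.pullbackWithin J κ S x ![u] = b (κ x) ![mfderivWithin 𝓘(ℝ, V) J κ S x u] := by
  change b (κ x) _ = _
  congr 1
  ext i; fin_cases i; rfl

section

variable (b : DiffForm (𝓘(ℝ, E).prod (𝓡∂ 1)) (M × unitInterval) 1) {φ : E → M} {B : Set E}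

theorem DiffForm.pullbackWithin_cylinderMap_id_left
    (hφ : ContMDiffOn 𝓘(ℝ, E) 𝓘(ℝ, E) ∞ φ B) (hB : UniqueDiffOn ℝ B) {w : E} (hw : w ∈ B)
    (s : unitInterval) (u : E) :
    b.pullbackWithin _ (cylinderMap id φ) (B ×ˢ Icc 0 1) (w, (s : ℝ)) ![(u, 0)] =
      b (φ w, s) ![tangentInl s (mfderivWithin 𝓘(ℝ, E) 𝓘(ℝ, E) φ B w u)] := by
  rw [DiffForm.pullbackWithin_apply_one]
  refine (b.apply_congr (cylinderMap_apply id φ w s) _).trans ?_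
  rw [mfderivWithin_cylinderMap_left contMDiff_id hφ hB hw s u]
  have h3 := DFunLike.congr_fun (mfderiv_prod_left (I := 𝓘(ℝ, E)) (I' := 𝓡∂ 1)
    (x₀ := φ w) (y₀ := s)) (mfderivWithin 𝓘(ℝ, E) 𝓘(ℝ, E) φ B w u)
  exact congrArg (fun X => b (φ w, s) ![X]) h3

theorem DiffForm.pullbackWithin_cylinderMap_id_right
    (hφ : ContMDiffOn 𝓘(ℝ, E) 𝓘(ℝ, E) ∞ φ B) {w : E} (hw : w ∈ B) (s : unitInterval) :
    b.pullbackWithin _ (cylinderMap id φ) (B ×ˢ Icc 0 1) (w, (s : ℝ)) ![((0 : E), (1 : ℝ))] =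
      b (φ w, s) ![tangentDs E s (φ w)] := by
  rw [DiffForm.pullbackWithin_apply_one]
  refine (b.apply_congr (cylinderMap_apply id φ w s) _).trans ?_
  rw [mfderivWithin_cylinderMap_right contMDiff_id hφ hw s]
  have h3 := DFunLike.congr_fun (mfderiv_prod_right (I := 𝓘(ℝ, E)) (I' := 𝓡∂ 1)
    (x₀ := φ w) (y₀ := s)) (1 : TangentSpace (𝓡∂ 1) s)
  exact congrArg (fun X => b (φ w, s) ![X]) h3

end

/-- If the restrictions of a closed `1`-form on `M × [0,1]` to the slices `M × {s}` are the
differentials of `H (·, s)`, then its difference with `dH` is `g ds`, where `g` is locally constant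
along the slices. -/
theorem eventually_sub_d_apply_tangentDs_eq [IsManifold 𝓘(ℝ, E) ∞ M]
    {b : DiffForm (𝓘(ℝ, E).prod (𝓡∂ 1)) (M × unitInterval) 1} (hb : b.IsSmooth _)
    (hbc : b.IsClosed _) {H : M × unitInterval → ℝ}
    (hH : ContMDiff (𝓘(ℝ, E).prod (𝓡∂ 1)) 𝓘(ℝ, ℝ) ∞ H)
    (hbH : ∀ s p (X : TangentSpace 𝓘(ℝ, E) p),
      b (p, s) ![tangentInl s X] = (mfderiv 𝓘(ℝ, E) 𝓘(ℝ, ℝ) (fun p => H (p, s)) p X : ℝ))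
    {g : M → unitInterval → ℝ} (hg : ∀ p s, g p s = b (p, s) ![tangentDs E s p] -
      DiffForm.d (𝓡∂ 1) (fun s => H (p, s)) s ![1]) (p₀ : M) :
    (∀ᶠ p in 𝓝 p₀, ∀ s, g p s = g p₀ s) ∧
      ContDiffOn ℝ ∞ (fun s => g p₀ (projIcc 0 1 zero_le_one s)) (Icc 0 1) := by
  have hid : ContMDiff (𝓘(ℝ, E).prod (𝓡∂ 1)) (𝓘(ℝ, E).prod (𝓡∂ 1)) ∞
    (id : M × unitInterval → M × unitInterval) := contMDiff_id
  set e := extChartAt 𝓘(ℝ, E) p₀ with he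
  obtain ⟨r, hr, hrB⟩ := Metric.isOpen_iff.1 (isOpen_extChartAt_target (I := 𝓘(ℝ, E)) p₀)
    (e p₀) (mem_extChartAt_target p₀)
  set B : Set E := Metric.ball (e p₀) r with hB
  have hBu : UniqueDiffOn ℝ B := Metric.isOpen_ball.uniqueDiffOn
  have hp₀B : e p₀ ∈ B := Metric.mem_ball_self hr
  have hφ : ContMDiffOn 𝓘(ℝ, E) 𝓘(ℝ, E) ∞ e.symm B :=
    (contMDiffOn_extChartAt_symm p₀).mono hrB
  set S : Set (E × ℝ) := B ×ˢ Icc (0 : ℝ) 1 with hS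
  have hSu : UniqueDiffOn ℝ S := uniqueDiffOn_cylinder hBu
  have hSc : ∀ x ∈ S, x ∈ closure (interior S) := by
    rintro ⟨w, s⟩ ⟨hw, hs⟩
    rw [hS, interior_prod_eq, closure_prod_eq, Metric.isOpen_ball.interior_eq, interior_Icc,
      closure_Ioo zero_ne_one]
    exact ⟨subset_closure hw, hs⟩
  have hκ : ContMDiffOn 𝓘(ℝ, E × ℝ) (𝓘(ℝ, E).prod (𝓡∂ 1)) ∞
    (cylinderMap (id : M × unitInterval → M × unitInterval) e.symm) S :=
    contMDiffOn_cylinderMap hid hφ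
  set f : E × ℝ → ℝ := cylinderMap H e.symm with hf
  have hfs : ContDiffOn ℝ ∞ f S := (contMDiffOn_cylinderMap hH hφ).contDiffOn
  set δ : E × ℝ → (E × ℝ) [⋀^Fin 1]→L[ℝ] ℝ := fun x =>
    b.pullbackWithin _ (cylinderMap (id : M × unitInterval → M × unitInterval) e.symm) S x -
    ContinuousAlternatingMap.ofSubsingleton ℝ (E × ℝ) ℝ (0 : Fin 1) (fderivWithin ℝ f S x) with hδ
  have hδd : DifferentiableOn ℝ δ S := by
    refine (hb.differentiableOn_pullbackWithin hκ hSu).sub ?_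
    exact (ContinuousAlternatingMap.ofSubsingletonLIE (𝕜 := ℝ) (E := E × ℝ) (F := ℝ)
      (0 : Fin 1)).toContinuousLinearEquiv.differentiable.comp_differentiableOn
        ((hfs.fderivWithin hSu (m := ∞) (by simp)).differentiableOn (by simp))
  have hδc : ∀ x ∈ S, extDerivWithin δ S x = 0 := fun x hx => by
    rw [hδ, extDerivWithin_sub_ofSubsingleton_fderivWithin
      (hb.differentiableOn_pullbackWithin hκ hSu x hx) hfs hSu hx (hSc x hx)]
    exact hbc.extDerivWithin_pullbackWithin hb hκ hSu hx (hSc x hx)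
  have hδk : ∀ k, ∀ x ∈ S, δ x ![(k, 0)] = 0 := by
    rintro k ⟨w, s⟩ ⟨hw, hs⟩
    have h2 := mfderivWithin_cylinderMap_left hH hφ hBu hw ⟨s, hs⟩ k
    rw [mfderivWithin_eq_fderivWithin] at h2
    exact sub_eq_zero.2 (((b.pullbackWithin_cylinderMap_id_left hφ hBu hw ⟨s, hs⟩ k).trans
      (hbH _ _ _)).trans h2.symm)
  have hδg : ∀ w ∈ B, ∀ s : unitInterval, δ (w, (s : ℝ)) ![(0, 1)] =
      g (e.symm w) s := by
    intro w hw s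
    rw [hg]
    have h2 := mfderivWithin_cylinderMap_right hH hφ hw s
    rw [mfderivWithin_eq_fderivWithin] at h2
    exact congrArg₂ (fun x y : ℝ => x - y) (b.pullbackWithin_cylinderMap_id_right hφ hw s) h2
  have hsm : ContDiffOn ℝ ∞ (fun x => δ x ![((0 : E), (1 : ℝ))]) S := by
    have h1 := hb.contDiffOn_pullbackWithin_apply hκ hSu ![((0 : E), (1 : ℝ))]
    have h2 := (hfs.fderivWithin hSu (m := ∞) (by simp)).clm_apply
      (contDiffOn_const (c := ((0 : E), (1 : ℝ))))
    exact h1.sub h2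
  constructor
  · have h1 : e.source ∩ e ⁻¹' B ∈ 𝓝 p₀ :=
      Filter.inter_mem (extChartAt_source_mem_nhds p₀)
        ((continuousAt_extChartAt p₀).preimage_mem_nhds (Metric.isOpen_ball.mem_nhds hp₀B))
    filter_upwards [h1] with p hp s
    have h2 : (fun x => δ x ![((0 : E), (1 : ℝ))]) (e p, (s : ℝ)) =
        (fun x => δ x ![((0 : E), (1 : ℝ))]) (e p₀, (s : ℝ)) :=
      eq_of_fderivWithin_prod_eq_zero (convex_ball _ _) (hsm.differentiableOn (by simp)) hp.2
        hp₀B s.2 fun x hx => fderivWithin_apply_eq_zero_of_extDerivWithin_eq_zero hδd hSu hδc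
          (hδk _) ⟨hx, s.2⟩
    simp only [hδg _ hp.2, hδg _ hp₀B] at h2
    rwa [e.left_inv hp.1, e.left_inv (mem_extChartAt_source p₀)] at h2
  · have h1 : ContDiffOn ℝ ∞ (fun s : ℝ => δ (e p₀, s) ![((0 : E), (1 : ℝ))]) (Icc 0 1) :=
      hsm.comp (contDiff_const.prodMk contDiff_id).contDiffOn (fun s hs => ⟨hp₀B, hs⟩)
    refine h1.congr fun s hs => ?_
    have h2 := hδg _ hp₀B ⟨s, hs⟩
    rw [e.left_inv (mem_extChartAt_source p₀)] at h2
    rw [h2, projIcc_of_mem _ hs]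

theorem mfderiv_apply_of_eventuallyEq_add_const {F G : M → ℝ} {c : ℝ} {p : M}
    (h : F =ᶠ[𝓝 p] fun p => G p + c) (hG : MDifferentiableAt 𝓘(ℝ, E) 𝓘(ℝ, ℝ) G p)
    (X : TangentSpace 𝓘(ℝ, E) p) :
    (mfderiv 𝓘(ℝ, E) 𝓘(ℝ, ℝ) F p X : ℝ) = mfderiv 𝓘(ℝ, E) 𝓘(ℝ, ℝ) G p X := by
  have h2 := ((hG.hasMFDerivAt.add (hasMFDerivAt_const c p)).congr_of_eventuallyEq h).mfderiv
  exact (DFunLike.congr_fun h2 X).trans (add_zero _)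

theorem mfderiv_add_comp_coe_one {F : unitInterval → ℝ} {Γ : ℝ → ℝ} {a : ℝ} {s : unitInterval}
    (hF : MDifferentiableAt (𝓡∂ 1) 𝓘(ℝ, ℝ) F s) (hΓ : HasDerivWithinAt Γ a (Icc 0 1) s) :
    (mfderiv (𝓡∂ 1) 𝓘(ℝ, ℝ) (fun s : unitInterval => F s + Γ s) s 1 : ℝ) =
      DiffForm.d (𝓡∂ 1) F s ![1] + a := by
  have hΓ' : MDifferentiableAt (𝓡∂ 1) 𝓘(ℝ, ℝ) (fun s : unitInterval => Γ s) s :=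
    mdifferentiableWithinAt_comp_projIcc_iff.1
      ((hΓ.congr (f₁ := (fun s : unitInterval => Γ s) ∘ projIcc 0 1 zero_le_one)
        (fun σ hσ => by simp [projIcc_of_mem _ hσ])
        (by simp)).hasFDerivWithinAt.hasMFDerivWithinAt.mdifferentiableWithinAt)
  have h2 := (hF.hasMFDerivAt.add hΓ'.hasMFDerivAt).mfderiv
  refine (DFunLike.congr_fun h2 1).trans (congrArg (DiffForm.d (𝓡∂ 1) F s ![1] + ·) ?_)
  have h4 := mfderivWithin_comp_projIcc_one (x := (0 : ℝ)) (y := 1) (I := 𝓘(ℝ, ℝ))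
    (f := fun s : unitInterval => Γ s) (w := s)
  refine h4.symm.trans ?_
  rw [mfderivWithin_eq_fderivWithin]
  have h5 : fderivWithin ℝ ((fun s : unitInterval => Γ s) ∘ projIcc 0 1 zero_le_one)
      (Icc 0 1) s = fderivWithin ℝ Γ (Icc 0 1) s :=
    fderivWithin_congr (fun σ hσ => by simp [projIcc_of_mem _ hσ]) (by simp)
  exact (DFunLike.congr_fun h5 1).trans
    (hΓ.derivWithin (uniqueDiffOn_Icc zero_lt_one s s.2))

/-- A closed `1`-form on `M × [0,1]` whose restrictions to the slices `M × {s}` are the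
differentials of `H (·, s)` is exact: the difference with `dH` is `g ds`, and closedness makes `g`
locally constant along the slices. -/
theorem exists_potential [IsManifold 𝓘(ℝ, E) ∞ M]
    {b : DiffForm (𝓘(ℝ, E).prod (𝓡∂ 1)) (M × unitInterval) 1} (hb : b.IsSmooth _)
    (hbc : b.IsClosed _) {H : M × unitInterval → ℝ}
    (hH : ContMDiff (𝓘(ℝ, E).prod (𝓡∂ 1)) 𝓘(ℝ, ℝ) ∞ H)
    (hbH : ∀ s p (X : TangentSpace 𝓘(ℝ, E) p),
      b (p, s) ![tangentInl s X] = (mfderiv 𝓘(ℝ, E) 𝓘(ℝ, ℝ) (fun p => H (p, s)) p X : ℝ)) :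
    ∃ H' : M × unitInterval → ℝ, ContMDiff (𝓘(ℝ, E).prod (𝓡∂ 1)) 𝓘(ℝ, ℝ) ∞ H' ∧
      b = DiffForm.d _ H' := by
  -- the coefficient of `ds` in `b - dH`
  set g : M → unitInterval → ℝ := fun p s => (b (p, s) ![tangentDs E s p] : ℝ) -
    DiffForm.d (𝓡∂ 1) (fun s => H (p, s)) s ![1] with hg
  have hloc := eventually_sub_d_apply_tangentDs_eq hb hbc hH hbH (g := g) (fun _ _ => rfl)
  set Γ : M → ℝ → ℝ := fun p s => ∫ σ in (0 : ℝ)..s, g p (projIcc 0 1 zero_le_one σ) with hΓ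
  have hΓs := fun p => contDiffOn_integral_Icc (hloc p).2
  have hΓm : ∀ p, ContMDiff (𝓡∂ 1) 𝓘(ℝ, ℝ) ∞ (fun s : unitInterval => Γ p s) := fun p =>
    (hΓs p).1.contMDiffOn.comp_contMDiff contMDiff_subtypeVal_Icc (fun s => s.2)
  set H' : M × unitInterval → ℝ := fun x => H x + Γ x.1 x.2 with hH'
  -- near `p₀`, the coefficient `g` may be taken at `p₀`, so `H'` is smooth there
  have hev : ∀ p₀ : M, ∀ s, H' =ᶠ[𝓝 (p₀, s)] fun x => H x + Γ p₀ x.2 := by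
    intro p₀ s
    filter_upwards [continuous_fst.continuousAt.eventually (hloc p₀).1] with x hx
    simp only [hH', hΓ, hx]
  have hH's : ContMDiff (𝓘(ℝ, E).prod (𝓡∂ 1)) 𝓘(ℝ, ℝ) ∞ H' := by
    rintro ⟨p₀, s⟩
    exact ((hH.add ((hΓm p₀).comp contMDiff_snd)) (p₀, s)).congr_of_eventuallyEq (hev p₀ s)
  refine ⟨H', hH's, DiffForm.ext_tangentInl_tangentDs (fun s p X => ?_) fun s p => ?_⟩
  · rw [DiffForm.d_apply, mfderiv_tangentInl (hH's.mdifferentiable (by simp) (p, s)), hbH]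
    refine (mfderiv_apply_of_eventuallyEq_add_const (c := Γ p s) ?_
      ((contMDiff_slice_left hH s).mdifferentiable (by simp) p) X).symm
    filter_upwards [(hloc p).1] with p' hp'
    simp only [hH', hΓ, hp']
  · rw [DiffForm.d_apply, mfderiv_tangentDs (hH's.mdifferentiable (by simp) (p, s))]
    have h1 := (hΓs p).2 s s.2
    rw [projIcc_val] at h1
    refine Eq.symm ((mfderiv_add_comp_coe_one
      ((contMDiff_slice_right hH p).mdifferentiable (by simp) s) h1).trans ?_)
    exact add_sub_cancel _ _

end Potential

/-! ### Orthogonal lifts and the equation of horizontal curves -/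

section SaddlePoint

variable {E : Type*} [NormedAddCommGroup E] [NormedSpace ℝ E] [FiniteDimensional ℝ E]
  {W : Type*} [NormedAddCommGroup W] [NormedSpace ℝ W] [FiniteDimensional ℝ W]
  {D : Type*} [NormedAddCommGroup D] [NormedSpace ℝ D]

/-- The linear system `b(X, ·) - λ ∘ B = η`, `B X = w` in the unknowns `X` and `λ`. For `η = 0` it
says that `X` is `b`-orthogonal to `ker B` and maps to `w`. -/
def saddleMap (b : E →L[ℝ] E →L[ℝ] ℝ) (B : E →L[ℝ] W) :
    E × (W →L[ℝ] ℝ) →L[ℝ] (E →L[ℝ] ℝ) × W :=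
  LinearMap.toContinuousLinearMap
    { toFun := fun x => (b x.1 - x.2.comp B, B x.1)
      map_add' := fun x y => by
        ext <;> simp
        ring
      map_smul' := fun r x => by
        ext <;> simp
        ring }

omit [FiniteDimensional ℝ E] in
theorem exists_eq_comp_of_forall_ker (f : E →L[ℝ] ℝ) (B : E →L[ℝ] W)
    (h : ∀ Z, B Z = 0 → f Z = 0) : ∃ l : W →L[ℝ] ℝ, f = l.comp B := by
  have h1 : (f : E →ₗ[ℝ] ℝ) ∈ LinearMap.range (B : E →ₗ[ℝ] W).dualMap := by
    rw [LinearMap.range_dualMap_eq_dualAnnihilator_ker, Submodule.mem_dualAnnihilator]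
    exact fun Z hZ => h Z hZ
  obtain ⟨l, hl⟩ := h1
  exact ⟨LinearMap.toContinuousLinearMap l, ContinuousLinearMap.ext fun Z =>
    (LinearMap.congr_fun hl Z).symm⟩

theorem exists_equiv_eq_saddleMap {b : E →L[ℝ] E →L[ℝ] ℝ} {B : E →L[ℝ] W}
    (hB : Function.Surjective B)
    (hb : ∀ X, B X = 0 → (∀ Z, B Z = 0 → b X Z = 0) → X = 0) :
    ∃ e : (E × (W →L[ℝ] ℝ)) ≃L[ℝ] (E →L[ℝ] ℝ) × W, (e : _ →L[ℝ] _) = saddleMap b B := by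
  have hinj : Function.Injective (saddleMap b B).toLinearMap := by
    rw [← LinearMap.ker_eq_bot, LinearMap.ker_eq_bot']
    rintro ⟨X, l⟩ h
    have h1 : b X - l.comp B = 0 := congrArg Prod.fst h
    have h2 : B X = 0 := congrArg Prod.snd h
    rw [sub_eq_zero] at h1
    have hX : X = 0 := hb X h2 fun Z hZ => by rw [h1]; simp [hZ]
    subst hX
    rw [map_zero] at h1
    refine Prod.ext rfl (ContinuousLinearMap.ext fun w => ?_)
    obtain ⟨Z, rfl⟩ := hB w
    exact (DFunLike.congr_fun h1 Z).symm
  have hdim : Module.finrank ℝ (E × (W →L[ℝ] ℝ)) = Module.finrank ℝ ((E →L[ℝ] ℝ) × W) := by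
    rw [Module.finrank_prod, Module.finrank_prod]
    have h1 := (LinearMap.toContinuousLinearMap (𝕜 := ℝ) (E := E) (F' := ℝ)).finrank_eq
    have h2 := (LinearMap.toContinuousLinearMap (𝕜 := ℝ) (E := W) (F' := ℝ)).finrank_eq
    have h3 : Module.finrank ℝ (E →ₗ[ℝ] ℝ) = Module.finrank ℝ E := Subspace.dual_finrank_eq
    have h4 : Module.finrank ℝ (W →ₗ[ℝ] ℝ) = Module.finrank ℝ W := Subspace.dual_finrank_eq
    omega
  refine ⟨(LinearMap.linearEquivOfInjective _ hinj hdim).toContinuousLinearEquiv, ?_⟩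
  ext x <;> rfl

/-- If `B` is onto and `b` is nondegenerate on `ker B` at one point, then near that point every `w`
has exactly one lift by `B` in the `b`-orthogonal complement of `ker B`, and it depends smoothly on
the point. -/
theorem exists_smooth_orthogonal_lift {O : Set D} (hO : IsOpen O) {b : D → E →L[ℝ] E →L[ℝ] ℝ}
    {B : D → E →L[ℝ] W} (hb : ContDiffOn ℝ ∞ b O) (hB : ContDiffOn ℝ ∞ B O) {z₀ : D} (hz₀ : z₀ ∈ O)
    (hsurj : Function.Surjective (B z₀))
    (hnd : ∀ X, B z₀ X = 0 → (∀ Z, B z₀ Z = 0 → b z₀ X Z = 0) → X = 0) :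
    ∃ (U : Set D) (P : D → W →L[ℝ] E), IsOpen U ∧ z₀ ∈ U ∧ U ⊆ O ∧ ContDiffOn ℝ ∞ P U ∧
      ∀ z ∈ U, ∀ X w, ((∀ Z, B z Z = 0 → b z X Z = 0) ∧ B z X = w) ↔ X = P z w := by
  set N : D → E × (W →L[ℝ] ℝ) →L[ℝ] (E →L[ℝ] ℝ) × W := fun z => saddleMap (b z) (B z) with hN
  have hNs : ContDiffOn ℝ ∞ N O := by
    rw [contDiffOn_clm_apply]
    rintro ⟨X, l⟩
    refine ContDiffOn.prodMk ?_ (hB.clm_apply contDiffOn_const)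
    exact (hb.clm_apply contDiffOn_const).sub (contDiffOn_const.clm_comp hB)
  set R : Set (E × (W →L[ℝ] ℝ) →L[ℝ] (E →L[ℝ] ℝ) × W) :=
    range ContinuousLinearEquiv.toContinuousLinearMap with hR
  set U : Set D := O ∩ N ⁻¹' R with hU
  have hUo : IsOpen U := hNs.continuousOn.isOpen_inter_preimage hO ContinuousLinearEquiv.isOpen
  refine ⟨U, fun z => (ContinuousLinearMap.fst ℝ E (W →L[ℝ] ℝ)).comp
    ((N z).inverse.comp (ContinuousLinearMap.inr ℝ (E →L[ℝ] ℝ) W)), hUo,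
    ⟨hz₀, exists_equiv_eq_saddleMap hsurj hnd⟩, inter_subset_left, ?_, ?_⟩
  · refine contDiffOn_const.clm_comp (ContDiffOn.clm_comp ?_ contDiffOn_const)
    rintro z ⟨hz, e, he⟩
    have h1 : ContDiffAt ℝ ∞ ContinuousLinearMap.inverse (N z) := he ▸ contDiffAt_map_inverse e
    exact h1.comp_contDiffWithinAt z ((hNs z hz).mono inter_subset_left)
  · rintro z ⟨hz, e, he⟩ X w
    have hinv : (N z).inverse = e.symm := by
      rw [← he]; exact ContinuousLinearMap.inverse_equiv e
    have hP : ((ContinuousLinearMap.fst ℝ E (W →L[ℝ] ℝ)).comp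
        ((N z).inverse.comp (ContinuousLinearMap.inr ℝ (E →L[ℝ] ℝ) W))) w = (e.symm (0, w)).1 := by
      rw [hinv]; rfl
    have happ : ∀ x, e x = (b z x.1 - x.2.comp (B z), B z x.1) := fun x =>
      DFunLike.congr_fun he x
    constructor
    · rintro ⟨h1, rfl⟩
      obtain ⟨l, hl⟩ := exists_eq_comp_of_forall_ker (b z X) (B z) h1
      have h2 : e (X, l) = (0, B z X) := by rw [happ]; simp [hl]
      refine Eq.trans ?_ hP.symm
      rw [← h2, e.symm_apply_apply]
    · intro h
      have h1 : X = (e.symm (0, w)).1 := h.trans hP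
      have h2 := happ (e.symm (0, w))
      rw [e.apply_symm_apply, ← h1, Prod.mk.injEq, eq_comm, sub_eq_zero] at h2
      refine ⟨fun Z hZ => ?_, h2.2.symm⟩
      rw [h2.1]; simp [hZ]

end SaddlePoint

section ODE

variable {E : Type*} [NormedAddCommGroup E] [NormedSpace ℝ E]
  {W : Type*} [NormedAddCommGroup W] [NormedSpace ℝ W]

/-- Local uniqueness for the equation `z' = P(z) γ'`, at interior points and at end points of the
time interval. -/
theorem eventuallyEq_of_hasDerivWithinAt {P : E → W →L[ℝ] E} {g : ℝ → W} {a b τ : ℝ} {z₁ z₂ : ℝ → E}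
    (hP : ContDiffAt ℝ 1 P (z₁ τ)) (hτ : τ ∈ Icc a b) (hg : ContinuousOn g (Icc a b))
    (hz : z₁ τ = z₂ τ)
    (h₁ : ∀ᶠ σ in 𝓝[Icc a b] τ, HasDerivWithinAt z₁ (P (z₁ σ) (g σ)) (Icc a b) σ)
    (h₂ : ∀ᶠ σ in 𝓝[Icc a b] τ, HasDerivWithinAt z₂ (P (z₂ σ) (g σ)) (Icc a b) σ) :
    ∀ᶠ σ in 𝓝[Icc a b] τ, z₁ σ = z₂ σ := by
  obtain ⟨K, T, hT, hK⟩ := hP.exists_lipschitzOnWith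
  obtain ⟨C, hC⟩ : ∃ C : NNReal, ∀ σ ∈ Icc a b, ‖g σ‖₊ ≤ C := by
    obtain ⟨C, hC⟩ := isCompact_Icc.exists_bound_of_continuousOn hg
    exact ⟨⟨max C 0, le_max_right _ _⟩, fun σ hσ => (hC σ hσ).trans (le_max_left _ _)⟩
  have hT₁ : ∀ᶠ σ in 𝓝[Icc a b] τ, z₁ σ ∈ T :=
    (h₁.self_of_nhdsWithin hτ).continuousWithinAt.eventually_mem hT
  have hT₂ : ∀ᶠ σ in 𝓝[Icc a b] τ, z₂ σ ∈ T :=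
    (h₂.self_of_nhdsWithin hτ).continuousWithinAt.eventually_mem (hz ▸ hT)
  have hall := (h₁.and h₂).and (hT₁.and hT₂)
  rw [Filter.Eventually, mem_nhdsWithin_iff_exists_mem_nhds_inter] at hall
  obtain ⟨u, hu, hall⟩ := hall
  obtain ⟨δ, hδ, hball⟩ := Metric.mem_nhds_iff.1 hu
  have hlip : ∀ σ ∈ Icc a b, LipschitzOnWith (K * C) (fun z => P z (g σ)) T := by
    intro σ hσ
    refine LipschitzOnWith.of_dist_le_mul fun x hx y hy => ?_
    rw [dist_eq_norm, ← sub_apply]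
    refine ((P x - P y).le_opNorm _).trans ?_
    have h1 : ‖P x - P y‖ ≤ K * dist x y := by
      rw [← dist_eq_norm]; exact hK.dist_le_mul x hx y hy
    have h2 : ‖g σ‖ ≤ C := hC σ hσ
    calc ‖P x - P y‖ * ‖g σ‖ ≤ (K * dist x y) * C := by gcongr
      _ = _ := by push_cast; ring
  have hmem : ∀ σ ∈ Icc a b, |σ - τ| < δ →
      (HasDerivWithinAt z₁ (P (z₁ σ) (g σ)) (Icc a b) σ ∧
        HasDerivWithinAt z₂ (P (z₂ σ) (g σ)) (Icc a b) σ) ∧ z₁ σ ∈ T ∧ z₂ σ ∈ T :=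
    fun σ hσ h => hall ⟨hball (by rwa [Metric.mem_ball, Real.dist_eq]), hσ⟩
  have hev : ∀ᶠ σ in 𝓝[Icc a b] τ, |σ - τ| < δ :=
    nhdsWithin_le_nhds (Metric.ball_mem_nhds τ hδ)
  filter_upwards [hev, self_mem_nhdsWithin] with σ hσ hσI
  have hsub : ∀ x, x ∈ uIcc τ σ → x ∈ Icc a b ∧ |x - τ| < δ := fun x hx =>
    ⟨uIcc_subset_Icc hτ hσI hx, (abs_sub_left_of_mem_uIcc hx).trans_lt hσ⟩
  have hc₁ : ContinuousOn z₁ (uIcc τ σ) := fun x hx =>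
    (hmem x (hsub x hx).1 (hsub x hx).2).1.1.continuousWithinAt.mono fun y hy => (hsub y hy).1
  have hc₂ : ContinuousOn z₂ (uIcc τ σ) := fun x hx =>
    (hmem x (hsub x hx).1 (hsub x hx).2).1.2.continuousWithinAt.mono fun y hy => (hsub y hy).1
  rcases le_total τ σ with h | h
  · rw [uIcc_of_le h] at hsub hc₁ hc₂
    have hd : ∀ x ∈ Ico τ σ, ∀ {z : ℝ → E} {d : E}, HasDerivWithinAt z d (Icc a b) x →
        HasDerivWithinAt z d (Ici x) x := fun x hx z d hz => by
      refine hz.mono_of_mem_nhdsWithin ?_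
      filter_upwards [Icc_mem_nhdsGE hx.2] with y hy
      exact (hsub y ⟨hx.1.trans hy.1, hy.2⟩).1
    have hm := fun x (hx : x ∈ Ico τ σ) =>
      hmem x (hsub x (Ico_subset_Icc_self hx)).1 (hsub x (Ico_subset_Icc_self hx)).2
    exact ODE_solution_unique_of_mem_Icc_right (v := fun σ z => P z (g σ)) (s := fun _ => T)
      (fun x hx => hlip x (hsub x (Ico_subset_Icc_self hx)).1) hc₁
      (fun x hx => hd x hx (hm x hx).1.1) (fun x hx => (hm x hx).2.1) hc₂
      (fun x hx => hd x hx (hm x hx).1.2) (fun x hx => (hm x hx).2.2) hz ⟨h, le_rfl⟩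
  · rw [uIcc_of_ge h] at hsub hc₁ hc₂
    have hd : ∀ x ∈ Ioc σ τ, ∀ {z : ℝ → E} {d : E}, HasDerivWithinAt z d (Icc a b) x →
        HasDerivWithinAt z d (Iic x) x := fun x hx z d hz => by
      refine hz.mono_of_mem_nhdsWithin ?_
      filter_upwards [Icc_mem_nhdsLE hx.1] with y hy
      exact (hsub y ⟨hy.1, hy.2.trans hx.2⟩).1
    have hm := fun x (hx : x ∈ Ioc σ τ) =>
      hmem x (hsub x (Ioc_subset_Icc_self hx)).1 (hsub x (Ioc_subset_Icc_self hx)).2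
    exact ODE_solution_unique_of_mem_Icc_left (v := fun σ z => P z (g σ)) (s := fun _ => T)
      (fun x hx => hlip x (hsub x (Ioc_subset_Icc_self hx)).1) hc₁
      (fun x hx => hd x hx (hm x hx).1.1) (fun x hx => (hm x hx).2.1) hc₂
      (fun x hx => hd x hx (hm x hx).1.2) (fun x hx => (hm x hx).2.2) hz ⟨le_rfl, h⟩

/-- Local existence and continuous dependence for the equation `z' = P(z) γ'`. -/
theorem exists_local_flow [CompleteSpace E] {P : E → W →L[ℝ] E} {γ : ℝ → W} {U : Set E} {z₀ : E}
    (τ₀ : ℝ) (hU : U ∈ 𝓝 z₀) (hP : ContDiffAt ℝ 1 P z₀) (hγ : ContDiff ℝ ∞ γ) :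
    ∃ δ > 0, ∃ O ∈ 𝓝 z₀, ∃ F : E × ℝ × ℝ → E,
      ContinuousOn F (O ×ˢ Ioo (τ₀ - δ) (τ₀ + δ) ×ˢ Ioo (τ₀ - δ) (τ₀ + δ)) ∧
      ∀ z ∈ O, ∀ τ' ∈ Ioo (τ₀ - δ) (τ₀ + δ), F (z, τ', τ') = z ∧
        ∀ τ ∈ Ioo (τ₀ - δ) (τ₀ + δ), F (z, τ', τ) ∈ U ∧
          HasDerivAt (fun τ => F (z, τ', τ)) (P (F (z, τ', τ)) (deriv γ τ)) τ := by
  -- the time is added as a second component to make the equation autonomous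
  set f : E × ℝ → E × ℝ := fun x => (P x.1 (deriv γ x.2), 1) with hf
  have hfs : ContDiffAt ℝ 1 f (z₀, τ₀) := by
    have h1 : ContDiff ℝ 1 (deriv γ) := (contDiff_infty_iff_deriv.1 hγ).2.of_le (by simp)
    refine ContDiffAt.prodMk (ContDiffAt.clm_apply ?_ ?_) contDiffAt_const
    · exact ContDiffAt.comp (z₀, τ₀) (f := Prod.fst) hP contDiffAt_fst
    · exact (h1.comp contDiff_snd).contDiffAt
  obtain ⟨ε, hε, A, r, L, K, hr, hPL⟩ := IsPicardLindelof.of_contDiffAt_one hfs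
  obtain ⟨α, hα, hαc⟩ :=
    (hPL 0).exists_forall_mem_closedBall_eq_hasDerivWithinAt_continuousOn
  simp only [zero_sub, zero_add] at hα hαc
  have hr' : (0 : ℝ) < r := hr
  -- the second component is the time
  have hα2 : ∀ x ∈ Metric.closedBall (z₀, τ₀) (r : ℝ), ∀ s ∈ Icc (-ε) ε,
      (α (x, s)).2 = x.2 + s := by
    intro x hx s hs
    have hd : ∀ s ∈ Icc (-ε) ε,
        HasDerivWithinAt (fun s => (α (x, s)).2 - s) 0 (Icc (-ε) ε) s := by
      intro s hs
      have h1 := hasFDerivAt_snd.comp_hasDerivWithinAt s ((hα x hx).2 s hs)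
      exact (h1.sub (hasDerivWithinAt_id s _)).congr_deriv (sub_self _)
    have h2 := (convex_Icc (-ε) ε).is_const_of_fderivWithin_eq_zero
      (fun s hs => (hd s hs).differentiableWithinAt) (fun s hs => by
        have h3 := (hd s hs).hasFDerivWithinAt.fderivWithin
          (uniqueDiffOn_Icc (by linarith) s hs)
        rw [h3]; ext; simp) hs (y := 0) ⟨by linarith, hε.le⟩
    have h3 := (hα x hx).1
    simp only [h3] at h2
    linarith
  have hcont : ContinuousAt α ((z₀, τ₀), 0) :=
    hαc.continuousAt (prod_mem_nhds (Metric.closedBall_mem_nhds _ hr')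
      (Icc_mem_nhds (by linarith) hε))
  have hU' : ∀ᶠ x in 𝓝 ((z₀, τ₀), (0 : ℝ)), (α x).1 ∈ U := by
    have h1 : (α ((z₀, τ₀), 0)).1 = z₀ := by rw [(hα _ (Metric.mem_closedBall_self hr'.le)).1]
    exact (continuous_fst.continuousAt.comp hcont).eventually_mem (by simpa [h1] using hU)
  obtain ⟨ρ, hρ, hρU⟩ := Metric.eventually_nhds_iff_ball.1 hU'
  set δ : ℝ := min (min (ρ / 2) (ε / 2)) r with hδ
  have hδ0 : 0 < δ := lt_min (lt_min (by linarith) (by linarith)) hr'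
  have hδρ : 2 * δ ≤ ρ := by
    have : δ ≤ ρ / 2 := (min_le_left _ _).trans (min_le_left _ _)
    linarith
  have hδε : 2 * δ ≤ ε := by
    have : δ ≤ ε / 2 := (min_le_left _ _).trans (min_le_right _ _)
    linarith
  have hδr : δ ≤ r := min_le_right _ _
  have hin : ∀ z ∈ Metric.ball z₀ δ, ∀ τ' ∈ Ioo (τ₀ - δ) (τ₀ + δ),
      (z, τ') ∈ Metric.ball (z₀, τ₀) δ := fun z hz τ' hτ' => by
    rw [Metric.mem_ball, Prod.dist_eq, max_lt_iff, Real.dist_eq, abs_lt]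
    exact ⟨hz, by linarith [hτ'.1], by linarith [hτ'.2]⟩
  have hcb : Metric.ball (z₀, τ₀) δ ⊆ Metric.closedBall (z₀, τ₀) (r : ℝ) :=
    (Metric.ball_subset_ball hδr).trans Metric.ball_subset_closedBall
  have hsub : ∀ τ' ∈ Ioo (τ₀ - δ) (τ₀ + δ), ∀ τ ∈ Ioo (τ₀ - δ) (τ₀ + δ),
      τ - τ' ∈ Ioo (-(2 * δ)) (2 * δ) := fun τ' hτ' τ hτ =>
    ⟨by linarith [hτ.1, hτ'.2], by linarith [hτ.2, hτ'.1]⟩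
  refine ⟨δ, hδ0, Metric.ball z₀ δ, Metric.ball_mem_nhds _ hδ0,
    fun x => (α ((x.1, x.2.1), x.2.2 - x.2.1)).1, ?_, ?_⟩
  · refine continuous_fst.comp_continuousOn (hαc.comp (by fun_prop) ?_)
    rintro ⟨z, τ', τ⟩ ⟨hz, hτ', hτ⟩
    have h1 := hsub τ' hτ' τ hτ
    exact ⟨hcb (hin z hz τ' hτ'), by linarith [h1.1], by linarith [h1.2]⟩
  · intro z hz τ' hτ'
    have hx := hcb (hin z hz τ' hτ')
    refine ⟨by simp [(hα _ hx).1], fun τ hτ => ?_⟩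
    have h1 := hsub τ' hτ' τ hτ
    have h2 : τ - τ' ∈ Icc (-ε) ε := ⟨by linarith [h1.1], by linarith [h1.2]⟩
    constructor
    · refine hρU _ ?_
      rw [Metric.mem_ball, Prod.dist_eq, max_lt_iff]
      refine ⟨(hin z hz τ' hτ').trans_le (by linarith), ?_⟩
      rw [Real.dist_eq, abs_lt]
      constructor <;> simp only [sub_zero] <;> linarith [h1.1, h1.2]
    · have h3 := ((hα _ hx).2 (τ - τ') h2).hasDerivAt
        (Icc_mem_nhds (by linarith [h1.1]) (by linarith [h1.2]))
      have h4 := hasFDerivAt_fst.comp_hasDerivAt _ h3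
      have h5 := h4.comp_sub_const τ τ'
      have h6 := hα2 _ hx (τ - τ') h2
      simp only [add_sub_cancel] at h6
      simpa [hf, h6] using h5

end ODE

/-! ### The horizontal field in a chart -/

section HorizontalField

/-- A `2`-form on a finite-dimensional space as a bilinear map. -/
def bilinOfAlternating {E : Type*} [NormedAddCommGroup E] [NormedSpace ℝ E] [FiniteDimensional ℝ E]
    (α : E [⋀^Fin 2]→L[ℝ] ℝ) : E →L[ℝ] E →L[ℝ] ℝ :=
  LinearMap.toContinuousLinearMap
    { toFun := fun X => LinearMap.toContinuousLinearMap
        { toFun := fun Z => α ![X, Z]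
          map_add' := fun Z Z' => by
            rw [α.apply_swap_two, ContinuousAlternatingMap.vecCons_add, α.apply_swap_two X,
              α.apply_swap_two X]
            ring
          map_smul' := fun r Z => by
            rw [α.apply_swap_two, ContinuousAlternatingMap.vecCons_smul, α.apply_swap_two X]
            simp }
      map_add' := fun X X' => ContinuousLinearMap.ext fun Z => α.vecCons_add _ _ _
      map_smul' := fun r X => ContinuousLinearMap.ext fun Z => by
        change α ![r • X, Z] = r • α ![X, Z]
        exact α.vecCons_smul _ _ _ }

variable {n : ℕ} {Y : Type*} [TopologicalSpace Y]
  [ChartedSpace (EuclideanSpace ℝ (Fin (2 * n + 2))) Y] [IsManifold (𝓡 (2 * n + 2)) ∞ Y]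
  {Ω : DiffForm (𝓡 (2 * n + 2)) Y 2} {v : Y → ℂ}

/-- In a chart, horizontal lifts of tangent vectors of the base are given by a smooth field of
linear maps. -/
theorem IsSymplecticLGModel.exists_horizontal_field (hLG : IsSymplecticLGModel Ω v) {y₀ : Y}
    (hy₀ : v y₀ ∈ regValues n v) :
    ∃ (U : Set (EuclideanSpace ℝ (Fin (2 * n + 2))))
      (P : EuclideanSpace ℝ (Fin (2 * n + 2)) → ℂ →L[ℝ] EuclideanSpace ℝ (Fin (2 * n + 2))),
      IsOpen U ∧ extChartAt (𝓡 (2 * n + 2)) y₀ y₀ ∈ U ∧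
      U ⊆ (extChartAt (𝓡 (2 * n + 2)) y₀).target ∧ ContDiffOn ℝ ∞ P U ∧
      ∀ y ∈ (extChartAt (𝓡 (2 * n + 2)) y₀).source, extChartAt (𝓡 (2 * n + 2)) y₀ y ∈ U →
        ∀ (X : TangentSpace (𝓡 (2 * n + 2)) y) (ζ : ℂ),
          (X ∈ hor Ω v y ∧ (mfderiv (𝓡 (2 * n + 2)) 𝓘(ℝ, ℂ) v y X : ℂ) = ζ) ↔
          (mfderiv (𝓡 (2 * n + 2)) 𝓘(ℝ, EuclideanSpace ℝ (Fin (2 * n + 2)))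
            (extChartAt (𝓡 (2 * n + 2)) y₀) y X : EuclideanSpace ℝ (Fin (2 * n + 2))) =
              P (extChartAt (𝓡 (2 * n + 2)) y₀ y) ζ := by
  set E := EuclideanSpace ℝ (Fin (2 * n + 2)) with hE
  set e := extChartAt (𝓡 (2 * n + 2)) y₀ with he
  have hO : IsOpen e.target := isOpen_extChartAt_target y₀
  have hsm : ContMDiffOn 𝓘(ℝ, E) (𝓡 (2 * n + 2)) ∞ e.symm e.target := contMDiffOn_extChartAt_symm y₀
  set D : ∀ z : E, E →L[ℝ] E := fun z =>
    mfderivWithin 𝓘(ℝ, E) (𝓡 (2 * n + 2)) e.symm e.target z with hD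
  set T : ∀ z : E, E →L[ℝ] E := fun z => mfderiv (𝓡 (2 * n + 2)) 𝓘(ℝ, E) e (e.symm z) with hT
  set dv : ∀ z : E, E →L[ℝ] ℂ := fun z => mfderiv (𝓡 (2 * n + 2)) 𝓘(ℝ, ℂ) v (e.symm z) with hdv
  set α : ∀ z : E, E [⋀^Fin 2]→L[ℝ] ℝ := fun z => Ω (e.symm z) with hα
  have hDr : ∀ z ∈ e.target, D z = mfderivWithin 𝓘(ℝ, E) (𝓡 (2 * n + 2)) e.symm
      (range (𝓡 (2 * n + 2))) z := fun z hz => by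
    rw [hD, ModelWithCorners.range_eq_univ, mfderivWithin_univ]
    exact mfderivWithin_of_isOpen hO hz
  have hDT : ∀ z ∈ e.target, ∀ X : E, D z (T z X) = X := by
    intro z hz X
    rw [hDr z hz]
    exact DFunLike.congr_fun (mfderivWithin_extChartAt_symm_comp_mfderiv_extChartAt hz) X
  have hTD : ∀ z ∈ e.target, ∀ X : E, T z (D z X) = X := by
    intro z hz X
    rw [hDr z hz]
    exact DFunLike.congr_fun (mfderiv_extChartAt_comp_mfderivWithin_extChartAt_symm hz) X
  set b : E → E →L[ℝ] E →L[ℝ] ℝ := fun z =>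
    bilinOfAlternating (Ω.pullbackWithin _ e.symm e.target z) with hb
  have hbapp : ∀ z X Z, b z X Z = α z ![D z X, D z Z] := fun z X Z =>
    Ω.pullbackWithin_apply_two _ _ _ _ _
  have hbs : ContDiffOn ℝ ∞ b e.target := by
    rw [contDiffOn_clm_apply]
    intro X
    rw [contDiffOn_clm_apply]
    intro Z
    exact hLG.symplectic.smooth.contDiffOn_pullbackWithin_apply hsm hO.uniqueDiffOn _
  set vh : E → ℂ := v ∘ e.symm with hvh
  have hvs : ContDiffOn ℝ ∞ vh e.target := (hLG.smooth.comp_contMDiffOn hsm).contDiffOn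
  set B : E → E →L[ℝ] ℂ := fderivWithin ℝ vh e.target with hB
  have hBs : ContDiffOn ℝ ∞ B e.target := hvs.fderivWithin hO.uniqueDiffOn (by simp)
  have hBapp : ∀ z ∈ e.target, ∀ X, B z X = dv z (D z X) := by
    intro z hz X
    have h1 := mfderiv_comp_mfderivWithin (I := 𝓘(ℝ, E)) (I' := 𝓡 (2 * n + 2)) (I'' := 𝓘(ℝ, ℂ))
      (g := v) (f := e.symm) (s := e.target) z (hLG.smooth.mdifferentiable (by simp) _)
      ((hsm z hz).mdifferentiableWithinAt (by simp)) (hO.uniqueDiffOn z hz).uniqueMDiffWithinAt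
    rw [mfderivWithin_eq_fderivWithin] at h1
    exact DFunLike.congr_fun h1 X
  have hiff : ∀ z ∈ e.target, ∀ (X : E) (ζ : ℂ),
      ((∀ Z, dv z Z = 0 → α z ![X, Z] = 0) ∧ dv z X = ζ) ↔
      ((∀ Z, B z Z = 0 → b z (T z X) Z = 0) ∧ B z (T z X) = ζ) := by
    intro z hz X ζ
    refine and_congr ⟨fun h Z hZ => ?_, fun h Z hZ => ?_⟩ ?_
    · rw [hbapp, hDT z hz]
      exact h _ ((hBapp z hz Z).symm.trans hZ)
    · have h1 := h (T z Z) (by rwa [hBapp z hz, hDT z hz])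
      rwa [hbapp, hDT z hz, hDT z hz] at h1
    · rw [hBapp z hz, hDT z hz]
  have hz₀ : e y₀ ∈ e.target := mem_extChartAt_target y₀
  have hreg : v (e.symm (e y₀)) ∈ regValues n v := by
    rwa [e.left_inv (mem_extChartAt_source y₀)]
  have hsurj : Function.Surjective (B (e y₀)) := by
    intro ζ
    have h1 : Function.Surjective (dv (e y₀)) := by
      by_contra h
      exact hreg ⟨_, rfl, h⟩
    obtain ⟨X, hX⟩ := h1 ζ
    exact ⟨T (e y₀) X, by rwa [hBapp _ hz₀, hDT _ hz₀]⟩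
  have hnd : ∀ X, B (e y₀) X = 0 → (∀ Z, B (e y₀) Z = 0 → b (e y₀) X Z = 0) → X = 0 := by
    intro X hX h
    have hfs : ∀ X : E, dv (e y₀) X = 0 → (∀ Z : E, dv (e y₀) Z = 0 → α (e y₀) ![X, Z] = 0) →
        X = 0 := fun X hX h => hLG.fiber_symplectic (e.symm (e y₀)) hreg X hX h
    have h1 : D (e y₀) X = 0 := by
      refine hfs _ (by rw [← hBapp _ hz₀, hX]) fun Z hZ => ?_
      have h2 := h (T (e y₀) Z) (by rw [hBapp _ hz₀, hDT _ hz₀, hZ])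
      rwa [hbapp, hDT _ hz₀] at h2
    rw [← hTD _ hz₀ X, h1, map_zero]
  obtain ⟨U, P, hU, hzU, hUO, hPs, hP⟩ := exists_smooth_orthogonal_lift hO hbs hBs hz₀ hsurj hnd
  refine ⟨U, P, hU, hzU, hUO, hPs, fun y hy hyU X ζ => ?_⟩
  obtain ⟨z, hz, rfl⟩ : ∃ z ∈ e.target, e.symm z = y := ⟨e y, e.map_source hy, e.left_inv hy⟩
  rw [e.right_inv hz] at hyU ⊢
  exact (hiff z hz X ζ).trans (hP z hyU _ ζ)

end HorizontalField

/-! ### Uniqueness and global existence of horizontal lifts -/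

section Lifts

variable {n : ℕ} {Y : Type*} [TopologicalSpace Y]
  [ChartedSpace (EuclideanSpace ℝ (Fin (2 * n + 2))) Y]
  {Ω : DiffForm (𝓡 (2 * n + 2)) Y 2} {v : Y → ℂ} {γ : ℝ → ℂ} {J : Set ℝ} {β β₁ β₂ : ℝ → Y}
  {a b τ : ℝ}

/-- A horizontal lift that is only required to be differentiable. Uniqueness holds in this class,
which is easier to check than smoothness. -/
structure IsDifferentiableLift (Ω : DiffForm (𝓡 (2 * n + 2)) Y 2) (v : Y → ℂ) (γ : ℝ → ℂ)
    (J : Set ℝ) (β : ℝ → Y) : Prop where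
  mdifferentiable : ∀ t ∈ J, MDifferentiableWithinAt 𝓘(ℝ, ℝ) (𝓡 (2 * n + 2)) β J t
  lift : ∀ t ∈ J, v (β t) = γ t
  horizontal : ∀ t ∈ J,
    mfderivWithin 𝓘(ℝ, ℝ) (𝓡 (2 * n + 2)) β J t (1 : ℝ) ∈ hor Ω v (β t)

theorem IsHorizontalLift.isDifferentiableLift (h : IsHorizontalLift Ω v γ J β) :
    IsDifferentiableLift Ω v γ J β :=
  ⟨fun t ht => (h.smooth t ht).mdifferentiableWithinAt (by simp), h.lift, h.horizontal⟩

theorem IsDifferentiableLift.mono (h : IsDifferentiableLift Ω v γ J β) {J' : Set ℝ} (hJ : J' ⊆ J)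
    (hu : UniqueDiffOn ℝ J') : IsDifferentiableLift Ω v γ J' β where
  mdifferentiable t ht := (h.mdifferentiable t (hJ ht)).mono hJ
  lift t ht := h.lift t (hJ ht)
  horizontal t ht := by
    rw [mfderivWithin_subset hJ (hu t ht).uniqueMDiffWithinAt (h.mdifferentiable t (hJ ht))]
    exact h.horizontal t (hJ ht)

theorem IsDifferentiableLift.continuousOn (h : IsDifferentiableLift Ω v γ J β) :
    ContinuousOn β J := fun t ht => (h.mdifferentiable t ht).continuousWithinAt

theorem IsDifferentiableLift.mfderiv_apply (h : IsDifferentiableLift Ω v γ J β)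
    (hv : ContMDiff (𝓡 (2 * n + 2)) 𝓘(ℝ, ℂ) ∞ v) (hτ : τ ∈ J) (hu : UniqueDiffWithinAt ℝ J τ) :
    (mfderiv (𝓡 (2 * n + 2)) 𝓘(ℝ, ℂ) v (β τ)
      (mfderivWithin 𝓘(ℝ, ℝ) (𝓡 (2 * n + 2)) β J τ (1 : ℝ)) : ℂ) = derivWithin γ J τ := by
  have h1 := mfderiv_comp_mfderivWithin (I := 𝓘(ℝ, ℝ)) (I' := 𝓡 (2 * n + 2)) (I'' := 𝓘(ℝ, ℂ))
    (g := v) (f := β) (s := J) τ (hv.mdifferentiable (by simp) _) (h.mdifferentiable τ hτ)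
    hu.uniqueMDiffWithinAt
  rw [mfderivWithin_eq_fderivWithin] at h1
  have h2 : fderivWithin ℝ (v ∘ β) J τ = fderivWithin ℝ γ J τ :=
    fderivWithin_congr (fun t ht => h.lift t ht) (h.lift τ hτ)
  exact (DFunLike.congr_fun h1 (1 : ℝ)).symm.trans (DFunLike.congr_fun h2 (1 : ℝ))

theorem mem_hor_congr {y y' : Y} (h : y = y') {X : EuclideanSpace ℝ (Fin (2 * n + 2))}
    (hX : (X : TangentSpace (𝓡 (2 * n + 2)) y) ∈ hor Ω v y) :
    (X : TangentSpace (𝓡 (2 * n + 2)) y') ∈ hor Ω v y' := by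
  subst h; exact hX

theorem IsDifferentiableLift.of_univ (h : IsHorizontalLift Ω v γ univ β) (hab : a < b) :
    IsDifferentiableLift Ω v γ (Icc a b) β :=
  h.isDifferentiableLift.mono (subset_univ _) (uniqueDiffOn_Icc hab)

variable [IsManifold (𝓡 (2 * n + 2)) ∞ Y]

/-- The velocity of a curve read in a chart. -/
theorem hasDerivWithinAt_extChartAt_comp (y₀ : Y)
    (hβ : MDifferentiableWithinAt 𝓘(ℝ, ℝ) (𝓡 (2 * n + 2)) β J τ) (hu : UniqueDiffWithinAt ℝ J τ)
    (hs : β τ ∈ (extChartAt (𝓡 (2 * n + 2)) y₀).source) :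
    HasDerivWithinAt (fun σ => extChartAt (𝓡 (2 * n + 2)) y₀ (β σ))
      (mfderiv (𝓡 (2 * n + 2)) 𝓘(ℝ, EuclideanSpace ℝ (Fin (2 * n + 2)))
        (extChartAt (𝓡 (2 * n + 2)) y₀) (β τ)
        (mfderivWithin 𝓘(ℝ, ℝ) (𝓡 (2 * n + 2)) β J τ (1 : ℝ)) :
          EuclideanSpace ℝ (Fin (2 * n + 2))) J τ := by
  have he : MDifferentiableAt (𝓡 (2 * n + 2)) 𝓘(ℝ, EuclideanSpace ℝ (Fin (2 * n + 2)))
      (extChartAt (𝓡 (2 * n + 2)) y₀) (β τ) :=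
    mdifferentiableAt_extChartAt (by rwa [extChartAt_source] at hs)
  have h1 := mfderiv_comp_mfderivWithin (I := 𝓘(ℝ, ℝ)) (I' := 𝓡 (2 * n + 2))
    (I'' := 𝓘(ℝ, EuclideanSpace ℝ (Fin (2 * n + 2)))) τ he hβ hu.uniqueMDiffWithinAt
  have h2 : DifferentiableWithinAt ℝ (extChartAt (𝓡 (2 * n + 2)) y₀ ∘ β) J τ :=
    (he.comp_mdifferentiableWithinAt τ hβ).differentiableWithinAt
  rw [mfderivWithin_eq_fderivWithin] at h1
  exact h2.hasDerivWithinAt.congr_deriv (DFunLike.congr_fun h1 (1 : ℝ))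

/-- Horizontal lifts are determined by one value. -/
theorem IsDifferentiableLift.eqOn [T2Space Y] (hLG : IsSymplecticLGModel Ω v) (hab : a < b)
    (hγ : ContDiffOn ℝ ∞ γ (Icc a b)) (hreg : ∀ t ∈ Icc a b, γ t ∈ regValues n v)
    (h₁ : IsDifferentiableLift Ω v γ (Icc a b) β₁) (h₂ : IsDifferentiableLift Ω v γ (Icc a b) β₂)
    (hτ : τ ∈ Icc a b) (heq : β₁ τ = β₂ τ) : EqOn β₁ β₂ (Icc a b) := by
  have hu : UniqueDiffOn ℝ (Icc a b) := uniqueDiffOn_Icc hab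
  have hloc : ∀ τ ∈ Icc a b, β₁ τ = β₂ τ → ∀ᶠ σ in 𝓝[Icc a b] τ, β₁ σ = β₂ σ := by
    intro τ hτ heq
    obtain ⟨U, P, hU, hyU, -, hP, hiff⟩ :=
      hLG.exists_horizontal_field (y₀ := β₁ τ) (by rw [h₁.lift τ hτ]; exact hreg τ hτ)
    set e := extChartAt (𝓡 (2 * n + 2)) (β₁ τ) with he
    have hnear : ∀ {β : ℝ → Y}, IsDifferentiableLift Ω v γ (Icc a b) β → β τ = β₁ τ →
        ∀ᶠ σ in 𝓝[Icc a b] τ, β σ ∈ e.source ∧ HasDerivWithinAt (fun σ => e (β σ))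
          (P (e (β σ)) (derivWithin γ (Icc a b) σ)) (Icc a b) σ := by
      intro β hβ hβτ
      have hN : e.source ∩ e ⁻¹' U ∈ 𝓝 (β τ) := by
        rw [hβτ]
        exact Filter.inter_mem (extChartAt_source_mem_nhds _)
          ((continuousAt_extChartAt _).preimage_mem_nhds (hU.mem_nhds hyU))
      filter_upwards [(hβ.continuousOn τ hτ).eventually_mem hN, self_mem_nhdsWithin] with σ hσ hσI
      refine ⟨hσ.1, ?_⟩
      refine (hasDerivWithinAt_extChartAt_comp (β₁ τ) (hβ.mdifferentiable σ hσI) (hu σ hσI)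
        hσ.1).congr_deriv ?_
      exact (hiff _ hσ.1 hσ.2 _ _).1
        ⟨hβ.horizontal σ hσI, hβ.mfderiv_apply hLG.smooth hσI (hu σ hσI)⟩
    have hz := eventuallyEq_of_hasDerivWithinAt (g := derivWithin γ (Icc a b))
      (z₁ := fun σ => e (β₁ σ)) (z₂ := fun σ => e (β₂ σ))
      ((hP.contDiffAt (hU.mem_nhds hyU)).of_le (by simp)) hτ
      (hγ.continuousOn_derivWithin hu (by simp)) (by simp only [heq])
      ((hnear h₁ rfl).mono fun σ h => h.2) ((hnear h₂ heq.symm).mono fun σ h => h.2)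
    filter_upwards [hz, hnear h₁ rfl, hnear h₂ heq.symm] with σ hσ hσ₁ hσ₂
    exact e.injOn hσ₁.1 hσ₂.1 hσ
  have hpre : PreconnectedSpace (Icc a b) :=
    isPreconnected_iff_preconnectedSpace.1 isPreconnected_Icc
  set S : Set (Icc a b) := {x | β₁ x = β₂ x} with hS
  have hclopen : IsClopen S := by
    constructor
    · exact isClosed_eq h₁.continuousOn.domRestrict h₂.continuousOn.domRestrict
    · rw [isOpen_iff_mem_nhds]
      intro x hx
      exact preimage_coe_mem_nhds_subtype.2 (hloc x x.2 hx)
  have huniv : S = univ := hclopen.eq_univ ⟨⟨τ, hτ⟩, heq⟩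
  intro σ hσ
  exact (huniv ▸ mem_univ (⟨σ, hσ⟩ : Icc a b) : (⟨σ, hσ⟩ : Icc a b) ∈ S)

theorem IsDifferentiableLift.eqOn_uIcc [T2Space Y] (hLG : IsSymplecticLGModel Ω v)
    (hγ : ContDiffOn ℝ ∞ γ (uIcc a b)) (hreg : ∀ t ∈ uIcc a b, γ t ∈ regValues n v)
    (h₁ : IsDifferentiableLift Ω v γ (uIcc a b) β₁) (h₂ : IsDifferentiableLift Ω v γ (uIcc a b) β₂)
    (hτ : τ ∈ uIcc a b) (heq : β₁ τ = β₂ τ) : EqOn β₁ β₂ (uIcc a b) := by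
  rcases eq_or_ne a b with rfl | hab
  · rw [uIcc_self] at hτ ⊢
    intro σ hσ
    rw [mem_singleton_iff.1 hσ, ← mem_singleton_iff.1 hτ, heq]
  · exact h₁.eqOn hLG (inf_lt_sup.2 hab) hγ hreg h₂ hτ heq

theorem parallelTransport_eq [T2Space Y] (hLG : IsSymplecticLGModel Ω v)
    (hγ : ContDiffOn ℝ ∞ γ (uIcc a b)) (hreg : ∀ t ∈ uIcc a b, γ t ∈ regValues n v)
    (h : IsDifferentiableLift Ω v γ (uIcc a b) β) :
    parallelTransport Ω v γ a b (β a) = β b := by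
  have hex := hLG.exists_lift γ a b hγ hreg (β a) (h.lift a left_mem_uIcc)
  rw [parallelTransport, dif_pos hex]
  exact hex.choose_spec.1.isDifferentiableLift.eqOn_uIcc hLG hγ hreg h left_mem_uIcc
    hex.choose_spec.2 right_mem_uIcc

omit [IsManifold (𝓡 (2 * n + 2)) ∞ Y] in
theorem parallelTransport_self (Ω : DiffForm (𝓡 (2 * n + 2)) Y 2) (v : Y → ℂ) (γ : ℝ → ℂ) (a : ℝ)
    (p : Y) : parallelTransport Ω v γ a a p = p := by
  rw [parallelTransport]
  split_ifs with hex
  · exact hex.choose_spec.2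
  · rfl

theorem parallelTransport_eq_of_univ [T2Space Y] (hLG : IsSymplecticLGModel Ω v)
    (hγ : ContDiff ℝ ∞ γ) (hreg : ∀ t, γ t ∈ regValues n v)
    (h : IsHorizontalLift Ω v γ univ β) (a b : ℝ) :
    parallelTransport Ω v γ a b (β a) = β b := by
  rcases eq_or_ne a b with rfl | hab
  · exact parallelTransport_self Ω v γ a _
  · exact parallelTransport_eq hLG hγ.contDiffOn (fun t _ => hreg t)
      (IsDifferentiableLift.of_univ h (inf_lt_sup.2 hab))

/-- Two lifts over the whole line agree as soon as they agree at one time. -/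
theorem IsHorizontalLift.eq_of_univ [T2Space Y] (hLG : IsSymplecticLGModel Ω v)
    (hγ : ContDiff ℝ ∞ γ) (hreg : ∀ t, γ t ∈ regValues n v)
    (h₁ : IsHorizontalLift Ω v γ univ β₁) (h₂ : IsHorizontalLift Ω v γ univ β₂)
    (heq : β₁ τ = β₂ τ) : β₁ = β₂ := by
  funext σ
  rw [← parallelTransport_eq_of_univ hLG hγ hreg h₁ τ σ, heq,
    parallelTransport_eq_of_univ hLG hγ hreg h₂ τ σ]

/-- Curves over the whole line have global lifts. -/
theorem IsSymplecticLGModel.exists_lift_univ [T2Space Y] (hLG : IsSymplecticLGModel Ω v)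
    (hγ : ContDiff ℝ ∞ γ) (hreg : ∀ t, γ t ∈ regValues n v) {p : Y} (hp : v p = γ a) :
    ∃ β : ℝ → Y, IsHorizontalLift Ω v γ univ β ∧ β a = p := by
  -- lifts with a prescribed value at an interior time: go back to `-R` first, then forward to `R`
  have hstep : ∀ R : ℝ, |a| < R → ∃ β, IsHorizontalLift Ω v γ (Icc (-R) R) β ∧ β a = p := by
    intro R hR
    obtain ⟨ha1, ha2⟩ := abs_lt.1 hR
    obtain ⟨β₁, h₁, hβ₁⟩ := hLG.exists_lift γ a (-R) hγ.contDiffOn (fun t _ => hreg t) p hp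
    obtain ⟨β₂, h₂, hβ₂⟩ := hLG.exists_lift γ (-R) R hγ.contDiffOn (fun t _ => hreg t) (β₁ (-R))
      (h₁.lift _ right_mem_uIcc)
    rw [uIcc_of_ge ha1.le] at h₁
    rw [uIcc_of_le (by linarith)] at h₂
    refine ⟨β₂, h₂, ?_⟩
    have h3 := (h₂.isDifferentiableLift.mono (Icc_subset_Icc_right ha2.le)
      (uniqueDiffOn_Icc ha1)).eqOn hLG ha1 hγ.contDiffOn (fun t _ => hreg t)
      h₁.isDifferentiableLift (left_mem_Icc.2 ha1.le) hβ₂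
    rw [h3 (right_mem_Icc.2 ha1.le), hβ₁]
  have hne : Nonempty Y := ⟨p⟩
  choose! B hB hBa using hstep
  set β : ℝ → Y := fun τ => B (|τ| + |a| + 1) τ with hβ
  have hcmp : ∀ R R' τ, |a| < R → R ≤ R' → |τ| ≤ R → B R τ = B R' τ := by
    intro R R' τ hR hRR' hτ
    have hneg : -R < R := by linarith [abs_nonneg a]
    have ha : a ∈ Icc (-R) R := abs_le.1 hR.le
    exact (hB R hR).isDifferentiableLift.eqOn hLG hneg hγ.contDiffOn (fun t _ => hreg t)
      ((hB R' (hR.trans_le hRR')).isDifferentiableLift.mono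
        (Icc_subset_Icc (by linarith) hRR') (uniqueDiffOn_Icc hneg)) ha
      ((hBa R hR).trans (hBa R' (hR.trans_le hRR')).symm) (abs_le.1 hτ)
  have hev : ∀ τ₀, β =ᶠ[𝓝 τ₀] B (|τ₀| + |a| + 2) := by
    intro τ₀
    filter_upwards [Metric.ball_mem_nhds τ₀ one_pos] with τ hτ
    rw [Metric.mem_ball, Real.dist_eq] at hτ
    have h1 : |τ| ≤ |τ₀| + 1 := by
      have := abs_sub_abs_le_abs_sub τ τ₀
      linarith
    exact hcmp _ _ τ (by linarith [abs_nonneg τ]) (by linarith) (by linarith [abs_nonneg a])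
  have hR : ∀ τ₀, |a| < |τ₀| + |a| + 2 := fun τ₀ => by linarith [abs_nonneg τ₀]
  have hmem : ∀ τ₀, Icc (-(|τ₀| + |a| + 2)) (|τ₀| + |a| + 2) ∈ 𝓝 τ₀ := fun τ₀ =>
    Icc_mem_nhds (by linarith [neg_abs_le τ₀, abs_nonneg a])
      (by linarith [le_abs_self τ₀, abs_nonneg a])
  refine ⟨β, ⟨fun τ₀ _ => ?_, fun τ₀ _ => ?_, fun τ₀ _ => ?_⟩, hBa _ (by linarith [abs_nonneg a])⟩
  · have h1 := ((hB _ (hR τ₀)).smooth τ₀ (mem_of_mem_nhds (hmem τ₀))).contMDiffAt (hmem τ₀)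
    exact (h1.congr_of_eventuallyEq (hev τ₀)).contMDiffWithinAt
  · rw [(hev τ₀).self_of_nhds]
    exact (hB _ (hR τ₀)).lift τ₀ (mem_of_mem_nhds (hmem τ₀))
  · have h1 := (hB _ (hR τ₀)).horizontal τ₀ (mem_of_mem_nhds (hmem τ₀))
    rw [mfderivWithin_of_mem_nhds (hmem τ₀)] at h1
    rw [mfderivWithin_univ]
    have h2 := (hev τ₀).mfderiv_eq (I := 𝓘(ℝ, ℝ)) (I' := 𝓡 (2 * n + 2))
    have h3 := mem_hor_congr (hev τ₀).self_of_nhds.symm h1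
    have h4 := DFunLike.congr_fun h2 (1 : ℝ)
    exact (congrArg (fun X : EuclideanSpace ℝ (Fin (2 * n + 2)) =>
      (X : TangentSpace (𝓡 (2 * n + 2)) (β τ₀)) ∈ hor Ω v (β τ₀)) h4).mpr h3

end Lifts

/-! ### Continuous dependence of horizontal lifts -/

section Flow

variable {n : ℕ} {Y : Type*} [TopologicalSpace Y]
  [ChartedSpace (EuclideanSpace ℝ (Fin (2 * n + 2))) Y] [IsManifold (𝓡 (2 * n + 2)) ∞ Y]
  {Ω : DiffForm (𝓡 (2 * n + 2)) Y 2} {v : Y → ℂ} {γ : ℝ → ℂ}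

/-- Locally, horizontal lifts depend continuously on their initial values. -/
theorem IsSymplecticLGModel.exists_local_transport [T2Space Y] (hLG : IsSymplecticLGModel Ω v)
    (hγ : ContDiff ℝ ∞ γ) (hreg : ∀ t, γ t ∈ regValues n v) {y₀ : Y} {τ₀ : ℝ} (hy₀ : v y₀ = γ τ₀) :
    ∃ δ > 0, ∃ W ∈ 𝓝 y₀, ∃ F : Y × ℝ × ℝ → Y,
      ContinuousOn F (W ×ˢ Ioo (τ₀ - δ) (τ₀ + δ) ×ˢ Ioo (τ₀ - δ) (τ₀ + δ)) ∧
      ∀ τ' ∈ Ioo (τ₀ - δ) (τ₀ + δ), ∀ τ ∈ Ioo (τ₀ - δ) (τ₀ + δ), ∀ β : ℝ → Y,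
        IsHorizontalLift Ω v γ univ β → β τ' ∈ W → F (β τ', τ', τ) = β τ := by
  obtain ⟨U, P, hU, hyU, hUt, hP, hiff⟩ :=
    hLG.exists_horizontal_field (y₀ := y₀) (by rw [hy₀]; exact hreg τ₀)
  set e := extChartAt (𝓡 (2 * n + 2)) y₀ with he
  obtain ⟨δ, hδ, O, hO, F, hF, hflow⟩ := exists_local_flow τ₀ (hU.mem_nhds hyU)
    ((hP.contDiffAt (hU.mem_nhds hyU)).of_le (by simp)) hγ
  refine ⟨δ, hδ, e.source ∩ e ⁻¹' O, Filter.inter_mem (extChartAt_source_mem_nhds _)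
    ((continuousAt_extChartAt _).preimage_mem_nhds hO),
    fun x => e.symm (F (e x.1, x.2.1, x.2.2)), ?_, ?_⟩
  · refine (continuousOn_extChartAt_symm y₀).comp (hF.comp ?_ ?_) ?_
    · refine ContinuousOn.prodMk ?_ (by fun_prop)
      exact (continuousOn_extChartAt y₀).comp continuous_fst.continuousOn fun x hx => hx.1.1
    · exact fun x hx => ⟨hx.1.2, hx.2⟩
    · exact fun x hx => hUt ((hflow _ hx.1.2 _ hx.2.1).2 _ hx.2.2).1
  · rintro τ' hτ' τ hτ β hβ ⟨hβs, hβO⟩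
    obtain ⟨h0, hfl⟩ := hflow (e (β τ')) hβO τ' hτ'
    rcases eq_or_ne τ' τ with rfl | hne
    · simp only [h0, e.left_inv hβs]
    set z : ℝ → EuclideanSpace ℝ (Fin (2 * n + 2)) := fun σ => F (e (β τ'), τ', σ) with hz
    set J : Set ℝ := uIcc τ' τ with hJ
    have hJs : J ⊆ Ioo (τ₀ - δ) (τ₀ + δ) := fun σ hσ =>
      ⟨(lt_inf_iff.2 ⟨hτ'.1, hτ.1⟩).trans_le hσ.1, hσ.2.trans_lt (sup_lt_iff.2 ⟨hτ'.2, hτ.2⟩)⟩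
    have hJu : UniqueDiffOn ℝ J := uniqueDiffOn_Icc (inf_lt_sup.2 hne)
    set ξ : ℝ → Y := fun σ => e.symm (z σ) with hξ
    have hξs : ∀ σ ∈ J, ξ σ ∈ e.source := fun σ hσ => e.map_target (hUt (hfl σ (hJs hσ)).1)
    have heξ : ∀ σ ∈ J, e (ξ σ) = z σ := fun σ hσ => e.right_inv (hUt (hfl σ (hJs hσ)).1)
    have hξd : ∀ σ ∈ J, MDifferentiableWithinAt 𝓘(ℝ, ℝ) (𝓡 (2 * n + 2)) ξ J σ := fun σ hσ => by
      have h1 := ((contMDiffOn_extChartAt_symm (I := 𝓡 (2 * n + 2)) (n := ∞) y₀).contMDiffAt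
        ((isOpen_extChartAt_target y₀).mem_nhds (hUt (hfl σ (hJs hσ)).1))).mdifferentiableAt
          (by simp)
      exact h1.comp_mdifferentiableWithinAt σ
        (hfl σ (hJs hσ)).2.differentiableAt.differentiableWithinAt.mdifferentiableWithinAt
    have hgood : ∀ σ ∈ J, mfderivWithin 𝓘(ℝ, ℝ) (𝓡 (2 * n + 2)) ξ J σ (1 : ℝ) ∈ hor Ω v (ξ σ) ∧
        (mfderiv (𝓡 (2 * n + 2)) 𝓘(ℝ, ℂ) v (ξ σ)
          (mfderivWithin 𝓘(ℝ, ℝ) (𝓡 (2 * n + 2)) ξ J σ (1 : ℝ)) : ℂ) = deriv γ σ := by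
      intro σ hσ
      refine (hiff (ξ σ) (hξs σ hσ) ?_ _ _).2 ?_
      · rw [heξ σ hσ]; exact (hfl σ (hJs hσ)).1
      · have h1 := hasDerivWithinAt_extChartAt_comp y₀ (hξd σ hσ) (hJu σ hσ) (hξs σ hσ)
        have h2 : HasDerivWithinAt (fun σ => e (ξ σ)) (P (z σ) (deriv γ σ)) J σ :=
          (hfl σ (hJs hσ)).2.hasDerivWithinAt.congr heξ (heξ σ hσ)
        rw [heξ σ hσ]
        exact (h1.derivWithin (hJu σ hσ)).symm.trans (h2.derivWithin (hJu σ hσ))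
    have hlift : ∀ σ ∈ J, v (ξ σ) = γ σ := by
      have hd : ∀ σ ∈ J, HasDerivWithinAt (fun σ => v (ξ σ) - γ σ) 0 J σ := by
        intro σ hσ
        have h1 := mfderiv_comp_mfderivWithin (I := 𝓘(ℝ, ℝ)) (I' := 𝓡 (2 * n + 2))
          (I'' := 𝓘(ℝ, ℂ)) (g := v) (f := ξ) (s := J) σ (hLG.smooth.mdifferentiable (by simp) _)
          (hξd σ hσ) (hJu σ hσ).uniqueMDiffWithinAt
        have h2 : DifferentiableWithinAt ℝ (v ∘ ξ) J σ :=
          ((hLG.smooth.mdifferentiable (by simp) _).comp_mdifferentiableWithinAt σ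
            (hξd σ hσ)).differentiableWithinAt
        rw [mfderivWithin_eq_fderivWithin] at h1
        have h3 : HasDerivWithinAt (v ∘ ξ) (deriv γ σ) J σ := h2.hasDerivWithinAt.congr_deriv
          ((DFunLike.congr_fun h1 (1 : ℝ)).trans (hgood σ hσ).2)
        exact (h3.sub (hγ.differentiable (by simp) σ).hasDerivAt.hasDerivWithinAt).congr_deriv
          (sub_self _)
      intro σ hσ
      have h1 := (convex_uIcc τ' τ).is_const_of_fderivWithin_eq_zero
        (fun σ hσ => (hd σ hσ).differentiableWithinAt) (fun σ hσ => by
          rw [(hd σ hσ).hasFDerivWithinAt.fderivWithin (hJu σ hσ)]; ext; simp)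
        hσ (y := τ') left_mem_uIcc
      have h2 : ξ τ' = β τ' := by simp only [hξ, hz, h0, e.left_inv hβs]
      rw [h2, hβ.lift τ' (mem_univ _), sub_self, sub_eq_zero] at h1
      exact h1
    have hξl : IsDifferentiableLift Ω v γ (uIcc τ' τ) ξ := ⟨hξd, hlift, fun σ hσ => (hgood σ hσ).1⟩
    refine hξl.eqOn_uIcc hLG hγ.contDiffOn (fun t _ => hreg t)
      (hβ.isDifferentiableLift.mono (subset_univ _) hJu) left_mem_uIcc ?_ right_mem_uIcc
    simp only [hξ, hz, h0, e.left_inv hβs]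

/-- A family of horizontal lifts of the same curve whose initial points depend continuously on a
parameter is jointly continuous. -/
theorem IsSymplecticLGModel.continuous_uncurry_lift [T2Space Y] (hLG : IsSymplecticLGModel Ω v)
    (hγ : ContDiff ℝ ∞ γ) (hreg : ∀ t, γ t ∈ regValues n v) {M : Type*} [TopologicalSpace M]
    {i : M → Y} {t : M → ℝ} {β : M → ℝ → Y} (hi : Continuous i) (ht : Continuous t)
    (hβ : ∀ p, IsHorizontalLift Ω v γ univ (β p)) (hβi : ∀ p, β p (t p) = i p) :
    Continuous (Function.uncurry β) := by
  rw [continuous_iff_continuousAt]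
  rintro ⟨p, τ⟩
  have hc : Continuous (β p) := contMDiffOn_univ.1 (hβ p).smooth |>.continuous
  have key : ∀ τ₀ : ℝ, ∃ δ > 0, ∃ W ∈ 𝓝 (β p τ₀), ∀ s : M → ℝ, ContinuousAt s p →
      s p ∈ Ioo (τ₀ - δ) (τ₀ + δ) → ContinuousAt (fun q => β q (s q)) p → W ∈ 𝓝 (β p (s p)) →
      ∀ τ ∈ Ioo (τ₀ - δ) (τ₀ + δ), ContinuousAt (Function.uncurry β) (p, τ) := by
    intro τ₀
    obtain ⟨δ, hδ, W, hW, F, hF, hFβ⟩ :=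
      hLG.exists_local_transport hγ hreg ((hβ p).lift τ₀ (mem_univ _))
    refine ⟨δ, hδ, W, hW, fun s hs hsp hβs hWs τ hτ => ?_⟩
    have h1 : ContinuousAt (fun x : M × ℝ => F (β x.1 (s x.1), s x.1, x.2)) (p, τ) := by
      have h2 : ContinuousAt F (β p (s p), s p, τ) :=
        hF.continuousAt (prod_mem_nhds hWs (prod_mem_nhds (Ioo_mem_nhds hsp.1 hsp.2)
          (Ioo_mem_nhds hτ.1 hτ.2)))
      refine ContinuousAt.comp (f := fun x : M × ℝ => (β x.1 (s x.1), s x.1, x.2)) h2 ?_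
      refine ContinuousAt.prodMk ?_ (ContinuousAt.prodMk ?_ continuousAt_snd)
      · exact ContinuousAt.comp (f := Prod.fst) (x := (p, τ)) hβs continuousAt_fst
      · exact ContinuousAt.comp (f := Prod.fst) (x := (p, τ)) hs continuousAt_fst
    refine h1.congr ?_
    have e1 : ∀ᶠ q in 𝓝 p, s q ∈ Ioo (τ₀ - δ) (τ₀ + δ) ∧ β q (s q) ∈ W :=
      (hs.eventually_mem (Ioo_mem_nhds hsp.1 hsp.2)).and (hβs.eventually_mem hWs)
    have e2 : ∀ᶠ x : M × ℝ in 𝓝 (p, τ), s x.1 ∈ Ioo (τ₀ - δ) (τ₀ + δ) ∧ β x.1 (s x.1) ∈ W :=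
      (continuousAt_fst : ContinuousAt (Prod.fst : M × ℝ → M) (p, τ)).eventually e1
    have e3 : ∀ᶠ x : M × ℝ in 𝓝 (p, τ), x.2 ∈ Ioo (τ₀ - δ) (τ₀ + δ) :=
      continuousAt_snd.eventually_mem (Ioo_mem_nhds hτ.1 hτ.2)
    filter_upwards [e2, e3] with x hx hx'
    exact hFβ _ hx.1 _ hx' _ (hβ x.1) hx.2
  set S : Set ℝ := {τ | ContinuousAt (Function.uncurry β) (p, τ)} with hS
  have hslice : ∀ τ ∈ S, ContinuousAt (fun q => β q τ) p := fun τ hτ =>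
    ContinuousAt.comp (f := fun q : M => (q, τ)) (x := p) hτ (by fun_prop)
  have hclopen : IsClopen S := by
    constructor
    · rw [← isOpen_compl_iff, isOpen_iff_mem_nhds]
      intro τ₀ hτ₀
      obtain ⟨δ, hδ, W, hW, h⟩ := key τ₀
      filter_upwards [Ioo_mem_nhds (sub_lt_self τ₀ hδ) (lt_add_of_pos_right τ₀ hδ),
        hc.continuousAt.eventually (eventually_mem_nhds_iff.2 hW)] with τ' hτ' hτW hτS
      exact hτ₀ (h (fun _ => τ') continuousAt_const hτ' (hslice τ' hτS) hτW τ₀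
        ⟨sub_lt_self τ₀ hδ, lt_add_of_pos_right τ₀ hδ⟩)
    · rw [isOpen_iff_mem_nhds]
      intro τ₀ hτ₀
      obtain ⟨δ, hδ, W, hW, h⟩ := key τ₀
      filter_upwards [Ioo_mem_nhds (sub_lt_self τ₀ hδ) (lt_add_of_pos_right τ₀ hδ)] with τ hτ
      exact h (fun _ => τ₀) continuousAt_const ⟨sub_lt_self τ₀ hδ, lt_add_of_pos_right τ₀ hδ⟩
        (hslice τ₀ hτ₀) hW τ hτ
  have huniv : S = univ := by
    refine hclopen.eq_univ ⟨t p, ?_⟩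
    obtain ⟨δ, hδ, W, hW, h⟩ := key (t p)
    have hI : t p ∈ Ioo (t p - δ) (t p + δ) := ⟨sub_lt_self _ hδ, lt_add_of_pos_right _ hδ⟩
    refine h t ht.continuousAt hI ?_ hW _ hI
    simp only [hβi]
    exact hi.continuousAt
  exact (huniv ▸ mem_univ τ : τ ∈ S)

end Flow

/-! ### Fibered Lagrangians and transport along a homotopy -/

section FiberedLagrangian

section

variable {n : ℕ} {Y : Type*} [TopologicalSpace Y]
  [ChartedSpace (EuclideanSpace ℝ (Fin (2 * n + 2))) Y] {v : Y → ℂ} {γ : ℝ → ℂ} {N : Set ℝ}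
  {h : ℝ → ℝ → ℂ}

theorem IsBaseHomotopy.contDiffOn_left (hh : IsBaseHomotopy n v γ N h) (τ : ℝ) :
    ContDiffOn ℝ ∞ (fun s => h s τ) (Icc 0 1) :=
  hh.smooth.comp (contDiff_id.prodMk contDiff_const).contDiffOn fun _ hs => ⟨hs, mem_univ _⟩

theorem IsBaseHomotopy.contDiff_right (hh : IsBaseHomotopy n v γ N h) {s : ℝ}
    (hs : s ∈ Icc (0 : ℝ) 1) : ContDiff ℝ ∞ (h s) :=
  contDiffOn_univ.1 (hh.smooth.comp (contDiff_const.prodMk contDiff_id).contDiffOn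
    fun _ _ => ⟨hs, mem_univ _⟩)

end

variable {n : ℕ} {Y : Type*} [TopologicalSpace Y] [T2Space Y]
  [ChartedSpace (EuclideanSpace ℝ (Fin (2 * n + 2))) Y] [IsManifold (𝓡 (2 * n + 2)) ∞ Y]
  {Ω : DiffForm (𝓡 (2 * n + 2)) Y 2} {v : Y → ℂ} {γ : ℝ → ℂ}
  {ℓ : Set Y} [ChartedSpace (EuclideanSpace ℝ (Fin n)) ℓ]
  {L : Set Y} [ChartedSpace (EuclideanSpace ℝ (Fin (n + 1))) L]

/-- A fibered Lagrangian carries the time function `t` with `γ ∘ t = v` and is foliated by the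
horizontal lifts of `γ`, which form a transverse flow. -/
theorem IsFiberedLagrangian.exists_transverseFlow (hLG : IsSymplecticLGModel Ω v)
    (hL : IsFiberedLagrangian Ω v γ ℓ L) :
    ∃ (t : L → ℝ) (c : L → ℝ → L), IsTransverseFlow (E := EuclideanSpace ℝ (Fin (n + 1))) t c ∧
      (∀ p, γ (t p) = v p) ∧ ∀ p, IsHorizontalLift Ω v γ univ (fun τ => (c p τ : Y)) := by
  have hγ : ContDiff ℝ ∞ γ := hL.curve_embedding.contMDiff.contDiff
  have hγi : Function.Injective γ := hL.curve_embedding.isEmbedding.injective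
  have hex : ∀ p : L, ∃ (τ : ℝ) (β : ℝ → Y), IsHorizontalLift Ω v γ univ β ∧ β τ = p ∧
      ∀ σ, β σ ∈ L := by
    rintro ⟨p, hp⟩
    have h1 := hp
    rw [hL.eq_transport, mem_iUnion] at h1
    obtain ⟨τ, q, hq, hqp⟩ := h1
    obtain ⟨β, hβ, rfl⟩ := hLG.exists_lift_univ hγ hL.curve_regular (a := 0) (p := q)
      (hL.fiberLagrangian.subset_fiber q hq)
    have h2 := parallelTransport_eq_of_univ hLG hγ hL.curve_regular hβ 0
    refine ⟨τ, β, hβ, (h2 τ).symm.trans hqp, fun σ => ?_⟩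
    rw [hL.eq_transport, mem_iUnion]
    exact ⟨σ, β 0, hq, h2 σ⟩
  choose t β hβ hβt hβL using hex
  have hγt : ∀ p : L, γ (t p) = v p := fun p => by
    rw [← hβt p, (hβ p).lift _ (mem_univ _), ]
  have htc : Continuous t := by
    rw [hL.curve_embedding.isEmbedding.continuous_iff]
    exact (hLG.smooth.continuous.comp continuous_subtype_val).congr fun p => (hγt p).symm
  have hts : ContMDiff (𝓡 (n + 1)) 𝓘(ℝ, ℝ) ∞ t := by
    rw [ContMDiff.iff_comp_isImmersion hL.curve_embedding.isImmersion]
    refine ⟨htc, (hLG.smooth.comp hL.embedding.contMDiff).congr hγt⟩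
  have htime : ∀ p τ, t ⟨β p τ, hβL p τ⟩ = τ := fun p τ =>
    hγi ((hγt _).trans ((hβ p).lift τ (mem_univ _)))
  have hββ : ∀ p τ, β ⟨β p τ, hβL p τ⟩ = β p := fun p τ => by
    refine (hβ _).eq_of_univ hLG hγ hL.curve_regular (hβ p) (τ := τ) ?_
    have h1 := hβt ⟨β p τ, hβL p τ⟩
    rwa [htime] at h1
  refine ⟨t, fun p τ => ⟨β p τ, hβL p τ⟩, ⟨hts, ?_, fun p => ?_, fun p => Subtype.ext (hβt p),
    htime, fun p τ => ?_⟩, hγt, hβ⟩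
  · exact (hLG.continuous_uncurry_lift hγ hL.curve_regular continuous_subtype_val htc hβ
      hβt).subtype_mk _
  · have h1 : ContMDiff 𝓘(ℝ, ℝ) (𝓡 (2 * n + 2)) ∞ (β p) := contMDiffOn_univ.1 (hβ p).smooth
    rw [ContMDiff.iff_comp_isImmersion hL.embedding.isImmersion]
    exact ⟨h1.continuous.subtype_mk _, h1⟩
  · funext σ
    exact Subtype.ext (congrFun (hββ p τ) σ)

variable {N : Set ℝ} {h : ℝ → ℝ → ℂ}

/-- The transport of `p` along `s ↦ h s τ` is a single horizontal lift. -/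
theorem IsBaseHomotopy.exists_lift (hLG : IsSymplecticLGModel Ω v)
    (hh : IsBaseHomotopy n v γ N h) {p : Y} {τ : ℝ} (hp : v p = γ τ) :
    ∃ β, IsHorizontalLift Ω v (fun s => h s τ) (Icc 0 1) β ∧
      ∀ s ∈ Icc (0 : ℝ) 1, parallelTransport Ω v (fun s => h s τ) 0 s p = β s := by
  have h01 : uIcc (0 : ℝ) 1 = Icc 0 1 := uIcc_of_le zero_le_one
  obtain ⟨β, hβ, hβ0⟩ := hLG.exists_lift (fun s => h s τ) 0 1 (h01 ▸ hh.contDiffOn_left τ)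
    (fun s hs => hh.regular s (h01 ▸ hs) τ) p (hp.trans (hh.start τ).symm)
  rw [h01] at hβ
  refine ⟨β, hβ, fun s hs => ?_⟩
  subst hβ0
  rcases hs.1.eq_or_lt with rfl | hs0
  · exact parallelTransport_self _ _ _ _ _
  · have hsub : uIcc 0 s ⊆ Icc (0 : ℝ) 1 := by
      rw [uIcc_of_le hs.1]; exact Icc_subset_Icc_right hs.2
    refine parallelTransport_eq hLG ((hh.contDiffOn_left τ).mono hsub)
      (fun s' hs' => hh.regular s' (hsub hs') τ) (hβ.isDifferentiableLift.mono hsub ?_)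
    rw [uIcc_of_le hs.1]
    exact uniqueDiffOn_Icc hs0

/-- If `ψ` is the transport along `h`, then `∂_s ψ` is horizontal, so the slice forms vanish on
the vectors that `ψ_s` maps to vertical ones. -/
theorem sliceForm_eq_zero_of_parallelTransport (hLG : IsSymplecticLGModel Ω v)
    (hh : IsBaseHomotopy n v γ N h) {t : L → ℝ} (ht : ContMDiff (𝓡 (n + 1)) 𝓘(ℝ, ℝ) ∞ t)
    (hγt : ∀ p : L, γ (t p) = v p) {ψ : L × unitInterval → Y}
    (hψ : ContMDiff ((𝓡 (n + 1)).prod (𝓡∂ 1)) (𝓡 (2 * n + 2)) ∞ ψ)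
    (hψt : ∀ (p : L) (s : unitInterval),
      ψ (p, s) = parallelTransport Ω v (fun s' => h s' (t p)) 0 s p)
    (s : unitInterval) (p : L) (X : TangentSpace (𝓡 (n + 1)) p)
    (hX : mfderiv (𝓡 (n + 1)) 𝓘(ℝ, ℝ) t p X = 0) : sliceForm Ω ψ s p X = 0 := by
  have hlift : ∀ (p : L) (s : unitInterval), v (ψ (p, s)) = h s (t p) := fun p s => by
    obtain ⟨β, hβ, hβs⟩ := hh.exists_lift hLG (hγt p).symm
    rw [hψt, hβs s s.2, hβ.lift s s.2]
  -- the vector `dψ_s X` is vertical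
  have hvert : mfderiv (𝓡 (n + 1)) (𝓡 (2 * n + 2)) (fun p => ψ (p, s)) p X ∈ vert v (ψ (p, s)) := by
    have h1 := mfderiv_comp (I := 𝓡 (n + 1)) (I' := 𝓡 (2 * n + 2)) (I'' := 𝓘(ℝ, ℂ)) (g := v)
      (f := fun p => ψ (p, s)) p (hLG.smooth.mdifferentiable (by simp) _)
      ((contMDiff_slice_left hψ s).mdifferentiable (by simp) p)
    have h2 := mfderiv_comp (I := 𝓡 (n + 1)) (I' := 𝓘(ℝ, ℝ)) (I'' := 𝓘(ℝ, ℂ)) (g := h s)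
      (f := t) p ((hh.contDiff_right s.2).contMDiff.mdifferentiable (n := ∞) (by simp) _)
      (ht.mdifferentiable (by simp) p)
    have key : ∀ f : L → ℂ, (v ∘ fun p => ψ (p, s)) = f →
        (mfderiv (𝓡 (n + 1)) 𝓘(ℝ, ℂ) (v ∘ fun p => ψ (p, s)) p X : ℂ) =
          mfderiv (𝓡 (n + 1)) 𝓘(ℝ, ℂ) f p X := by
      rintro _ rfl; rfl
    refine (DFunLike.congr_fun h1 X).symm.trans ((key (h s ∘ t)
      (funext fun p => hlift p s)).trans ((DFunLike.congr_fun h2 X).trans ?_))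
    exact (congrArg (mfderiv 𝓘(ℝ, ℝ) 𝓘(ℝ, ℂ) (h s) (t p)) hX).trans (map_zero _)
  -- the vector `∂_s ψ` is horizontal
  have hhor : mfderiv (𝓡∂ 1) (𝓡 (2 * n + 2)) (fun s => ψ (p, s)) s 1 ∈ hor Ω v (ψ (p, s)) := by
    obtain ⟨β, hβ, hβs⟩ := hh.exists_lift hLG (hγt p).symm
    have h1 : ∀ σ ∈ Icc (0 : ℝ) 1,
        ((fun s => ψ (p, s)) ∘ projIcc 0 1 zero_le_one) σ = β σ := fun σ hσ => by
      rw [Function.comp_apply, projIcc_of_mem _ hσ, hψt]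
      exact hβs σ hσ
    have h2 := mfderivWithin_comp_projIcc_one (x := (0 : ℝ)) (y := 1) (I := 𝓡 (2 * n + 2))
      (f := fun s => ψ (p, s)) (w := s)
    have h3 := mfderivWithin_congr (I := 𝓘(ℝ, ℝ)) (I' := 𝓡 (2 * n + 2)) h1 (h1 s s.2)
    have h4 : β s = ψ (p, s) := ((hψt p s).trans (hβs s s.2)).symm
    have h5 := mem_hor_congr h4 (hβ.horizontal s s.2)
    have h6 := h2.symm.trans (DFunLike.congr_fun h3 (1 : ℝ))
    exact (congrArg (fun X : EuclideanSpace ℝ (Fin (2 * n + 2)) =>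
      (X : TangentSpace (𝓡 (2 * n + 2)) (ψ (p, s))) ∈ hor Ω v (ψ (p, s))) h6).mpr h5
  rw [sliceForm, ContinuousAlternatingMap.apply_swap_two, hhor _ hvert, neg_zero]

end FiberedLagrangian

end

theorem lemma2 {n : ℕ} {Y : Type*} [TopologicalSpace Y] [T2Space Y] [SecondCountableTopology Y]
    [ChartedSpace (EuclideanSpace ℝ (Fin (2 * n + 2))) Y] [IsManifold (𝓡 (2 * n + 2)) ∞ Y]
    (Ω : DiffForm (𝓡 (2 * n + 2)) Y 2) (v : Y → ℂ) (hLG : IsSymplecticLGModel Ω v)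
    (γ : ℝ → ℂ)
    (ℓ : Set Y) [ChartedSpace (EuclideanSpace ℝ (Fin n)) ℓ] [IsManifold (𝓡 n) ∞ ℓ]
    (L : Set Y) [ChartedSpace (EuclideanSpace ℝ (Fin (n + 1))) L] [IsManifold (𝓡 (n + 1)) ∞ L]
    (hL : IsFiberedLagrangian Ω v γ ℓ L)
    (ε : ℝ) (hε : 0 < ε) (t₀ : ℝ) (hγ : γ t₀ = -(ε : ℂ))
    (N : Set ℝ) (h : ℝ → ℝ → ℂ) (hh : IsBaseHomotopy n v γ N h) :
    -- every point of `L` is the transport of a unique point of the fiber of `L` over `-ε`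
    (∀ p ∈ L, ∃! qt : Y × ℝ, qt.1 ∈ L ∧ v qt.1 = -(ε : ℂ) ∧
      p = parallelTransport Ω v γ t₀ qt.2 qt.1) ∧
    -- a Lagrangian isotopy (more generally, family) given by parallel transport along the homotopy `h` is exact
    ∀ ψ : L × unitInterval → Y, IsLagrangianFamily Ω ψ →
      (∀ (p : L) (q : Y) (t : ℝ), q ∈ L → v q = -(ε : ℂ) →
        (p : Y) = parallelTransport Ω v γ t₀ t q →
        ∀ s : unitInterval,
          ψ (p, s) = parallelTransport Ω v (fun s' => h s' t) 0 s p) →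
      IsExactFamily Ω ψ ∧
      -- and every closed `1`-form `b` with `ψ^* Ω = b ∧ ds` is exact
      ∀ b : DiffForm ((𝓡 (n + 1)).prod (𝓡∂ 1)) (L × unitInterval) 1,
        b.IsSmooth _ → b.IsClosed _ → PullbackEqWedgeDs Ω ψ b →
        ∃ H : L × unitInterval → ℝ,
          ContMDiff ((𝓡 (n + 1)).prod (𝓡∂ 1)) 𝓘(ℝ, ℝ) ∞ H ∧ b = DiffForm.d _ H := by
  obtain ⟨t, c, hc, hγt, hclift⟩ := hL.exists_transverseFlow hLG
  have hγs : ContDiff ℝ ∞ γ := hL.curve_embedding.contMDiff.contDiff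
  have hγi : Function.Injective γ := hL.curve_embedding.isEmbedding.injective
  have hPT : ∀ (p : L) (a b : ℝ), parallelTransport Ω v γ a b (c p a) = c p b := fun p a b =>
    parallelTransport_eq_of_univ hLG hγs hL.curve_regular (hclift p) a b
  have hfib : ∀ p : L, v (c p t₀) = -(ε : ℂ) := fun p =>
    ((hclift p).lift t₀ (mem_univ _)).trans hγ
  have hpt : ∀ p : L, (p : Y) = parallelTransport Ω v γ t₀ (t p) (c p t₀) := fun p => by
    rw [hPT, hc.curve_time]
  refine ⟨fun p hp => ?_, fun ψ hψ hψt => ?_⟩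
  · refine ⟨(c ⟨p, hp⟩ t₀, t ⟨p, hp⟩), ⟨Subtype.coe_prop _, hfib _, hpt ⟨p, hp⟩⟩, ?_⟩
    rintro ⟨q, τ⟩ ⟨hq, hqε, hpq⟩
    simp only at hq hqε hpq
    have htq : t ⟨q, hq⟩ = t₀ := hγi ((hγt _).trans (hqε.trans hγ.symm))
    have hcq : c ⟨q, hq⟩ t₀ = ⟨q, hq⟩ := htq ▸ hc.curve_time ⟨q, hq⟩
    have hcp : (⟨p, hp⟩ : L) = c ⟨q, hq⟩ τ := by
      refine Subtype.ext (hpq.trans ?_)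
      rw [← hPT _ t₀ τ, hcq]
    rw [hcp, hc.time_curve, hc.curve_curve, hcq]
  · have hψ' : ∀ (p : L) (s : unitInterval),
        ψ (p, s) = parallelTransport Ω v (fun s' => h s' (t p)) 0 s p := fun p s =>
      hψt p (c p t₀) (t p) (Subtype.coe_prop _) (hfib p) (hpt p) s
    obtain ⟨H, hH, hHd⟩ := hc.exists_primitive hLG.symplectic.smooth hLG.symplectic.closed
      hψ.smooth hψ.lagrangian
      (sliceForm_eq_zero_of_parallelTransport hLG hh hc.contMDiff_time hγt hψ.smooth hψ')
    refine ⟨⟨H, hH, (pullback_eq_wedge_iff hψ.smooth hψ.lagrangian _).2 fun s p X => ?_⟩,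
      fun b hb hbc hbψ => ?_⟩
    · rw [DiffForm.d_apply, mfderiv_tangentInl (hH.mdifferentiable (by simp) (p, s))]
      exact hHd s p X
    · refine exists_potential hb hbc hH fun s p X => ?_
      rw [(pullback_eq_wedge_iff hψ.smooth hψ.lagrangian b).1 hbψ]
      exact (hHd s p X).symm
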